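/- There are absolute constants $K>0$ and $m\in\mathbb{N}$ such that the following holds. Let $G$ be a finite abelian group of odd order, and write $\mu_G(S)=|S|/|G|$ for $S\subset G$. Let $\Gamma$ be a set of $k\ge 0$ characters of $G$, let $\delta:\Gamma\to(0,2]$, and let $B=\{x\in G: |1-\gamma(x)|\le\delta_\gamma \text{ for all }\gamma\in\Gamma\}$ be the corresponding Bohr set of rank $k$. Let $A\subset B$ have relative density $\alpha=\mu_G(A)/\mu_G(B)>0$, and put $$T(1_A,1_A,1_A)=\frac{1}{|G|^2}\sum_{x,y\in G}1_A(x-y)\,1_A(x)\,1_A(x+y).$$ Then $$T(1_A,1_A,1_A)=\exp(-X)\,\mu_G(B)^2\quad\text{for some real } X \text{ with}\quad 0\le X\le K\,(k+\alpha^{-2})\,\bigl(\log(2(k+\alpha^{-2}))\bigr)^{m}.$$ -/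

import Mathlib

open scoped BigOperators

noncomputable section

/-- A Bohr set on the finite abelian group `G`, with a fixed choice of frequency set `Γ` (a finite
set of characters of `G`; characters of a finite group take values in the unit circle of `ℂ`)
and width function `δ ∈ (0, 2]^Γ`. The values of `width` outside `freq` play no role. -/
structure BohrSet (G : Type*) [AddCommGroup G] where
  /-- the frequency set `Γ` -/
  freq : Finset (AddChar G ℂ)
  /-- the width function `δ` -/
  width : AddChar G ℂ → ℝ
  width_mem : ∀ γ ∈ freq, width γ ∈ Set.Ioc (0 : ℝ) 2

/-- The underlying set `{x ∈ G : |1 - γ(x)| ≤ δ_γ for all γ ∈ Γ}`. -/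
def BohrSet.carrier {G : Type*} [AddCommGroup G] (B : BohrSet G) : Set G :=
  {x | ∀ γ ∈ B.freq, ‖1 - γ x‖ ≤ B.width γ}

/-- The rank of a Bohr set: the size of its frequency set. -/
def BohrSet.rank {G : Type*} [AddCommGroup G] (B : BohrSet G) : ℕ := B.freq.card

/-- Haar probability measure `μ_G(S) = |S| / |G|` on a finite group. -/
def haarProb (G : Type*) [Fintype G] (S : Set G) : ℝ := (S.ncard : ℝ) / (Fintype.card G : ℝ)

/-- The trilinear form counting three-term progressions `(x - y, x, x + y)`:
`T(f, g, h) = ∫∫ f(x - y) g(x) h(x + y) dμ_G(x) dμ_G(y)`. -/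
def threeAP {G : Type*} [AddCommGroup G] [Fintype G] (f g h : G → ℝ) : ℝ :=
  ((Fintype.card G : ℝ) ^ 2)⁻¹ * ∑ x : G, ∑ y : G, f (x - y) * g x * h (x + y)

/-- The indicator function `1_A`. -/
def ind {G : Type*} (A : Set G) : G → ℝ := Set.indicator A (fun _ => 1)

end

/-! The proof is a density increment relative to Bohr sets. Each increment multiplies the density by
201/200 and adds at most m = O(α^{-2}) frequencies, so n = O(log(4/α)) increments suffice and the
rank never exceeds some D = O((k + α^{-2}) log). Each one shrinks widths by a factor polynomial in
J, where J is proportional to (D + 1)⌈1/ε⌉. By `card_bohr_le` this costs J^{O(D)} in size, so the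
total loss is J^{O(Dn)}. The three logarithms of the final bound come from D, n and log J.

The increment (`increment_of_few_aps`) uses a wide regular Bohr set carrying the end points A₁ and a
much narrower one carrying the midpoints A₂. If there are few progressions, the balanced function of
A₁ has large Fourier mass at characters γ for which 2γ lies in the large spectrum of A₂
(`spectral_mass`). Suppose that spectrum contains about α^{-2} separated characters. They are almost
orthogonal on the Bohr set, and a Bessel inequality makes A₂ denser on a translate of a smaller Bohr
set (`increment_of_spectrum`). Otherwise fewer than m characters, with the trivial one, cover it.
Once these are added as frequencies, every γ carrying the mass is nearly 1 on the doubled new Bohr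
set, and an L² argument makes A₁ denser there (`increment_of_mass`). Doubling is an automorphism in
odd order, so the dilation can be undone.

The iteration must start on a regular Bohr set, but the given one has arbitrary widths, and merely
passing to a smaller Bohr set could lose a factor exponential in k in the density, ruining the
α^{-2}. Instead the Bohr set is lifted to the lattice points of a box in ℝ^k. `exists_regular_slice`
cuts this box by cosets of subspaces until the slice is stable under perturbations that are small
relative to its own widths. Stability is proved by contracting the perturbed slice towards an
interior point and rounding randomly to lattice vectors (`ChainSpace.exists_rounding`).
`exists_denseOn_translate` then provides a translate of a regular Bohr set on which the density is
still at least α/4. -/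

/-! ### Sizes and regularity of Bohr sets. -/

section BohrFinset

variable {G : Type*} [AddCommGroup G] [Fintype G]

/-- The Bohr set with frequency set `Γ` and widths `w`, as a finset. -/
noncomputable def bohr (Γ : Finset (AddChar G ℂ)) (w : AddChar G ℂ → ℝ) : Finset G :=
  Finset.univ.filter fun x => ∀ γ ∈ Γ, ‖1 - γ x‖ ≤ w γ

lemma mem_bohr {Γ : Finset (AddChar G ℂ)} {w : AddChar G ℂ → ℝ} {x : G} :
    x ∈ bohr Γ w ↔ ∀ γ ∈ Γ, ‖1 - γ x‖ ≤ w γ := by simp [bohr]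

lemma norm_one_sub_add_le (γ : AddChar G ℂ) (x y : G) :
    ‖1 - γ (x + y)‖ ≤ ‖1 - γ x‖ + ‖1 - γ y‖ := by
  have h : 1 - γ (x + y) = (1 - γ x) + γ x * (1 - γ y) := by
    rw [AddChar.map_add_eq_mul]; ring
  rw [h]
  refine (norm_add_le _ _).trans ?_
  rw [norm_mul, AddChar.norm_apply, one_mul]

lemma norm_one_sub_neg (γ : AddChar G ℂ) (x : G) : ‖1 - γ (-x)‖ = ‖1 - γ x‖ := by
  have h : 1 - γ x = -(γ x * (1 - γ (-x))) := by
    rw [mul_sub, ← AddChar.map_add_eq_mul]; simp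
  rw [h, norm_neg, norm_mul, AddChar.norm_apply, one_mul]

lemma norm_one_sub_sub (γ : AddChar G ℂ) (x y : G) : ‖1 - γ (x - y)‖ = ‖γ x - γ y‖ := by
  have h : γ x - γ y = -(γ y * (1 - γ (x - y))) := by
    rw [mul_sub, ← AddChar.map_add_eq_mul]; simp
  rw [h, norm_neg, norm_mul, AddChar.norm_apply, one_mul]

lemma norm_one_sub_le_two (γ : AddChar G ℂ) (x : G) : ‖1 - γ x‖ ≤ 2 := by
  refine (norm_sub_le _ _).trans ?_
  rw [AddChar.norm_apply, norm_one]; norm_num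

lemma zero_mem_bohr {Γ : Finset (AddChar G ℂ)} {w : AddChar G ℂ → ℝ} (hw : ∀ γ ∈ Γ, 0 ≤ w γ) :
    (0 : G) ∈ bohr Γ w := by
  rw [mem_bohr]; intro γ hγ; simpa using hw γ hγ

lemma neg_mem_bohr {Γ : Finset (AddChar G ℂ)} {w : AddChar G ℂ → ℝ} {x : G} :
    -x ∈ bohr Γ w ↔ x ∈ bohr Γ w := by
  simp only [mem_bohr, norm_one_sub_neg]

lemma bohr_mono {Γ : Finset (AddChar G ℂ)} {w w' : AddChar G ℂ → ℝ} (h : ∀ γ ∈ Γ, w γ ≤ w' γ) :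
    bohr Γ w ⊆ bohr Γ w' := by
  intro x hx
  rw [mem_bohr] at hx ⊢
  exact fun γ hγ => (hx γ hγ).trans (h γ hγ)

lemma add_mem_bohr {Γ : Finset (AddChar G ℂ)} {w w' w'' : AddChar G ℂ → ℝ} {x y : G}
    (hx : x ∈ bohr Γ w) (hy : y ∈ bohr Γ w') (h : ∀ γ ∈ Γ, w γ + w' γ ≤ w'' γ) :
    x + y ∈ bohr Γ w'' := by
  rw [mem_bohr] at *
  intro γ hγ
  have := norm_one_sub_add_le γ x y
  linarith [hx γ hγ, hy γ hγ, h γ hγ]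

lemma bohr_card_pos {Γ : Finset (AddChar G ℂ)} {w : AddChar G ℂ → ℝ} (hw : ∀ γ ∈ Γ, 0 ≤ w γ) :
    (0 : ℝ) < (bohr Γ w).card := by
  exact_mod_cast Finset.card_pos.2 ⟨0, zero_mem_bohr hw⟩

lemma norm_le_of_floor_eq {M : ℕ} (hM : 1 ≤ M) {r : ℝ} (hr : 0 < r) {z z' : ℂ}
    (h1 : ⌊2 * M * z.re / r⌋ = ⌊2 * M * z'.re / r⌋)
    (h2 : ⌊2 * M * z.im / r⌋ = ⌊2 * M * z'.im / r⌋) : ‖z - z'‖ ≤ r / M := by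
  have hM' : (0 : ℝ) < M := by exact_mod_cast hM
  have key : ∀ a b : ℝ, ⌊2 * M * a / r⌋ = ⌊2 * M * b / r⌋ → |a - b| ≤ r / M / 2 := by
    intro a b hab
    have := Int.abs_sub_lt_one_of_floor_eq_floor hab
    have e : 2 * M * a / r - 2 * M * b / r = (a - b) * (2 * M / r) := by ring
    rw [e, abs_mul, abs_of_pos (show (0 : ℝ) < 2 * M / r by positivity)] at this
    have e2 : r / M / 2 = 1 / (2 * M / r) := by field_simp
    rw [e2, le_div_iff₀ (by positivity)]
    exact this.le
  calc ‖z - z'‖ ≤ |(z - z').re| + |(z - z').im| := Complex.norm_le_abs_re_add_abs_im _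
    _ ≤ r / M / 2 + r / M / 2 := by
        rw [Complex.sub_re, Complex.sub_im]
        exact add_le_add (key _ _ h1) (key _ _ h2)
    _ = r / M := by ring

lemma floor_mem_Icc {M : ℕ} {r a : ℝ} (hr : 0 < r) (h : |a| ≤ r) :
    ⌊2 * M * a / r⌋ ∈ Finset.Icc (-(2 * M : ℤ)) (2 * M) := by
  have h1 := abs_le.1 h
  have h2 : -1 ≤ a / r := by rw [le_div_iff₀ hr]; linarith
  have h3 : a / r ≤ 1 := by rw [div_le_iff₀ hr]; linarith
  have hM : (0 : ℝ) ≤ 2 * M := by positivity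
  have e : 2 * M * a / r = 2 * M * (a / r) := by ring
  rw [Finset.mem_Icc]
  constructor
  · rw [Int.le_floor, e]; push_cast; nlinarith
  · rw [← Int.cast_le (R := ℝ)]
    refine (Int.floor_le _).trans ?_
    rw [e]; push_cast; nlinarith

/-- Shrinking all widths of a Bohr set of rank `d` by a factor `M` costs at most a factor
`(5M)^{2d}` in size. -/
lemma card_bohr_le (Γ : Finset (AddChar G ℂ)) {w w' : AddChar G ℂ → ℝ} {M : ℕ} (hM : 1 ≤ M)
    (hw : ∀ γ ∈ Γ, 0 < w γ) (hw' : ∀ γ ∈ Γ, w γ / M ≤ w' γ) :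
    ((bohr Γ w).card : ℝ) ≤ (5 * M : ℝ) ^ (2 * Γ.card) * (bohr Γ w').card := by
  classical
  let cell : G → (↥Γ → ℤ × ℤ) := fun x γ =>
    (⌊2 * M * (1 - γ.1 x).re / w γ.1⌋, ⌊2 * M * (1 - γ.1 x).im / w γ.1⌋)
  let T : Finset (↥Γ → ℤ × ℤ) := Fintype.piFinset fun _ =>
    Finset.Icc (-(2 * M : ℤ)) (2 * M) ×ˢ Finset.Icc (-(2 * M : ℤ)) (2 * M)
  have hT : ∀ x ∈ bohr Γ w, cell x ∈ T := by
    intro x hx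
    rw [mem_bohr] at hx
    rw [Fintype.mem_piFinset]
    intro γ
    rw [Finset.mem_product]
    exact ⟨floor_mem_Icc (hw _ γ.2) ((Complex.abs_re_le_norm _).trans (hx _ γ.2)),
      floor_mem_Icc (hw _ γ.2) ((Complex.abs_im_le_norm _).trans (hx _ γ.2))⟩
  -- Two points of one cell differ by an element of `bohr Γ w'`, so subtracting a fixed point of the
  -- cell injects the cell there.
  have hfib : ∀ b ∈ T, ((bohr Γ w).filter fun x => cell x = b).card ≤ (bohr Γ w').card := by
    intro b _
    rcases Finset.eq_empty_or_nonempty ((bohr Γ w).filter fun x => cell x = b) with h | ⟨x0, h0⟩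
    · rw [h]; simp
    · refine Finset.card_le_card_of_injOn (fun x => x - x0) ?_ (fun a _ b _ h => by simpa using h)
      intro x hx
      rw [Finset.mem_coe, Finset.mem_filter] at hx
      rw [Finset.mem_filter] at h0
      rw [Finset.mem_coe, mem_bohr]
      intro γ hγ
      have hc : cell x ⟨γ, hγ⟩ = cell x0 ⟨γ, hγ⟩ := by rw [hx.2, h0.2]
      have h1 := congrArg Prod.fst hc
      have h2 := congrArg Prod.snd hc
      have := norm_le_of_floor_eq hM (hw γ hγ) h1 h2
      rw [norm_one_sub_sub]
      have e : (1 - γ x) - (1 - γ x0) = -(γ x - γ x0) := by ring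
      rw [e, norm_neg] at this
      exact this.trans (hw' γ hγ)
  have hcard := Finset.card_le_mul_card_image_of_maps_to hT _ hfib
  have hTc : T.card = ((4 * M + 1) ^ 2) ^ Γ.card := by
    have h0 : (2 * (M : ℤ) + 1 - -(2 * M)).toNat = 4 * M + 1 := by omega
    simp only [T, Fintype.card_piFinset, Finset.card_product, Int.card_Icc, h0,
      Finset.prod_const, Finset.card_univ, Fintype.card_coe]
    ring
  have h5 : (T.card : ℝ) ≤ (5 * M : ℝ) ^ (2 * Γ.card) := by
    rw [hTc, pow_mul]; push_cast
    gcongr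
    have : (1 : ℝ) ≤ M := by exact_mod_cast hM
    linarith
  calc ((bohr Γ w).card : ℝ) ≤ (bohr Γ w').card * T.card := by exact_mod_cast hcard
    _ ≤ (bohr Γ w').card * (5 * M : ℝ) ^ (2 * Γ.card) := by gcongr
    _ = _ := mul_comm _ _

/-- A Bohr set which grows by a factor at most `1 + ε` when its widths are scaled by `1 + ρ`. -/
def RegularBohr (ε ρ : ℝ) (Γ : Finset (AddChar G ℂ)) (w : AddChar G ℂ → ℝ) : Prop :=
  ((bohr Γ ((1 + ρ) • w)).card : ℝ) ≤ (1 + ε) * (bohr Γ w).card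

/-- Pigeonhole over the scales (1+ρ)^{-j}, j ≤ J. Since (1+ρ)^J ≤ exp(1/2) ≤ 2 they all lie in [1/2,
1]. If none were regular the size would fall by (1+ε)^J, which exceeds 100^D because (1+ε)^{⌈1/ε⌉} ≥
2 and 2^7 > 100, whereas halving the widths costs at most 10^{2D}. -/
lemma exists_regularBohr (Γ : Finset (AddChar G ℂ)) {w : AddChar G ℂ → ℝ}
    (hw : ∀ γ ∈ Γ, 0 < w γ) {ε : ℝ} (hε : 0 < ε) {D J : ℕ} (hΓ : Γ.card ≤ D)
    (hJ : J = 7 * (D + 1) * ⌈1 / ε⌉₊) :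
    ∃ l : ℝ, 1 / 2 ≤ l ∧ l ≤ 1 ∧ RegularBohr ε (1 / (2 * J)) Γ (l • w) := by
  have hn : (0 : ℝ) < ⌈1 / ε⌉₊ := lt_of_lt_of_le (by positivity) (Nat.le_ceil (1 / ε))
  have hJ0 : (0 : ℝ) < J := by rw [hJ]; push_cast; positivity
  have hJ1 : 1 ≤ J := by exact_mod_cast hJ0
  set ρ : ℝ := 1 / (2 * J) with hρ
  have hρ0 : 0 < ρ := by positivity
  have hup : (1 + ρ) ^ J ≤ 2 := by
    calc (1 + ρ) ^ J ≤ (Real.exp ρ) ^ J := by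
          gcongr; linarith [Real.add_one_le_exp ρ]
      _ = Real.exp (1 / 2) := by
          rw [← Real.exp_nat_mul]; congr 1; rw [hρ]; field_simp
      _ ≤ 2 := by
          have h1 : Real.exp (1 / 2) ^ 2 = Real.exp 1 := by
            rw [← Real.exp_nat_mul]; norm_num
          have h2 := Real.exp_one_lt_d9
          by_contra! h
          nlinarith
  have hlow : (100 : ℝ) ^ D < (1 + ε) ^ J := by
    have hb : (2 : ℝ) ≤ (1 + ε) ^ ⌈1 / ε⌉₊ := by
      have h1 := one_add_mul_le_pow (show (-2 : ℝ) ≤ ε by linarith) ⌈1 / ε⌉₊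
      have h2 : 1 ≤ (⌈1 / ε⌉₊ : ℝ) * ε := by
        have := Nat.le_ceil (1 / ε)
        rw [div_le_iff₀ hε] at this
        exact this
      linarith
    calc (100 : ℝ) ^ D ≤ ((2 : ℝ) ^ 7) ^ D := by gcongr; norm_num
      _ < ((2 : ℝ) ^ 7) ^ (D + 1) := pow_lt_pow_right₀ (by norm_num) (Nat.lt_succ_self D)
      _ = 2 ^ (7 * (D + 1)) := by rw [pow_mul]
      _ ≤ ((1 + ε) ^ ⌈1 / ε⌉₊) ^ (7 * (D + 1)) := by gcongr
      _ = (1 + ε) ^ J := by rw [← pow_mul, hJ]; congr 1; ring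
  by_contra! hcon
  let q : ℕ → ℝ := fun j => ((1 + ρ) ^ j)⁻¹
  have hq0 : ∀ j, 0 < q j := fun j => by simp only [q]; positivity
  have hq1 : ∀ j, q j ≤ 1 := fun j => inv_le_one_of_one_le₀ (one_le_pow₀ (by linarith))
  have hqJ : ∀ j ≤ J, 1 / 2 ≤ q j := by
    intro j hj
    have : (1 + ρ) ^ j ≤ 2 := (pow_le_pow_right₀ (by linarith) hj).trans hup
    simp only [q]
    rw [one_div]
    exact inv_anti₀ (by positivity) this
  have step : ∀ j ≤ J, (1 + ε) ^ j * ((bohr Γ (q j • w)).card : ℝ) ≤ (bohr Γ w).card := by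
    intro j
    induction j with
    | zero => intro _; simp [q]
    | succ j ih =>
      intro hj
      have h1 := hcon (q (j + 1)) (hqJ _ hj) (hq1 _)
      have h2 := ih (by omega)
      rw [RegularBohr, not_le, smul_smul] at h1
      have e : (1 + ρ) * q (j + 1) = q j := by
        simp only [q]; rw [pow_succ]; field_simp
      rw [e] at h1
      calc (1 + ε) ^ (j + 1) * ((bohr Γ (q (j + 1) • w)).card : ℝ)
          = (1 + ε) ^ j * ((1 + ε) * (bohr Γ (q (j + 1) • w)).card) := by ring
        _ ≤ (1 + ε) ^ j * (bohr Γ (q j • w)).card := by gcongr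
        _ ≤ _ := h2
  have h3 := step J le_rfl
  have h4 := card_bohr_le Γ (w := w) (w' := q J • w) (M := 2) (by norm_num) hw (by
    intro γ hγ
    have := hqJ J le_rfl
    have := hw γ hγ
    simp only [Pi.smul_apply, smul_eq_mul]
    push_cast
    nlinarith)
  have h5 : (5 * (2 : ℕ) : ℝ) ^ (2 * Γ.card) ≤ 100 ^ D := by
    rw [pow_mul]; push_cast
    calc _ = (100 : ℝ) ^ Γ.card := by norm_num
      _ ≤ _ := pow_le_pow_right₀ (by norm_num) hΓ
  have h6 := bohr_card_pos (Γ := Γ) (w := q J • w) (fun γ hγ => by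
    have := hw γ hγ
    have := hq0 J
    simp only [Pi.smul_apply, smul_eq_mul]; positivity)
  nlinarith [mul_le_mul_of_nonneg_right h5 h6.le, mul_lt_mul_of_pos_right hlow h6]

end BohrFinset

/-! ### Indicator functions, a Bessel inequality and Fourier identities. -/

section FourierFacts

variable {G : Type*}

/-- The real-valued indicator function of a finset. -/
noncomputable def chi (B : Finset G) (x : G) : ℝ := Set.indicator (B : Set G) (fun _ => 1) x

lemma chi_of_mem {B : Finset G} {x : G} (h : x ∈ B) : chi B x = 1 := by simp [chi, h]

lemma chi_of_notMem {B : Finset G} {x : G} (h : x ∉ B) : chi B x = 0 := by simp [chi, h]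

lemma chi_nonneg (B : Finset G) (x : G) : 0 ≤ chi B x := by
  by_cases h : x ∈ B <;> simp [chi, h]

lemma chi_le_one (B : Finset G) (x : G) : chi B x ≤ 1 := by
  by_cases h : x ∈ B <;> simp [chi, h]

lemma chi_mul_self (B : Finset G) (x : G) : chi B x * chi B x = chi B x := by
  by_cases h : x ∈ B <;> simp [chi, h]

lemma chi_mul_of_subset {A B : Finset G} (h : A ⊆ B) (x : G) : chi A x * chi B x = chi A x := by
  by_cases hx : x ∈ A
  · simp [chi_of_mem hx, chi_of_mem (h hx)]
  · simp [chi_of_notMem hx]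

variable [Fintype G]

lemma sum_chi_mul (B : Finset G) (g : G → ℝ) : ∑ x, chi B x * g x = ∑ x ∈ B, g x := by
  classical
  rw [← Finset.sum_filter_add_sum_filter_not Finset.univ (fun x => x ∈ B)]
  have h1 : ∑ x ∈ Finset.univ.filter (fun x => x ∈ B), chi B x * g x = ∑ x ∈ B, g x := by
    rw [Finset.filter_mem_eq_inter, Finset.univ_inter]
    exact Finset.sum_congr rfl fun x hx => by rw [chi_of_mem hx, one_mul]
  rw [h1, add_eq_left]
  refine Finset.sum_eq_zero fun x hx => ?_
  rw [Finset.mem_filter] at hx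
  rw [chi_of_notMem hx.2, zero_mul]

lemma sum_chi_mul_complex (B : Finset G) (g : G → ℂ) :
    ∑ x, (chi B x : ℂ) * g x = ∑ x ∈ B, g x := by
  classical
  rw [← Finset.sum_filter_add_sum_filter_not Finset.univ (fun x => x ∈ B)]
  have h1 : ∑ x ∈ Finset.univ.filter (fun x => x ∈ B), (chi B x : ℂ) * g x = ∑ x ∈ B, g x := by
    rw [Finset.filter_mem_eq_inter, Finset.univ_inter]
    exact Finset.sum_congr rfl fun x hx => by rw [chi_of_mem hx, Complex.ofReal_one, one_mul]
  rw [h1, add_eq_left]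
  refine Finset.sum_eq_zero fun x hx => ?_
  rw [Finset.mem_filter] at hx
  rw [chi_of_notMem hx.2, Complex.ofReal_zero, zero_mul]

lemma sum_chi (B : Finset G) : ∑ x, chi B x = B.card := by
  have := sum_chi_mul B (fun _ => 1)
  simpa using this

/-- A generalised Bessel inequality for almost orthogonal systems. -/
lemma bessel_almost_orthogonal {ι : Type*} (L : Finset ι) (u : ι → G → ℂ) (H : G → ℝ)
    {R : ℝ} (hR0 : 0 ≤ R) (hR : ∀ i ∈ L, ∑ j ∈ L, ‖∑ z, u i z * (starRingEnd ℂ) (u j z)‖ ≤ R) :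
    ∑ i ∈ L, ‖∑ z, (H z : ℂ) * u i z‖ ^ 2 ≤ (∑ z, H z ^ 2) * R := by
  set c : ι → ℂ := fun i => ∑ z, (H z : ℂ) * u i z with hc
  set E : ℝ := ∑ i ∈ L, ‖c i‖ ^ 2 with hE
  set V : G → ℂ := fun z => ∑ i ∈ L, (starRingEnd ℂ) (c i) * u i z with hV
  have hE0 : 0 ≤ E := Finset.sum_nonneg fun _ _ => by positivity
  have h1 : (E : ℂ) = ∑ z, (H z : ℂ) * V z := by
    simp only [hE, hV]
    push_cast
    simp_rw [Finset.mul_sum]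
    rw [Finset.sum_comm]
    refine Finset.sum_congr rfl fun i _ => ?_
    rw [← Complex.conj_mul']
    conv_lhs => arg 2; rw [hc]
    rw [Finset.mul_sum]
    refine Finset.sum_congr rfl fun z _ => ?_
    ring
  have h2 : E ^ 2 ≤ (∑ z, H z ^ 2) * ∑ z, ‖V z‖ ^ 2 := by
    have h3 : E ≤ ∑ z, |H z| * ‖V z‖ := by
      calc E = ‖(E : ℂ)‖ := by rw [Complex.norm_real, Real.norm_of_nonneg hE0]
        _ ≤ ∑ z, ‖(H z : ℂ) * V z‖ := by rw [h1]; exact norm_sum_le _ _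
        _ = _ := by simp_rw [norm_mul, Complex.norm_real, Real.norm_eq_abs]
    calc E ^ 2 ≤ (∑ z, |H z| * ‖V z‖) ^ 2 := by gcongr
      _ ≤ (∑ z, |H z| ^ 2) * ∑ z, ‖V z‖ ^ 2 := Finset.sum_mul_sq_le_sq_mul_sq _ _ _
      _ = _ := by simp_rw [sq_abs]
  -- Schur's test: bound ‖c i‖‖c j‖ by the mean of the squares and use the row sums of the symmetric
  -- Gram matrix. Combined with Cauchy–Schwarz in `h2`, one factor E cancels.
  have h4 : ∑ z, ‖V z‖ ^ 2 ≤ E * R := by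
    have h5 : ((∑ z, ‖V z‖ ^ 2 : ℝ) : ℂ) = ∑ i ∈ L, ∑ j ∈ L,
        (starRingEnd ℂ) (c i) * c j * ∑ z, u i z * (starRingEnd ℂ) (u j z) := by
      push_cast
      simp_rw [← Complex.mul_conj', hV, map_sum, Finset.sum_mul_sum, Finset.mul_sum]
      rw [Finset.sum_comm]
      refine Finset.sum_congr rfl fun i _ => ?_
      rw [Finset.sum_comm]
      refine Finset.sum_congr rfl fun j _ => Finset.sum_congr rfl fun z _ => ?_
      rw [map_mul, Complex.conj_conj]; ring
    have h0 : 0 ≤ ∑ z, ‖V z‖ ^ 2 := Finset.sum_nonneg fun _ _ => by positivity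
    set g : ι → ι → ℝ := fun i j => ‖∑ z, u i z * (starRingEnd ℂ) (u j z)‖ with hg
    have hsymm : ∀ i j, g i j = g j i := by
      intro i j
      simp only [hg]
      rw [← RCLike.norm_conj, map_sum]
      congr 1
      refine Finset.sum_congr rfl fun z _ => ?_
      rw [map_mul, Complex.conj_conj, mul_comm]
    have h6 : ∑ i ∈ L, ∑ j ∈ L, ‖c i‖ ^ 2 * g i j ≤ E * R := by
      rw [hE, Finset.sum_mul]
      refine Finset.sum_le_sum fun i hi => ?_
      rw [← Finset.mul_sum]
      exact mul_le_mul_of_nonneg_left (hR i hi) (by positivity)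
    have h7 : ∑ i ∈ L, ∑ j ∈ L, ‖c j‖ ^ 2 * g i j ≤ E * R := by
      rw [Finset.sum_comm]
      simp_rw [hsymm] at h6 ⊢
      refine le_trans (le_of_eq ?_) h6
      exact Finset.sum_congr rfl fun i _ => Finset.sum_congr rfl fun j _ => by rw [hsymm]
    calc ∑ z, ‖V z‖ ^ 2 = ‖((∑ z, ‖V z‖ ^ 2 : ℝ) : ℂ)‖ := by
          rw [Complex.norm_real, Real.norm_of_nonneg h0]
      _ ≤ ∑ i ∈ L, ∑ j ∈ L, ‖c i‖ * ‖c j‖ * g i j := by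
          rw [h5]
          refine (norm_sum_le _ _).trans (Finset.sum_le_sum fun i _ => ?_)
          refine (norm_sum_le _ _).trans (Finset.sum_le_sum fun j _ => ?_)
          rw [norm_mul, norm_mul, RCLike.norm_conj]
      _ ≤ ∑ i ∈ L, ∑ j ∈ L, (‖c i‖ ^ 2 * g i j + ‖c j‖ ^ 2 * g i j) / 2 := by
          refine Finset.sum_le_sum fun i _ => Finset.sum_le_sum fun j _ => ?_
          have : 0 ≤ g i j := norm_nonneg _
          nlinarith [mul_nonneg (sq_nonneg (‖c i‖ - ‖c j‖)) this]
      _ = ((∑ i ∈ L, ∑ j ∈ L, ‖c i‖ ^ 2 * g i j)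
            + ∑ i ∈ L, ∑ j ∈ L, ‖c j‖ ^ 2 * g i j) / 2 := by
          simp_rw [← Finset.sum_div, Finset.sum_add_distrib]
      _ ≤ E * R := by linarith
  rcases hE0.eq_or_lt with h | h
  · rw [← h]
    exact mul_nonneg (Finset.sum_nonneg fun _ _ => by positivity) hR0
  · have hH : 0 ≤ ∑ z, H z ^ 2 := Finset.sum_nonneg fun _ _ => by positivity
    have : E * E ≤ E * ((∑ z, H z ^ 2) * R) := by nlinarith [mul_le_mul_of_nonneg_left h4 hH]
    exact le_of_mul_le_mul_left this h

variable [AddCommGroup G]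

/-- The Fourier transform of a real function, with respect to counting measure. -/
noncomputable def ft (f : G → ℝ) (γ : AddChar G ℂ) : ℂ := ∑ x, (f x : ℂ) * γ x

lemma sum_char_mul_conj (x y : G) [DecidableEq G] :
    ∑ γ : AddChar G ℂ, γ x * (starRingEnd ℂ) (γ y) = if x = y then (Fintype.card G : ℂ) else 0 := by
  have h : ∀ γ : AddChar G ℂ, γ x * (starRingEnd ℂ) (γ y) = γ (x - y) := fun γ => by
    rw [← AddChar.map_neg_eq_conj, ← AddChar.map_add_eq_mul, sub_eq_add_neg]
  simp_rw [h, AddChar.sum_apply_eq_ite, sub_eq_zero]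

lemma parseval (f : G → ℝ) :
    ∑ γ : AddChar G ℂ, ‖ft f γ‖ ^ 2 = Fintype.card G * ∑ x, f x ^ 2 := by
  classical
  have h : ((∑ γ : AddChar G ℂ, ‖ft f γ‖ ^ 2 : ℝ) : ℂ)
      = ((Fintype.card G * ∑ x, f x ^ 2 : ℝ) : ℂ) := by
    push_cast
    have h1 : ∀ γ : AddChar G ℂ, (‖ft f γ‖ : ℂ) ^ 2
        = ∑ x, ∑ y, (f x : ℂ) * f y * (γ x * (starRingEnd ℂ) (γ y)) := by
      intro γ
      rw [← Complex.mul_conj', ft, map_sum, Finset.sum_mul_sum]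
      refine Finset.sum_congr rfl fun x _ => Finset.sum_congr rfl fun y _ => ?_
      rw [map_mul, Complex.conj_ofReal]; ring
    simp_rw [h1]
    rw [Finset.sum_comm, Finset.mul_sum]
    refine Finset.sum_congr rfl fun x _ => ?_
    rw [Finset.sum_comm]
    simp_rw [← Finset.mul_sum, sum_char_mul_conj]
    simp; ring
  exact_mod_cast h

/-- Orthogonality detects u + v = 2m. The midpoints therefore enter through their transform at the
doubled character, which is the source of every `γ (m + m)` below. -/
lemma sum_conv_eq (f : G → ℝ) (A : Finset G) :
    ((Fintype.card G * ∑ m ∈ A, ∑ u, f u * f (m + m - u) : ℝ) : ℂ)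
      = ∑ γ : AddChar G ℂ, ft f γ ^ 2 * (starRingEnd ℂ) (∑ m ∈ A, γ (m + m)) := by
  classical
  have h1 : ∀ γ : AddChar G ℂ, ft f γ ^ 2 * (starRingEnd ℂ) (∑ m ∈ A, γ (m + m))
      = ∑ m ∈ A, ∑ u, ∑ v, (f u : ℂ) * f v * (γ (u + v) * (starRingEnd ℂ) (γ (m + m))) := by
    intro γ
    rw [map_sum, Finset.mul_sum]
    refine Finset.sum_congr rfl fun m _ => ?_
    rw [sq, ft, Finset.sum_mul_sum, Finset.sum_mul]
    refine Finset.sum_congr rfl fun u _ => ?_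
    rw [Finset.sum_mul]
    refine Finset.sum_congr rfl fun v _ => ?_
    rw [AddChar.map_add_eq_mul γ u v]; ring
  simp_rw [h1]
  push_cast
  rw [Finset.mul_sum]
  refine Eq.trans ?_ Finset.sum_comm
  refine Finset.sum_congr rfl fun m _ => ?_
  rw [Finset.mul_sum]
  refine Eq.trans ?_ Finset.sum_comm
  refine Finset.sum_congr rfl fun u _ => ?_
  refine Eq.trans ?_ Finset.sum_comm
  simp_rw [← Finset.mul_sum, sum_char_mul_conj]
  rw [Finset.sum_eq_single (m + m - u)]
  · simp; ring
  · intro v _ hv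
    rw [if_neg, mul_zero]
    intro h; exact hv (by rw [← h]; abel)
  · simp

lemma ft_sum_shift (f : G → ℝ) (B : Finset G) (φ : G → G) (γ : AddChar G ℂ) :
    ft (fun z => ∑ b ∈ B, f (z + φ b)) γ = ft f γ * (starRingEnd ℂ) (∑ b ∈ B, γ (φ b)) := by
  rw [ft, map_sum, Finset.mul_sum]
  simp_rw [Complex.ofReal_sum, Finset.sum_mul]
  rw [Finset.sum_comm]
  refine Finset.sum_congr rfl fun b _ => ?_
  rw [ft, Finset.sum_mul]
  refine Eq.trans ?_ (Equiv.sum_comp (Equiv.addRight (φ b))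
    (fun x => (f x : ℂ) * γ x * (starRingEnd ℂ) (γ (φ b))))
  refine (Finset.sum_congr rfl fun z _ => ?_)
  simp only [Equiv.coe_addRight]
  rw [AddChar.map_add_eq_mul]
  have : γ (φ b) * (starRingEnd ℂ) (γ (φ b)) = 1 := by
    rw [Complex.mul_conj', AddChar.norm_apply]; simp
  linear_combination (-(f (z + φ b) : ℂ) * γ z) * this

/-- Summing f over shifts by φ(B) multiplies its transform by a factor of modulus at least κ|B| on
S, so Parseval retains the mass on S. A general φ is allowed because it is later the doubling map.
-/
lemma sum_sq_shift_ge (f : G → ℝ) (B : Finset G) (φ : G → G) (S : Finset (AddChar G ℂ)) {κ : ℝ}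
    (hκ : 0 ≤ κ) (hS : ∀ γ ∈ S, κ * B.card ≤ ‖∑ b ∈ B, γ (φ b)‖) :
    (κ * B.card) ^ 2 * ∑ γ ∈ S, ‖ft f γ‖ ^ 2
      ≤ Fintype.card G * ∑ z, (∑ b ∈ B, f (z + φ b)) ^ 2 := by
  rw [← parseval (fun z => ∑ b ∈ B, f (z + φ b)), Finset.mul_sum]
  calc ∑ γ ∈ S, (κ * B.card) ^ 2 * ‖ft f γ‖ ^ 2
      ≤ ∑ γ ∈ S, ‖ft (fun z => ∑ b ∈ B, f (z + φ b)) γ‖ ^ 2 := by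
        refine Finset.sum_le_sum fun γ hγ => ?_
        rw [ft_sum_shift, norm_mul, RCLike.norm_conj, mul_pow ‖ft f γ‖, mul_comm]
        exact mul_le_mul_of_nonneg_left (pow_le_pow_left₀ (by positivity) (hS γ hγ) 2)
          (by positivity)
    _ ≤ _ := Finset.sum_le_sum_of_subset_of_nonneg (Finset.subset_univ _) fun _ _ _ => by positivity

end FourierFacts

/-! ### Almost invariance, and the passage from few progressions to Fourier mass to a density
increment. -/

section LocalCounting

variable {G : Type*}

lemma abs_chi_le_one (B : Finset G) (x : G) : |chi B x| ≤ 1 := by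
  rw [abs_of_nonneg (chi_nonneg B x)]; exact chi_le_one B x

variable [AddCommGroup G] [Fintype G]

/-- `B` is almost invariant under translation by `s`. -/
def ShiftInv (δ : ℝ) (B : Finset G) (s : G) : Prop :=
  ∑ u, |chi B (u + s) - chi B u| ≤ δ * B.card

/-- Where the indicators of B and its translate differ, the point lies in the shell between B and
its enlargement, or in a translate of that shell. Each shell has at most ε|B| points, hence 2ε. -/
lemma RegularBohr.shiftInv {ε ρ : ℝ} {Γ : Finset (AddChar G ℂ)} {w : AddChar G ℂ → ℝ}
    (h : RegularBohr ε ρ Γ w) (hρ : 0 ≤ ρ) (hw : ∀ γ ∈ Γ, 0 ≤ w γ) {s : G}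
    (hs : s ∈ bohr Γ (ρ • w)) :
    ShiftInv (2 * ε) (bohr Γ w) s := by
  have hsub : bohr Γ w ⊆ bohr Γ ((1 + ρ) • w) := bohr_mono fun γ hγ => by
    have := mul_nonneg hρ (hw γ hγ)
    simp only [Pi.smul_apply, smul_eq_mul]; linarith
  have hadd : ∀ γ ∈ Γ, w γ + (ρ • w) γ ≤ ((1 + ρ) • w) γ := fun γ _ => by
    simp only [Pi.smul_apply, smul_eq_mul]; linarith
  set B := bohr Γ w with hB
  set B' := bohr Γ ((1 + ρ) • w) with hB'
  have hle : ∀ u, |chi B (u + s) - chi B u|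
      ≤ (chi B' u - chi B u) + (chi B' (u + s) - chi B (u + s)) := by
    intro u
    by_cases h1 : u ∈ B <;> by_cases h2 : u + s ∈ B
    · simp [chi_of_mem h1, chi_of_mem h2, chi_of_mem (hsub h1), chi_of_mem (hsub h2)]
    · have h3 : u + s ∈ B' := add_mem_bohr h1 hs hadd
      simp [chi_of_mem h1, chi_of_notMem h2, chi_of_mem (hsub h1), chi_of_mem h3]
    · have h3 : u ∈ B' := by
        have := add_mem_bohr h2 (neg_mem_bohr.2 hs) hadd
        rwa [add_neg_cancel_right] at this
      simp [chi_of_notMem h1, chi_of_mem h2, chi_of_mem h3, chi_of_mem (hsub h2)]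
    · have h3 := chi_nonneg B' u
      have h4 := chi_nonneg B' (u + s)
      simp only [chi_of_notMem h1, chi_of_notMem h2, sub_zero, abs_zero]
      linarith
  have hshift : ∀ C : Finset G, ∑ u, chi C (u + s) = C.card := fun C => by
    rw [← sum_chi C]; exact Equiv.sum_comp (Equiv.addRight s) (chi C)
  calc ∑ u, |chi B (u + s) - chi B u|
      ≤ ∑ u, ((chi B' u - chi B u) + (chi B' (u + s) - chi B (u + s))) :=
        Finset.sum_le_sum fun u _ => hle u
    _ = 2 * ((B'.card : ℝ) - B.card) := by
        rw [Finset.sum_add_distrib, Finset.sum_sub_distrib, Finset.sum_sub_distrib, hshift, hshift,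
          sum_chi, sum_chi]; ring
    _ ≤ 2 * ε * B.card := by
        have := h
        rw [RegularBohr, ← hB, ← hB'] at this
        linarith

lemma ShiftInv.abs_sum_sub_le {δ : ℝ} {B : Finset G} {s : G} (h : ShiftInv δ B s) {g : G → ℝ}
    (hg : ∀ x, |g x| ≤ 1) :
    |∑ u, chi B (u + s) * g u - ∑ u, chi B u * g u| ≤ δ * B.card := by
  rw [← Finset.sum_sub_distrib]
  refine (Finset.abs_sum_le_sum_abs _ _).trans (le_trans (Finset.sum_le_sum fun u _ => ?_) h)
  rw [← sub_mul, abs_mul]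
  exact mul_le_of_le_one_right (abs_nonneg _) (hg u)

lemma ShiftInv.norm_sum_sub_le {δ : ℝ} {B : Finset G} {s : G} (h : ShiftInv δ B s) {g : G → ℂ}
    (hg : ∀ x, ‖g x‖ ≤ 1) :
    ‖∑ u, (chi B (u + s) : ℂ) * g u - ∑ u, (chi B u : ℂ) * g u‖ ≤ δ * B.card := by
  rw [← Finset.sum_sub_distrib]
  refine (norm_sum_le _ _).trans (le_trans (Finset.sum_le_sum fun u _ => ?_) h)
  rw [← sub_mul, norm_mul, ← Complex.ofReal_sub, Complex.norm_real, Real.norm_eq_abs]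
  exact mul_le_of_le_one_right (abs_nonneg _) (hg u)

/-- The translates of a small set, centred at points of an almost invariant set `B`, see on average
the density of `A` on `B`. -/
lemma sum_translates_ge {δ : ℝ} {B B' A : Finset G} (hA : A ⊆ B)
    (hinv : ∀ s ∈ B', ShiftInv δ B s) :
    ((A.card : ℝ) - δ * B.card) * B'.card ≤ ∑ x ∈ B, ∑ b ∈ B', chi A (x + b) := by
  rw [Finset.sum_comm]
  have : ∀ b ∈ B', (A.card : ℝ) - δ * B.card ≤ ∑ x ∈ B, chi A (x + b) := by
    intro b hb
    have h1 := (hinv b hb).abs_sum_sub_le (g := fun u => chi A (u + b))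
      (fun x => abs_chi_le_one A _)
    rw [abs_le] at h1
    have h2 : ∑ u, chi B (u + b) * chi A (u + b) = A.card := by
      rw [← sum_chi A]
      refine (Equiv.sum_comp (Equiv.addRight b) (fun u => chi B u * chi A u)).trans ?_
      exact Finset.sum_congr rfl fun u _ => by rw [mul_comm, chi_mul_of_subset hA]
    rw [h2, sum_chi_mul] at h1
    linarith [h1.2]
  calc ((A.card : ℝ) - δ * B.card) * B'.card = ∑ b ∈ B', ((A.card : ℝ) - δ * B.card) := by
        rw [Finset.sum_const, nsmul_eq_mul, mul_comm]
    _ ≤ _ := Finset.sum_le_sum this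

/-- If there are few progressions with end points in `A₁` and midpoint in `A₂`, then the balanced
function of `A₁` has large Fourier mass on the (halved) large spectrum of `A₂`. -/
lemma spectral_mass {a δ : ℝ} {A₁ A₂ B : Finset G} (hA : A₁ ⊆ B) (hB : 0 < (B.card : ℝ))
    (hsym : ∀ x, -x ∈ B ↔ x ∈ B) (hA₂ : A₂.Nonempty) (ha : a * B.card = A₁.card) (ha0 : 0 < a)
    (hδ : δ ≤ a / 12) (hinv : ∀ m ∈ A₂, ShiftInv δ B (-(m + m)))
    (hcount : ∑ m ∈ A₂, ∑ u, chi A₁ u * chi A₁ (m + m - u) ≤ a ^ 2 / 4 * A₂.card * B.card) :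
    a ^ 2 / 4 * B.card * Fintype.card G ≤
      ∑ γ ∈ Finset.univ.filter (fun γ : AddChar G ℂ => a / 4 * A₂.card < ‖∑ m ∈ A₂, γ (m + m)‖),
        ‖ft (fun u => chi A₁ u - a * chi B u) γ‖ ^ 2 := by
  set f : G → ℝ := fun u => chi A₁ u - a * chi B u with hf
  have ha1 : a ≤ 1 := by
    have : (A₁.card : ℝ) ≤ B.card := by exact_mod_cast Finset.card_le_card hA
    rw [← ha] at this
    nlinarith
  have hA₂' : (0 : ℝ) < A₂.card := by exact_mod_cast Finset.card_pos.2 hA₂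
  have hG : (0 : ℝ) < Fintype.card G := by exact_mod_cast Fintype.card_pos
  have hf1 : ∀ u, |f u| ≤ 1 := fun u => by
    have h1 := chi_nonneg A₁ u
    have h2 := chi_le_one A₁ u
    have h3 := chi_nonneg B u
    have h4 := chi_le_one B u
    rw [abs_le]; simp only [hf]
    constructor <;> nlinarith
  have hBf : ∑ u, chi B u * f u = 0 := by
    simp only [hf]
    have : ∀ u, chi B u * (chi A₁ u - a * chi B u) = chi A₁ u - a * chi B u := fun u => by
      rw [mul_sub, mul_comm, chi_mul_of_subset hA]
      linear_combination (-a) * chi_mul_self B u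
    simp_rw [this]
    rw [Finset.sum_sub_distrib, ← Finset.mul_sum, sum_chi, sum_chi, ha, sub_self]
  have hrefl : ∀ s u : G, chi B (s - u) = chi B (u + -s) := fun s u => by
    have h : s - u = -(u + -s) := by abel
    by_cases h1 : u + -s ∈ B
    · rw [chi_of_mem h1, h, chi_of_mem ((hsym _).2 h1)]
    · rw [chi_of_notMem h1, h, chi_of_notMem (fun h2 => h1 ((hsym _).1 h2))]
  -- Substitute 1_{A₁} = a·1_B + f. The main term loses a²δ|B| by almost invariance; each of the two
  -- cross terms is at most aδ|B| in size because f has sum 0 over B.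
  have hR : ∀ m ∈ A₂, (a ^ 2 * (1 - δ) - 2 * a * δ) * B.card + ∑ u, f u * f (m + m - u)
      ≤ ∑ u, chi A₁ u * chi A₁ (m + m - u) := by
    intro m hm
    set s := m + m with hs
    have e1 : ∀ u, chi A₁ u * chi A₁ (s - u) = a ^ 2 * (chi B (u + -s) * chi B u)
        + a * (chi B (u + -s) * f u) + a * (chi B u * f (s - u)) + f u * f (s - u) := fun u => by
      rw [← hrefl]; simp only [hf]; ring
    simp_rw [e1]
    rw [Finset.sum_add_distrib, Finset.sum_add_distrib, Finset.sum_add_distrib, ← Finset.mul_sum,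
      ← Finset.mul_sum, ← Finset.mul_sum]
    have e2 : ∑ u, chi B u * f (s - u) = ∑ u, chi B (u + -s) * f u := by
      rw [← Equiv.sum_comp (Equiv.subLeft s)]
      refine Finset.sum_congr rfl fun u _ => ?_
      simp only [Equiv.subLeft_apply, sub_sub_cancel, hrefl]
    have h1 := (hinv m hm).abs_sum_sub_le (g := chi B) (abs_chi_le_one B)
    have h2 := (hinv m hm).abs_sum_sub_le (g := f) hf1
    rw [hBf, sub_zero, abs_le] at h2
    simp_rw [chi_mul_self] at h1
    rw [sum_chi, abs_le] at h1
    rw [e2]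
    nlinarith [mul_le_mul_of_nonneg_left h1.1 (sq_nonneg a), mul_le_mul_of_nonneg_left h2.1 ha0.le]
  have hsum := Finset.sum_le_sum hR
  rw [Finset.sum_add_distrib, Finset.sum_const, nsmul_eq_mul] at hsum
  set F := ∑ m ∈ A₂, ∑ u, f u * f (m + m - u) with hF
  -- With δ ≤ a/12 the main term keeps a constant 3/4, while the count is at most 1/4, so the part
  -- quadratic in f is at most −1/2 in the same units.
  have hFle : F ≤ -(a ^ 2 / 2 * A₂.card * B.card) := by
    have h1 : a ^ 2 * (3 / 4) ≤ a ^ 2 * (1 - δ) - 2 * a * δ := by nlinarith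
    have h2 : a ^ 2 * (3 / 4) * B.card * A₂.card ≤
        A₂.card * ((a ^ 2 * (1 - δ) - 2 * a * δ) * B.card) := by
      rw [mul_comm (A₂.card : ℝ)]; gcongr
    nlinarith
  have hspec : (Fintype.card G : ℝ) * (a ^ 2 / 2 * A₂.card * B.card)
      ≤ ∑ γ : AddChar G ℂ, ‖ft f γ‖ ^ 2 * ‖∑ m ∈ A₂, γ (m + m)‖ := by
    calc (Fintype.card G : ℝ) * (a ^ 2 / 2 * A₂.card * B.card)
        ≤ Fintype.card G * |F| := by
          gcongr
          rw [abs_of_neg (lt_of_le_of_lt hFle (neg_lt_zero.2 (by positivity)))]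
          linarith
      _ = ‖((Fintype.card G * F : ℝ) : ℂ)‖ := by
          rw [Complex.norm_real, Real.norm_eq_abs, abs_mul, abs_of_pos hG]
      _ ≤ _ := by
          rw [hF, sum_conv_eq]
          refine (norm_sum_le _ _).trans (le_of_eq (Finset.sum_congr rfl fun γ _ => ?_))
          rw [norm_mul, RCLike.norm_conj, norm_pow]
  have hf2 : ∑ u, f u ^ 2 ≤ a * B.card := by
    have e1 : ∀ u, f u ^ 2 = chi A₁ u - a * chi A₁ u - a * (chi B u * f u) := fun u => by
      simp only [hf]
      linear_combination chi_mul_self A₁ u - a * chi_mul_of_subset hA u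
    simp_rw [e1]
    rw [Finset.sum_sub_distrib, Finset.sum_sub_distrib, ← Finset.mul_sum, ← Finset.mul_sum, hBf,
      sum_chi, ← ha]
    nlinarith
  -- By Parseval, the characters below the threshold a/4·|A₂| account for at most half of the lower
  -- bound in `hspec`; the other half must come from the large spectrum, where the coefficient is
  -- trivially at most |A₂|.
  rw [← Finset.sum_filter_add_sum_filter_not Finset.univ
    (fun γ : AddChar G ℂ => a / 4 * A₂.card < ‖∑ m ∈ A₂, γ (m + m)‖)] at hspec
  have h1 : ∑ γ ∈ Finset.univ.filter
      (fun γ : AddChar G ℂ => a / 4 * A₂.card < ‖∑ m ∈ A₂, γ (m + m)‖),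
      ‖ft f γ‖ ^ 2 * ‖∑ m ∈ A₂, γ (m + m)‖ ≤ (∑ γ ∈ Finset.univ.filter
      (fun γ : AddChar G ℂ => a / 4 * A₂.card < ‖∑ m ∈ A₂, γ (m + m)‖), ‖ft f γ‖ ^ 2)
        * A₂.card := by
    rw [Finset.sum_mul]
    refine Finset.sum_le_sum fun γ _ => mul_le_mul_of_nonneg_left ?_ (by positivity)
    refine (norm_sum_le _ _).trans ?_
    simp [AddChar.norm_apply]
  have h2 : ∑ γ ∈ Finset.univ.filter
      (fun γ : AddChar G ℂ => ¬ a / 4 * A₂.card < ‖∑ m ∈ A₂, γ (m + m)‖),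
      ‖ft f γ‖ ^ 2 * ‖∑ m ∈ A₂, γ (m + m)‖
      ≤ Fintype.card G * (a * B.card) * (a / 4 * A₂.card) := by
    calc _ ≤ ∑ γ ∈ Finset.univ.filter
            (fun γ : AddChar G ℂ => ¬ a / 4 * A₂.card < ‖∑ m ∈ A₂, γ (m + m)‖),
          ‖ft f γ‖ ^ 2 * (a / 4 * A₂.card) := by
          refine Finset.sum_le_sum fun γ hγ => mul_le_mul_of_nonneg_left ?_ (by positivity)
          rw [Finset.mem_filter] at hγ
          exact not_lt.1 hγ.2
      _ ≤ ∑ γ : AddChar G ℂ, ‖ft f γ‖ ^ 2 * (a / 4 * A₂.card) :=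
          Finset.sum_le_sum_of_subset_of_nonneg (Finset.subset_univ _) fun _ _ _ => by positivity
      _ = (Fintype.card G * ∑ u, f u ^ 2) * (a / 4 * A₂.card) := by
          rw [← Finset.sum_mul, parseval]
      _ ≤ _ := by gcongr
  refine le_of_mul_le_mul_right ?_ hA₂'
  nlinarith

/-- Density increment from Fourier mass of the balanced function. -/
lemma increment_of_mass {a δ κ K : ℝ} {A B T : Finset G} {φ : G → G} (hA : A ⊆ B)
    (ha : a * B.card = A.card) (ha0 : 0 < a) (hB : 0 < (B.card : ℝ)) (hT : T.Nonempty)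
    (hinv : ∀ b ∈ T, ∀ b' ∈ T, ShiftInv δ B (φ b' - φ b))
    (S : Finset (AddChar G ℂ)) (hκ : 0 ≤ κ) (hS : ∀ γ ∈ S, κ * T.card ≤ ‖∑ b ∈ T, γ (φ b)‖)
    (hmass : K * B.card * Fintype.card G
      ≤ ∑ γ ∈ S, ‖ft (fun u => chi A u - a * chi B u) γ‖ ^ 2) :
    ∃ z, (a * (1 - δ) - 2 * δ + κ ^ 2 * K / a) * T.card ≤ ∑ b ∈ T, chi A (z + φ b) := by
  set f : G → ℝ := fun u => chi A u - a * chi B u with hf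
  set p : ℝ := (B.card : ℝ) with hp
  set q : ℝ := (T.card : ℝ) with hq
  have hq0 : 0 < q := by rw [hq]; exact_mod_cast Finset.card_pos.2 hT
  have hG : (0 : ℝ) < Fintype.card G := by exact_mod_cast Fintype.card_pos
  have ha1 : a ≤ 1 := by
    have : (A.card : ℝ) ≤ B.card := by exact_mod_cast Finset.card_le_card hA
    rw [← ha] at this
    nlinarith
  have hf1 : ∀ u, |f u| ≤ 1 := fun u => by
    have h1 := chi_nonneg A u
    have h2 := chi_le_one A u
    have h3 := chi_nonneg B u
    have h4 := chi_le_one B u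
    rw [abs_le]; simp only [hf]
    constructor <;> nlinarith
  have hBf : ∑ u, chi B u * f u = 0 := by
    simp only [hf]
    have : ∀ u, chi B u * (chi A u - a * chi B u) = chi A u - a * chi B u := fun u => by
      rw [mul_sub, mul_comm, chi_mul_of_subset hA]
      linear_combination (-a) * chi_mul_self B u
    simp_rw [this]
    rw [Finset.sum_sub_distrib, ← Finset.mul_sum, sum_chi, sum_chi, ha, sub_self]
  have hpair : ∀ g : G → ℝ, (∑ z, (∑ b ∈ T, g (z + φ b)) * ∑ b ∈ T, chi B (z + φ b))
      = ∑ b ∈ T, ∑ b' ∈ T, ∑ u, chi B (u + (φ b' - φ b)) * g u := by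
    intro g
    simp_rw [Finset.sum_mul_sum]
    rw [Finset.sum_comm]
    refine Finset.sum_congr rfl fun b _ => ?_
    rw [Finset.sum_comm]
    refine Finset.sum_congr rfl fun b' _ => ?_
    rw [← Equiv.sum_comp (Equiv.addRight (φ b)) (fun u => chi B (u + (φ b' - φ b)) * g u)]
    refine Finset.sum_congr rfl fun z _ => ?_
    simp only [Equiv.coe_addRight]
    rw [mul_comm, show z + φ b + (φ b' - φ b) = z + φ b' by abel]
  have hpairge : ∀ (g : G → ℝ) (r : ℝ), (∀ u, |g u| ≤ 1) → ∑ u, chi B u * g u = r →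
      q ^ 2 * (r - δ * p) ≤ ∑ z, (∑ b ∈ T, g (z + φ b)) * ∑ b ∈ T, chi B (z + φ b) := by
    intro g r hg hr
    rw [hpair]
    have : ∀ b ∈ T, ∀ b' ∈ T, r - δ * p ≤ ∑ u, chi B (u + (φ b' - φ b)) * g u := by
      intro b hb b' hb'
      have := (hinv b hb b' hb').abs_sum_sub_le hg
      rw [hr, abs_le] at this
      linarith [this.1]
    calc q ^ 2 * (r - δ * p) = ∑ b ∈ T, ∑ b' ∈ T, (r - δ * p) := by
          simp only [Finset.sum_const, nsmul_eq_mul]; ring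
      _ ≤ _ := Finset.sum_le_sum fun b hb => Finset.sum_le_sum fun b' hb' => this b hb b' hb'
  have hPP := hpairge (chi B) p (abs_chi_le_one B) (by simp_rw [chi_mul_self]; exact sum_chi B)
  have hQP := hpairge f 0 hf1 hBf
  have hQQ := sum_sq_shift_ge f T φ S hκ hS
  have hQQ' : (κ * q) ^ 2 * (K * p) ≤ ∑ z, (∑ b ∈ T, f (z + φ b)) ^ 2 := by
    refine le_of_mul_le_mul_left ?_ hG
    refine le_trans ?_ hQQ
    have := mul_le_mul_of_nonneg_left hmass (sq_nonneg (κ * q))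
    nlinarith
  set H : G → ℝ := fun z => ∑ b ∈ T, chi A (z + φ b) with hH
  -- The square, cross and balanced terms produce in turn the a(1−δ), the −2δ and the gain κ²K/a of
  -- the conclusion.
  have hHsq : ∑ z, H z ^ 2 = a ^ 2 * (∑ z, (∑ b ∈ T, chi B (z + φ b)) * ∑ b ∈ T, chi B (z + φ b))
      + 2 * a * (∑ z, (∑ b ∈ T, f (z + φ b)) * ∑ b ∈ T, chi B (z + φ b))
      + ∑ z, (∑ b ∈ T, f (z + φ b)) ^ 2 := by
    rw [Finset.mul_sum, Finset.mul_sum, ← Finset.sum_add_distrib, ← Finset.sum_add_distrib]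
    refine Finset.sum_congr rfl fun z _ => ?_
    have : H z = a * (∑ b ∈ T, chi B (z + φ b)) + ∑ b ∈ T, f (z + φ b) := by
      simp only [hH, hf]
      rw [Finset.sum_sub_distrib, ← Finset.mul_sum]; ring
    rw [this]; ring
  have hHsum : ∑ z, H z = q * (a * p) := by
    simp only [hH]
    rw [Finset.sum_comm, ha]
    have : ∀ b ∈ T, ∑ z, chi A (z + φ b) = A.card := fun b _ => by
      rw [← sum_chi A]; exact Equiv.sum_comp (Equiv.addRight (φ b)) (chi A)
    rw [Finset.sum_congr rfl this, Finset.sum_const, nsmul_eq_mul]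
  -- If H stayed below θ|T| everywhere, then ∑H² < θ|T|∑H, contradicting the lower bound for ∑H².
  by_contra! hcon
  set θ := a * (1 - δ) - 2 * δ + κ ^ 2 * K / a with hθ
  have hHnn : ∀ z, 0 ≤ H z := fun z => Finset.sum_nonneg fun _ _ => chi_nonneg _ _
  have hpos : 0 < ∑ z, H z := by rw [hHsum]; positivity
  have hlt : ∑ z, H z ^ 2 < θ * q * ∑ z, H z := by
    rw [Finset.mul_sum]
    obtain ⟨z0, -, hz0⟩ := Finset.exists_lt_of_sum_lt
      (show ∑ z : G, (0 : ℝ) < ∑ z, H z by simpa using hpos)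
    refine Finset.sum_lt_sum (fun z _ => ?_) ⟨z0, Finset.mem_univ _, ?_⟩
    · rw [sq]; exact mul_le_mul_of_nonneg_right (hcon z).le (hHnn z)
    · rw [sq]; exact mul_lt_mul_of_pos_right (hcon z0) hz0
  rw [hHsum, hHsq] at hlt
  have e : θ * q * (q * (a * p))
      = q ^ 2 * p * (a ^ 2 * (1 - δ) - 2 * a * δ) + (κ * q) ^ 2 * (K * p) := by
    rw [hθ]; field_simp
  rw [e] at hlt
  nlinarith [mul_le_mul_of_nonneg_left hPP (sq_nonneg a), mul_le_mul_of_nonneg_left hQP ha0.le]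

end LocalCounting

/-! ### Density increments from large, well separated spectra. -/

section SpectrumIncrement

variable {G : Type*} [AddCommGroup G] [Fintype G]

lemma norm_char_le_one (γ : AddChar G ℂ) (x : G) : ‖γ x‖ ≤ 1 := (AddChar.norm_apply γ x).le

/-- A character which is not close to `1` on the almost periods of `B` has a small Fourier
coefficient on `B`. -/
lemma ShiftInv.norm_sum_char_le {δ : ℝ} {B : Finset G} {b : G} (h : ShiftInv δ B (-b))
    {ψ : AddChar G ℂ} (hψ : 1 / 2 < ‖1 - ψ b‖) : ‖∑ x ∈ B, ψ x‖ ≤ 2 * δ * B.card := by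
  have h1 := h.norm_sum_sub_le (g := ψ) (norm_char_le_one ψ)
  have h2 : ∑ u, (chi B (u + -b) : ℂ) * ψ u = ψ b * ∑ u, (chi B u : ℂ) * ψ u := by
    rw [← Equiv.sum_comp (Equiv.addRight b), Finset.mul_sum]
    refine Finset.sum_congr rfl fun u _ => ?_
    simp only [Equiv.coe_addRight, add_neg_cancel_right]
    rw [AddChar.map_add_eq_mul]; ring
  rw [h2, sum_chi_mul_complex] at h1
  have h3 : ψ b * ∑ x ∈ B, ψ x - ∑ x ∈ B, ψ x = -((1 - ψ b) * ∑ x ∈ B, ψ x) := by ring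
  rw [h3, norm_neg, norm_mul] at h1
  nlinarith [norm_nonneg (∑ x ∈ B, ψ x)]

/-- Density increment from many almost orthogonal characters in the large spectrum. -/
lemma increment_of_spectrum [DecidableEq (AddChar G ℂ)] {a δ : ℝ} {A B T : Finset G} (hA : A ⊆ B)
    (ha : a * B.card = A.card) (ha0 : 0 < a) (hB : 0 < (B.card : ℝ)) (hT : T.Nonempty)
    (hδ0 : 0 ≤ δ) (hδ : δ ≤ a ^ 2 / 20)
    (hinv : ∀ b ∈ T, ShiftInv δ B (-b)) (L : Finset (AddChar G ℂ)) (hL : (0 : AddChar G ℂ) ∉ L)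
    (hspec : ∀ γ ∈ L, a / 5 * A.card ≤ ‖∑ x ∈ A, γ x‖)
    (horth : ∀ γ ∈ insert 0 L, ∀ γ' ∈ insert 0 L, γ ≠ γ' →
      ‖∑ x ∈ B, (γ - γ') x‖ ≤ 2 * δ * B.card)
    (hLT : ∀ γ ∈ L, ∀ b ∈ T, ‖1 - γ b‖ ≤ 1 / 8) :
    ∃ z, a * ((1 - δ / a) ^ 2 + L.card * (a / 8) ^ 2) / (1 + 2 * δ * L.card) * T.card
      ≤ ∑ b ∈ T, chi A (z + b) := by
  set p : ℝ := (B.card : ℝ) with hp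
  set q : ℝ := (T.card : ℝ) with hq
  have hq0 : 0 < q := by rw [hq]; exact_mod_cast Finset.card_pos.2 hT
  have hAp : 0 < (A.card : ℝ) := by rw [← ha]; positivity
  have ha1 : a ≤ 1 := by
    have : (A.card : ℝ) ≤ B.card := by exact_mod_cast Finset.card_le_card hA
    rw [← ha] at this
    nlinarith
  set H : G → ℝ := fun z => ∑ b ∈ T, chi A (z + b) with hH
  have hHnn : ∀ z, 0 ≤ H z := fun z => Finset.sum_nonneg fun _ _ => chi_nonneg _ _
  set u : AddChar G ℂ → G → ℂ := fun γ z => (chi B z : ℂ) * γ z with hu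
  have hrow : ∀ γ ∈ insert 0 L, ∑ γ' ∈ insert 0 L, ‖∑ z, u γ z * (starRingEnd ℂ) (u γ' z)‖
      ≤ p * (1 + 2 * δ * L.card) := by
    intro γ hγ
    have hval : ∀ γ' : AddChar G ℂ, ∑ z, u γ z * (starRingEnd ℂ) (u γ' z)
        = ∑ x ∈ B, (γ - γ') x := by
      intro γ'
      refine Eq.trans ?_ (sum_chi_mul_complex B ⇑(γ - γ'))
      refine Finset.sum_congr rfl fun z _ => ?_
      simp only [hu]
      rw [map_mul, Complex.conj_ofReal, AddChar.sub_apply, AddChar.map_neg_eq_conj]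
      have := congrArg (fun r : ℝ => (r : ℂ)) (chi_mul_self B z)
      push_cast at this
      linear_combination (γ z * (starRingEnd ℂ) (γ' z)) * this
    simp_rw [hval]
    rw [← Finset.add_sum_erase _ _ hγ, sub_self]
    have h1 : ‖∑ x ∈ B, (0 : AddChar G ℂ) x‖ = p := by simp [hp]
    have h2 : ∑ γ' ∈ (insert 0 L).erase γ, ‖∑ x ∈ B, (γ - γ') x‖ ≤ L.card * (2 * δ * p) := by
      have hc : ((insert 0 L).erase γ).card = L.card := by
        rw [Finset.card_erase_of_mem hγ, Finset.card_insert_of_notMem hL]; simp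
      rw [← hc, ← nsmul_eq_mul]
      refine Finset.sum_le_card_nsmul _ _ _ fun γ' hγ' => ?_
      rw [Finset.mem_erase] at hγ'
      exact horth γ hγ γ' hγ'.2 hγ'.1.symm
    rw [h1]
    nlinarith
  have hbes := bessel_almost_orthogonal (insert 0 L) u H (by positivity) hrow
  have hcoef : ∀ γ : AddChar G ℂ, ‖∑ z, (H z : ℂ) * u γ z
      - (∑ b ∈ T, γ (-b)) * ∑ x ∈ A, γ x‖ ≤ q * (δ * p) := by
    intro γ
    have h1 : ∑ z, (H z : ℂ) * u γ z
        = ∑ b ∈ T, ∑ x, (chi B (x + -b) : ℂ) * ((chi A x : ℂ) * γ (x + -b)) := by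
      simp only [hH]
      simp_rw [Complex.ofReal_sum, Finset.sum_mul]
      rw [Finset.sum_comm]
      refine Finset.sum_congr rfl fun b _ => ?_
      rw [← Equiv.sum_comp (Equiv.addRight b)
        (fun x => (chi B (x + -b) : ℂ) * ((chi A x : ℂ) * γ (x + -b)))]
      refine Finset.sum_congr rfl fun z _ => ?_
      simp only [hu, Equiv.coe_addRight, add_neg_cancel_right]
      ring
    have h2 : (∑ b ∈ T, γ (-b)) * ∑ x ∈ A, γ x
        = ∑ b ∈ T, ∑ x, (chi B x : ℂ) * ((chi A x : ℂ) * γ (x + -b)) := by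
      rw [Finset.sum_mul]
      refine Finset.sum_congr rfl fun b _ => ?_
      rw [← sum_chi_mul_complex, Finset.mul_sum]
      refine Finset.sum_congr rfl fun x _ => ?_
      rw [AddChar.map_add_eq_mul]
      have := congrArg (fun r : ℝ => (r : ℂ)) (chi_mul_of_subset hA x)
      push_cast at this
      linear_combination (-γ x * γ (-b)) * this
    rw [h1, h2, ← Finset.sum_sub_distrib, hq, ← nsmul_eq_mul]
    refine (norm_sum_le _ _).trans (Finset.sum_le_card_nsmul _ _ _ fun b hb => ?_)
    refine (hinv b hb).norm_sum_sub_le (g := fun x => (chi A x : ℂ) * γ (x + -b)) fun x => ?_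
    rw [norm_mul, AddChar.norm_apply, mul_one, Complex.norm_real, Real.norm_eq_abs]
    exact abs_chi_le_one A x
  have hzero : q * A.card * (1 - δ / a) ≤ ‖∑ z, (H z : ℂ) * u 0 z‖ := by
    have h1 := hcoef 0
    have h2 : (∑ b ∈ T, (0 : AddChar G ℂ) (-b)) * ∑ x ∈ A, (0 : AddChar G ℂ) x
        = ((q * A.card : ℝ) : ℂ) := by
      simp [hq]
    rw [h2] at h1
    have h3 : ‖((q * A.card : ℝ) : ℂ)‖ = q * A.card := by
      rw [Complex.norm_real, Real.norm_of_nonneg (by positivity)]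
    have h4 := norm_sub_norm_le ((q * A.card : ℝ) : ℂ) (∑ z, (H z : ℂ) * u 0 z)
    rw [h3, norm_sub_rev] at h4
    have h5 : q * A.card * (1 - δ / a) = q * A.card - q * (δ * p) := by
      rw [← ha]; field_simp
    linarith
  -- The constant is 7/8·a/5 − a/20 = a/8: the sum of γ over T keeps 7/8 of |T|, and the cut-off
  -- error is at most a/20 because δ ≤ a²/20.
  have hlarge : ∀ γ ∈ L, q * A.card * (a / 8) ≤ ‖∑ z, (H z : ℂ) * u γ z‖ := by
    intro γ hγ
    have h1 := hcoef γ
    have h2 : 7 / 8 * q ≤ ‖∑ b ∈ T, γ (-b)‖ := by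
      have e : ∑ b ∈ T, γ (-b) = (q : ℂ) - ∑ b ∈ T, (1 - γ (-b)) := by
        rw [Finset.sum_sub_distrib]; simp [hq]
      have h3 : ‖∑ b ∈ T, (1 - γ (-b))‖ ≤ T.card • (1 / 8 : ℝ) :=
        (norm_sum_le _ _).trans (Finset.sum_le_card_nsmul _ _ _ fun b hb => by
          rw [norm_one_sub_neg]; exact hLT γ hγ b hb)
      rw [nsmul_eq_mul, ← hq] at h3
      rw [e]
      have h4 := norm_sub_norm_le (q : ℂ) (∑ b ∈ T, (1 - γ (-b)))
      rw [Complex.norm_real, Real.norm_of_nonneg hq0.le] at h4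
      linarith
    have h3 : 7 / 8 * q * (a / 5 * A.card) ≤ ‖(∑ b ∈ T, γ (-b)) * ∑ x ∈ A, γ x‖ := by
      rw [norm_mul]
      exact mul_le_mul h2 (hspec γ hγ) (by positivity) (norm_nonneg _)
    have h4 := norm_sub_norm_le ((∑ b ∈ T, γ (-b)) * ∑ x ∈ A, γ x) (∑ z, (H z : ℂ) * u γ z)
    rw [norm_sub_rev] at h4
    have h5 : q * (δ * p) ≤ q * (a / 20 * A.card) := by
      refine mul_le_mul_of_nonneg_left ?_ hq0.le
      rw [← ha]
      nlinarith
    nlinarith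
  have hsum : (q * A.card) ^ 2 * ((1 - δ / a) ^ 2 + L.card * (a / 8) ^ 2)
      ≤ ∑ γ ∈ insert 0 L, ‖∑ z, (H z : ℂ) * u γ z‖ ^ 2 := by
    rw [Finset.sum_insert hL]
    have hda : 0 ≤ 1 - δ / a := by
      rw [sub_nonneg, div_le_one ha0]; nlinarith
    have h1 : (q * A.card * (1 - δ / a)) ^ 2 ≤ ‖∑ z, (H z : ℂ) * u 0 z‖ ^ 2 :=
      pow_le_pow_left₀ (by positivity) hzero 2
    have h2 : L.card • (q * A.card * (a / 8)) ^ 2 ≤ ∑ γ ∈ L, ‖∑ z, (H z : ℂ) * u γ z‖ ^ 2 :=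
      Finset.card_nsmul_le_sum _ _ _ fun γ hγ =>
        pow_le_pow_left₀ (by positivity) (hlarge γ hγ) 2
    rw [nsmul_eq_mul] at h2
    linarith
  have hHsum : ∑ z, H z = q * A.card := by
    simp only [hH]
    rw [Finset.sum_comm]
    have : ∀ b ∈ T, ∑ z, chi A (z + b) = A.card := fun b _ => by
      rw [← sum_chi A]; exact Equiv.sum_comp (Equiv.addRight b) (chi A)
    rw [Finset.sum_congr rfl this, Finset.sum_const, nsmul_eq_mul]
  by_contra! hcon
  set θ := a * ((1 - δ / a) ^ 2 + L.card * (a / 8) ^ 2) / (1 + 2 * δ * L.card) with hθ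
  have hpos : 0 < ∑ z, H z := by rw [hHsum]; positivity
  have hlt : ∑ z, H z ^ 2 < θ * q * ∑ z, H z := by
    rw [Finset.mul_sum]
    obtain ⟨z0, -, hz0⟩ := Finset.exists_lt_of_sum_lt
      (show ∑ z : G, (0 : ℝ) < ∑ z, H z by simpa using hpos)
    refine Finset.sum_lt_sum (fun z _ => ?_) ⟨z0, Finset.mem_univ _, ?_⟩
    · rw [sq]; exact mul_le_mul_of_nonneg_right (hcon z).le (hHnn z)
    · rw [sq]; exact mul_lt_mul_of_pos_right (hcon z0) hz0
  have hD : 0 < 1 + 2 * δ * L.card := by positivity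
  have hfin := mul_lt_mul_of_pos_right hlt (show 0 < p * (1 + 2 * δ * L.card) by positivity)
  have e : θ * q * (∑ z, H z) * (p * (1 + 2 * δ * L.card))
      = (q * A.card) ^ 2 * ((1 - δ / a) ^ 2 + L.card * (a / 8) ^ 2) := by
    rw [hHsum, hθ, div_mul_eq_mul_div, div_mul_eq_mul_div, div_mul_eq_mul_div,
      div_eq_iff hD.ne']
    linear_combination (q ^ 2 * A.card * ((1 - δ / a) ^ 2 + L.card * (a / 8) ^ 2)
      * (1 + 2 * δ * L.card)) * ha
  linarith

/-- Two characters are close if their quotient is close to `1` on `C`. -/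
def CloseOn (C : Finset G) (γ γ' : AddChar G ℂ) : Prop := ∀ b ∈ C, ‖1 - (γ - γ') b‖ ≤ 1 / 2

lemma CloseOn.symm {C : Finset G} {γ γ' : AddChar G ℂ} (h : CloseOn C γ γ') : CloseOn C γ' γ := by
  intro b hb
  have := h b hb
  rw [← norm_one_sub_neg, ← AddChar.neg_apply, neg_sub] at this
  exact this

/-- Either there are `m` pairwise separated nontrivial characters in `S`, or `S` is covered by the
neighbourhoods of fewer than `m` characters together with the trivial one. -/
lemma exists_separated_or_cover [DecidableEq (AddChar G ℂ)] (C : Finset G)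
    (S : Finset (AddChar G ℂ)) (m : ℕ) :
    ∃ L ⊆ S, L.card ≤ m ∧ (0 : AddChar G ℂ) ∉ L ∧
      ((L.card = m ∧ ∀ γ ∈ insert 0 L, ∀ γ' ∈ insert 0 L, γ ≠ γ' → ¬ CloseOn C γ γ') ∨
        ∀ γ ∈ S, ∃ γ' ∈ insert 0 L, CloseOn C γ γ') := by
  classical
  let Sep : Finset (AddChar G ℂ) → Prop := fun L => (0 : AddChar G ℂ) ∉ L ∧
    ∀ γ ∈ insert 0 L, ∀ γ' ∈ insert 0 L, γ ≠ γ' → ¬ CloseOn C γ γ'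
  have hne : (S.powerset.filter Sep).Nonempty := by
    refine ⟨∅, Finset.mem_filter.2 ⟨Finset.empty_mem_powerset _, Finset.notMem_empty _, ?_⟩⟩
    intro γ hγ γ' hγ' h
    simp only [insert_empty_eq, Finset.mem_singleton] at hγ hγ'
    exact absurd (hγ.trans hγ'.symm) h
  -- A separated set of maximal size covers S, since an uncovered character could be adjoined. If it
  -- has m or more elements, any m of them remain separated.
  obtain ⟨L, hL, hmax⟩ := Finset.exists_max_image _ Finset.card hne
  rw [Finset.mem_filter, Finset.mem_powerset] at hL
  obtain ⟨hLS, h0, hsep⟩ := hL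
  by_cases hm : m ≤ L.card
  · obtain ⟨L', hL', hcard⟩ := Finset.exists_subset_card_eq hm
    have hsub := Finset.insert_subset_insert (0 : AddChar G ℂ) hL'
    exact ⟨L', hL'.trans hLS, hcard.le, fun h => h0 (hL' h), Or.inl ⟨hcard,
      fun γ hγ γ' hγ' h => hsep γ (hsub hγ) γ' (hsub hγ') h⟩⟩
  · refine ⟨L, hLS, by omega, h0, Or.inr fun γ hγ => ?_⟩
    by_cases hγL : γ ∈ insert 0 L
    · exact ⟨γ, hγL, fun b _ => by simp⟩
    by_contra! hcon
    have hγL' : γ ∉ L := fun h => hγL (Finset.mem_insert_of_mem h)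
    have hγ0 : γ ≠ 0 := fun h => hγL (h ▸ Finset.mem_insert_self _ _)
    have hmem : insert γ L ∈ S.powerset.filter Sep := by
      rw [Finset.mem_filter, Finset.mem_powerset]
      refine ⟨Finset.insert_subset hγ hLS, ?_, ?_⟩
      · rw [Finset.mem_insert, not_or]; exact ⟨hγ0.symm, h0⟩
      · intro ψ hψ ψ' hψ' hne
        rw [Finset.insert_comm, Finset.mem_insert] at hψ hψ'
        rcases hψ with rfl | hψ <;> rcases hψ' with rfl | hψ'
        · exact absurd rfl hne
        · exact hcon _ hψ'
        · exact fun h => hcon _ hψ h.symm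
        · exact hsep _ hψ _ hψ' hne
    have := hmax _ hmem
    rw [Finset.card_insert_of_notMem hγL'] at this
    omega

end SpectrumIncrement

/-! ### The density increment step and its iteration. -/

section IncrementStep

variable {G : Type*}

lemma chi_mono {A B : Finset G} (h : A ⊆ B) (x : G) : chi A x ≤ chi B x := by
  by_cases hx : x ∈ A
  · rw [chi_of_mem hx, chi_of_mem (h hx)]
  · rw [chi_of_notMem hx]; exact chi_nonneg B x

lemma card_filter_eq_sum_chi (A B : Finset G) [DecidablePred (· ∈ A)] :
    ((B.filter (· ∈ A)).card : ℝ) = ∑ b ∈ B, chi A b := by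
  rw [Finset.card_filter]
  push_cast
  refine Finset.sum_congr rfl fun b _ => ?_
  by_cases h : b ∈ A
  · rw [if_pos h, chi_of_mem h]
  · rw [if_neg h, chi_of_notMem h]

variable [Fintype G]

/-- The preimage of a finset under a self-map. -/
noncomputable def pullback (φ : G → G) (A : Finset G) : Finset G := by
  classical exact Finset.univ.filter fun x => φ x ∈ A

lemma mem_pullback {φ : G → G} {A : Finset G} {x : G} : x ∈ pullback φ A ↔ φ x ∈ A := by
  simp [pullback]

lemma chi_pullback (φ : G → G) (A : Finset G) (x : G) : chi (pullback φ A) x = chi A (φ x) := by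
  by_cases h : φ x ∈ A
  · rw [chi_of_mem h, chi_of_mem (mem_pullback.2 h)]
  · rw [chi_of_notMem h, chi_of_notMem (fun h' => h (mem_pullback.1 h'))]

variable [AddCommGroup G]

/-- The number of three-term progressions in `A`, the trivial ones included. -/
noncomputable def apCount (A : Finset G) : ℝ :=
  ∑ x, ∑ y, chi A (x - y) * chi A x * chi A (x + y)

/-- Injective affine maps permute the progressions. Doubling has to be allowed because one kind of
increment lives on a translate of a doubled Bohr set. -/
lemma apCount_pullback (φ : G →+ G) (hφ : Function.Injective φ) (z : G) (A : Finset G) :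
    apCount (pullback (fun x => z + φ x) A) = apCount A := by
  have hb : Function.Bijective φ := Finite.injective_iff_bijective.1 hφ
  let e : G ≃ G := Equiv.ofBijective φ hb
  unfold apCount
  refine Eq.trans ?_ (Equiv.sum_comp (e.trans (Equiv.addLeft z))
    (fun x => ∑ y, chi A (x - y) * chi A x * chi A (x + y)))
  refine Finset.sum_congr rfl fun x _ => ?_
  refine Eq.trans ?_ (Equiv.sum_comp e _)
  refine Finset.sum_congr rfl fun y _ => ?_
  simp only [chi_pullback, map_sub, map_add, e, Equiv.trans_apply, Equiv.ofBijective_apply,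
    Equiv.coe_addLeft, add_sub_assoc, add_assoc]

lemma apCount_translate (z : G) (A : Finset G) :
    apCount (pullback (fun x => z + x) A) = apCount A :=
  apCount_pullback (AddMonoidHom.id G) Function.injective_id z A

lemma sum_le_apCount {A A₁ A₂ : Finset G} (h₁ : A₁ ⊆ A) (h₂ : A₂ ⊆ A) :
    ∑ m ∈ A₂, ∑ u, chi A₁ u * chi A₁ (m + m - u) ≤ apCount A := by
  rw [← sum_chi_mul]
  refine Finset.sum_le_sum fun x _ => ?_
  rw [← Equiv.sum_comp (Equiv.subLeft x), Finset.mul_sum]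
  refine Finset.sum_le_sum fun y _ => ?_
  have e : x + x - (x - y) = x + y := by abel
  simp only [Equiv.subLeft_apply, e]
  have h1 := chi_mono h₁ (x - y)
  have h2 := chi_mono h₁ (x + y)
  have h3 := chi_mono h₂ x
  calc chi A₂ x * (chi A₁ (x - y) * chi A₁ (x + y))
      ≤ chi A x * (chi A (x - y) * chi A (x + y)) :=
        mul_le_mul h3 (mul_le_mul h1 h2 (chi_nonneg _ _) (chi_nonneg _ _))
          (mul_nonneg (chi_nonneg _ _) (chi_nonneg _ _)) (chi_nonneg _ _)
    _ = _ := by ring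

/-- One can find a common centre at which `A` has about the expected density on two
small sets, unless `A` is denser on some translate of one of them. -/
lemma exists_common_centre {α δ : ℝ} {A B B₁ B₂ : Finset G} (hB : 0 < (B.card : ℝ))
    (hB₁ : 0 < (B₁.card : ℝ)) (hB₂ : 0 < (B₂.card : ℝ))
    (hA : α * B.card ≤ ∑ b ∈ B, chi A b) (hinv₁ : ∀ s ∈ B₁, ShiftInv δ B s)
    (hinv₂ : ∀ s ∈ B₂, ShiftInv δ B s) :
    ∃ x, 2 * (α - δ) ≤ (∑ b ∈ B₁, chi A (x + b)) / B₁.card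
      + (∑ b ∈ B₂, chi A (x + b)) / B₂.card := by
  classical
  have key : ∀ C : Finset G, 0 < (C.card : ℝ) → (∀ s ∈ C, ShiftInv δ B s) →
      (α - δ) * B.card ≤ ∑ x ∈ B, (∑ b ∈ C, chi A (x + b)) / C.card := by
    intro C hC hinv
    have h1 := sum_translates_ge (A := B.filter (· ∈ A)) (Finset.filter_subset _ _) hinv
    rw [card_filter_eq_sum_chi] at h1
    rw [← Finset.sum_div, le_div_iff₀ hC]
    have h2 : ∑ x ∈ B, ∑ b ∈ C, chi (B.filter (· ∈ A)) (x + b)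
        ≤ ∑ x ∈ B, ∑ b ∈ C, chi A (x + b) :=
      Finset.sum_le_sum fun x _ => Finset.sum_le_sum fun b _ =>
        chi_mono (fun y hy => (Finset.mem_filter.1 hy).2) _
    refine le_trans ?_ (h1.trans h2)
    gcongr
    linarith
  -- The two averages are added before x is chosen, so that one centre serves both sets.
  have h := add_le_add (key B₁ hB₁ hinv₁) (key B₂ hB₂ hinv₂)
  rw [← Finset.sum_add_distrib] at h
  have hne : B.Nonempty := Finset.card_pos.1 (by exact_mod_cast hB)
  by_contra! hcon
  have h2 := Finset.sum_lt_sum_of_nonempty hne fun x _ => hcon x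
  rw [Finset.sum_const, nsmul_eq_mul] at h2
  linarith

end IncrementStep

section IncrementStep

variable {G : Type*} [AddCommGroup G] [Fintype G]

/-- `A` has density at least `α` on the regular Bohr set with data `(Γ, w)`. -/
structure DenseOn (ε ρ α : ℝ) (A : Finset G) (Γ : Finset (AddChar G ℂ))
    (w : AddChar G ℂ → ℝ) : Prop where
  pos : ∀ γ ∈ Γ, 0 < w γ
  le_two : ∀ γ ∈ Γ, w γ ≤ 2
  regular : RegularBohr ε ρ Γ w
  dense : α * (bohr Γ w).card ≤ ∑ b ∈ bohr Γ w, chi A b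

/-- This builds the Bohr set on which the increment takes place: old frequencies get width about
ρw₂, so its elements are almost periods at scale w₂, and new ones get width about 1/8. The factor
256J³ is 32/ρ³, from ρ²/16 in w₂, a further ρ, and 1/2 from regularisation. -/
lemma exists_regular_enlargement [DecidableEq (AddChar G ℂ)] {ε : ℝ} (hε : 0 < ε) {D J : ℕ}
    (hJ : J = 7 * (D + 1) * ⌈1 / ε⌉₊) {Γ L : Finset (AddChar G ℂ)} (hD : (Γ ∪ L).card ≤ D)
    {w w₂ : AddChar G ℂ → ℝ} (hw : ∀ γ ∈ Γ, 0 < w γ) (hw2 : ∀ γ ∈ Γ, w γ ≤ 2)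
    (hw₂ : ∀ γ ∈ Γ, (1 / (2 * J)) ^ 2 / 16 * w γ ≤ w₂ γ) (hw₂' : ∀ γ ∈ Γ, 4 * w₂ γ ≤ w γ) :
    ∃ w' : AddChar G ℂ → ℝ, (∀ γ ∈ Γ ∪ L, 0 < w' γ) ∧ (∀ γ ∈ Γ ∪ L, w' γ ≤ 1 / 8) ∧
      (∀ γ ∈ Γ, w' γ ≤ ((1 / (2 * J) : ℝ) • w₂) γ) ∧
      RegularBohr ε (1 / (2 * J)) (Γ ∪ L) w' ∧
      ((bohr Γ w).card : ℝ) ≤ (5 * (256 * J ^ 3 : ℕ)) ^ (2 * D) * (bohr (Γ ∪ L) w').card := by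
  have hn : (0 : ℝ) < ⌈1 / ε⌉₊ := lt_of_lt_of_le (by positivity) (Nat.le_ceil (1 / ε))
  have hn1 : 1 ≤ ⌈1 / ε⌉₊ := by exact_mod_cast hn
  have hJ7 : 7 ≤ J := by rw [hJ]; nlinarith
  have hJ7' : (7 : ℝ) ≤ J := by exact_mod_cast hJ7
  have hM : 1 ≤ 256 * J ^ 3 := Nat.mul_pos (by norm_num) (pow_pos (by omega) 3)
  have hJ3 : (343 : ℝ) ≤ (J : ℝ) ^ 3 := by
    calc (343 : ℝ) = 7 ^ 3 := by norm_num
      _ ≤ (J : ℝ) ^ 3 := by gcongr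
  set ρ : ℝ := 1 / (2 * J) with hρ
  have hρ0 : 0 < ρ := by positivity
  have hρ1 : ρ ≤ 1 / 14 := by
    rw [hρ]; exact one_div_le_one_div_of_le (by norm_num) (by linarith)
  let v : AddChar G ℂ → ℝ := fun γ => if γ ∈ Γ then ρ * w₂ γ else 1 / 8
  have hv0 : ∀ γ ∈ Γ ∪ L, 0 < v γ := by
    intro γ _
    simp only [v]
    split_ifs with h
    · have := hw₂ γ h
      have := hw γ h
      have : 0 < ρ ^ 2 / 16 * w γ := by positivity
      have : 0 < w₂ γ := by linarith
      positivity
    · norm_num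
  have hv1 : ∀ γ ∈ Γ ∪ L, v γ ≤ 1 / 8 := by
    intro γ _
    simp only [v]
    split_ifs with h
    · nlinarith [hw₂' γ h, hw2 γ h, hw γ h]
    · norm_num
  obtain ⟨l, hl1, hl2, hreg⟩ := exists_regularBohr (Γ ∪ L) hv0 hε hD hJ
  refine ⟨l • v, ?_, ?_, ?_, hreg, ?_⟩
  · intro γ hγ
    have := hv0 γ hγ
    simp only [Pi.smul_apply, smul_eq_mul]
    nlinarith
  · intro γ hγ
    have := hv0 γ hγ
    have := hv1 γ hγ
    simp only [Pi.smul_apply, smul_eq_mul]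
    nlinarith
  · intro γ hγ
    have := hv0 γ (Finset.mem_union_left _ hγ)
    simp only [Pi.smul_apply, smul_eq_mul]
    calc l * v γ ≤ 1 * v γ := by gcongr
      _ = ρ * w₂ γ := by simp [v, hγ]
  -- A frequency of width 2 imposes no condition, so new frequencies may be inserted before the
  -- widths are compared.
  · let v' : AddChar G ℂ → ℝ := fun γ => if γ ∈ Γ then w γ else 2
    have hsub : bohr Γ w ⊆ bohr (Γ ∪ L) v' := by
      intro x hx
      rw [mem_bohr] at hx ⊢
      intro γ _
      simp only [v']
      split_ifs with h
      · exact hx γ h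
      · exact norm_one_sub_le_two γ x
    have h1 := card_bohr_le (Γ ∪ L) (w := v') (w' := l • v) hM (by
      intro γ _
      simp only [v']
      split_ifs with h
      · exact hw γ h
      · norm_num) (by
      intro γ _
      have hc : ((256 * J ^ 3 : ℕ) : ℝ) = 256 * (J : ℝ) ^ 3 := by push_cast; ring
      rw [hc]
      simp only [v', v, Pi.smul_apply, smul_eq_mul]
      split_ifs with h
      · have h2 := hw₂ γ h
        have h3 := hw γ h
        have h4 : w γ / (256 * (J : ℝ) ^ 3) = 1 / 2 * (ρ * (ρ ^ 2 / 16 * w γ)) := by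
          rw [hρ]; field_simp; norm_num
        rw [h4]
        gcongr
      · rw [div_le_iff₀ (by positivity)]
        nlinarith)
    calc ((bohr Γ w).card : ℝ) ≤ (bohr (Γ ∪ L) v').card := by
          exact_mod_cast Finset.card_le_card hsub
      _ ≤ _ := h1
      _ ≤ _ := by
          gcongr
          have : (1 : ℝ) ≤ (256 * J ^ 3 : ℕ) := by exact_mod_cast hM
          linarith

end IncrementStep

section IncrementStep

variable {G : Type*} [AddCommGroup G] [Fintype G]

lemma smul_mem_bohr_of_four {Γ : Finset (AddChar G ℂ)} {w₁ w₂ : AddChar G ℂ → ℝ} {ρ : ℝ}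
    (h : ∀ γ ∈ Γ, 4 * w₂ γ ≤ ρ * w₁ γ) {x y : G}
    (hx : x ∈ bohr Γ w₂) (hy : y ∈ bohr Γ w₂) : x + x - (y + y) ∈ bohr Γ (ρ • w₁) := by
  rw [sub_eq_add_neg]
  have h1 : x + x ∈ bohr Γ ((2 : ℝ) • w₂) := add_mem_bohr hx hx fun γ _ => by
    simp only [Pi.smul_apply, smul_eq_mul]; linarith
  have h2 : y + y ∈ bohr Γ ((2 : ℝ) • w₂) := add_mem_bohr hy hy fun γ _ => by
    simp only [Pi.smul_apply, smul_eq_mul]; linarith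
  refine add_mem_bohr h1 (neg_mem_bohr.2 h2) fun γ hγ => ?_
  have := h γ hγ
  simp only [Pi.smul_apply, smul_eq_mul]; linarith

/-- If a set has roughly density `α` on two nested Bohr sets of different scale, but few
progressions, then an affine image of it is denser on some smaller Bohr set. -/
lemma increment_of_few_aps (hodd : Function.Injective fun x : G => x + x)
    {α ε : ℝ} {m D J : ℕ} (hα : 0 < α) (hα1 : α ≤ 1) (hε : 0 < ε) (hεα : ε ≤ α ^ 2 / 2000)
    (hm : 32 ≤ m * α ^ 2) (hmε : 4 * ε * m ≤ 1 / 5) (hJ : J = 7 * (D + 1) * ⌈1 / ε⌉₊)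
    {Γ : Finset (AddChar G ℂ)} (hΓ : Γ.card + m ≤ D) {w w₁ w₂ : AddChar G ℂ → ℝ}
    (hw : ∀ γ ∈ Γ, 0 < w γ) (hw2 : ∀ γ ∈ Γ, w γ ≤ 2)
    (hw₂w : ∀ γ ∈ Γ, (1 / (2 * J)) ^ 2 / 16 * w γ ≤ w₂ γ) (hw₁w : ∀ γ ∈ Γ, w₁ γ ≤ w γ)
    (hw₁0 : ∀ γ ∈ Γ, 0 < w₁ γ) (hw₂0 : ∀ γ ∈ Γ, 0 < w₂ γ)
    (hw₂w₁ : ∀ γ ∈ Γ, 4 * w₂ γ ≤ 1 / (2 * J) * w₁ γ)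
    (hreg₁ : RegularBohr ε (1 / (2 * J)) Γ w₁) (hreg₂ : RegularBohr ε (1 / (2 * J)) Γ w₂)
    {A A₁ A₂ : Finset G} (hA₁ : A₁ ⊆ A) (hA₂ : A₂ ⊆ A) (hB₁ : A₁ ⊆ bohr Γ w₁)
    (hB₂ : A₂ ⊆ bohr Γ w₂) {a₁ a₂ : ℝ} (ha₁ : a₁ * (bohr Γ w₁).card = A₁.card)
    (ha₂ : a₂ * (bohr Γ w₂).card = A₂.card) (ha₁l : 197 / 200 * α ≤ a₁)
    (ha₂l : 197 / 200 * α ≤ a₂) (ha₂u : a₂ ≤ 201 / 200 * α)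
    (hcount : ∑ m ∈ A₂, ∑ u, chi A₁ u * chi A₁ (m + m - u)
      ≤ a₁ ^ 2 / 4 * A₂.card * (bohr Γ w₁).card) :
    ∃ (Γ' : Finset (AddChar G ℂ)) (w' : AddChar G ℂ → ℝ) (A' : Finset G),
      DenseOn ε (1 / (2 * J)) (201 / 200 * α) A' Γ' w' ∧ apCount A' = apCount A ∧
      Γ'.card ≤ Γ.card + m ∧
      ((bohr Γ w).card : ℝ) ≤ (5 * (256 * J ^ 3 : ℕ)) ^ (2 * D) * (bohr Γ' w').card := by
  classical
  have hn : (0 : ℝ) < ⌈1 / ε⌉₊ := lt_of_lt_of_le (by positivity) (Nat.le_ceil (1 / ε))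
  have hn1 : 1 ≤ ⌈1 / ε⌉₊ := by exact_mod_cast hn
  have hJ7 : 7 ≤ J := by rw [hJ]; nlinarith
  have hJ7' : (7 : ℝ) ≤ J := by exact_mod_cast hJ7
  set ρ : ℝ := 1 / (2 * J) with hρ
  have hρ0 : 0 < ρ := by positivity
  have hρ1 : ρ ≤ 1 := by
    rw [hρ, div_le_one (by positivity)]; linarith
  set B₁ := bohr Γ w₁ with hB₁def
  set B₂ := bohr Γ w₂ with hB₂def
  set C := bohr Γ (ρ • w₂) with hC
  have hB₁pos : 0 < (B₁.card : ℝ) := bohr_card_pos fun γ hγ => (hw₁0 γ hγ).le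
  have hB₂pos : 0 < (B₂.card : ℝ) := bohr_card_pos fun γ hγ => (hw₂0 γ hγ).le
  have ha₁0 : 0 < a₁ := by linarith only [ha₁l, hα]
  have ha₂0 : 0 < a₂ := by linarith only [ha₂l, hα]
  have hA₂ne : A₂.Nonempty := by
    rw [← Finset.card_pos]
    have : 0 < (A₂.card : ℝ) := by rw [← ha₂]; positivity
    exact_mod_cast this
  have hδα : 2 * ε ≤ α ^ 2 / 1000 := by linarith only [hεα]
  have hδα' : 2 * ε ≤ α / 1000 := by nlinarith only [hδα, hα, hα1]
  have hαa₂ : 97 / 100 * α ^ 2 ≤ a₂ ^ 2 := by nlinarith only [ha₂l, hα]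
  have hCB₂ : C ⊆ B₂ := bohr_mono fun γ hγ => by
    have := hw₂0 γ hγ
    simp only [Pi.smul_apply, smul_eq_mul]; nlinarith
  have hinv₁ : ∀ x ∈ B₂, ∀ y ∈ B₂, ShiftInv (2 * ε) B₁ (x + x - (y + y)) := fun x hx y hy =>
    hreg₁.shiftInv hρ0.le (fun γ hγ => (hw₁0 γ hγ).le)
      (smul_mem_bohr_of_four hw₂w₁ hx hy)
  have hinv₂ : ∀ b ∈ C, ShiftInv (2 * ε) B₂ (-b) := fun b hb =>
    hreg₂.shiftInv hρ0.le (fun γ hγ => (hw₂0 γ hγ).le) (neg_mem_bohr.2 hb)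
  have h0B₂ : (0 : G) ∈ B₂ := zero_mem_bohr fun γ hγ => (hw₂0 γ hγ).le
  have hmass := spectral_mass hB₁ hB₁pos (fun x => neg_mem_bohr) hA₂ne ha₁ ha₁0
    (δ := 2 * ε) (by linarith only [hδα', ha₁l, hα])
    (fun y hy => by
      have := hinv₁ 0 h0B₂ y (hB₂ hy)
      rwa [add_zero, zero_sub] at this) hcount
  set S := Finset.univ.filter
    (fun γ : AddChar G ℂ => a₁ / 4 * A₂.card < ‖∑ m ∈ A₂, γ (m + m)‖) with hS
  set S₂ := Finset.univ.filter
    (fun γ : AddChar G ℂ => a₂ / 5 * A₂.card ≤ ‖∑ m ∈ A₂, γ m‖) with hS₂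
  -- Both alternatives add the same L, of size at most m, so the new Bohr set T can be built before
  -- splitting into cases.
  obtain ⟨L, hLS, hLm, hL0, hL⟩ := exists_separated_or_cover C S₂ m
  have hcardΓ' : (Γ ∪ L).card ≤ Γ.card + m := (Finset.card_union_le _ _).trans (by omega)
  obtain ⟨w', hw'0, hw'8, hw'Γ, hreg', hsize⟩ := exists_regular_enlargement hε hJ
    (hcardΓ'.trans hΓ) hw hw2 hw₂w (fun γ hγ => by
      have := hw₂w₁ γ hγ
      have := hw₁w γ hγ
      have := hw₁0 γ hγ
      nlinarith)
  set T := bohr (Γ ∪ L) w' with hT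
  have hTpos : 0 < (T.card : ℝ) := bohr_card_pos fun γ hγ => (hw'0 γ hγ).le
  have hTne : T.Nonempty := Finset.card_pos.1 (by exact_mod_cast hTpos)
  have hTC : T ⊆ C := fun x hx => by
    rw [mem_bohr] at hx ⊢
    exact fun γ hγ => (hx γ (Finset.mem_union_left _ hγ)).trans (hw'Γ γ hγ)
  have hTL : ∀ γ ∈ L, ∀ b ∈ T, ‖1 - γ b‖ ≤ 1 / 8 := fun γ hγ b hb =>
    (mem_bohr.1 hb γ (Finset.mem_union_right _ hγ)).trans (hw'8 γ (Finset.mem_union_right _ hγ))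
  have hfinish : ∀ φ : G →+ G, Function.Injective φ →
      (∃ z, 201 / 200 * α * T.card ≤ ∑ b ∈ T, chi A (z + φ b)) →
      ∃ (Γ' : Finset (AddChar G ℂ)) (w' : AddChar G ℂ → ℝ) (A' : Finset G),
      DenseOn ε ρ (201 / 200 * α) A' Γ' w' ∧ apCount A' = apCount A ∧
      Γ'.card ≤ Γ.card + m ∧
      ((bohr Γ w).card : ℝ) ≤ (5 * (256 * J ^ 3 : ℕ)) ^ (2 * D) * (bohr Γ' w').card := by
    rintro φ hφ ⟨z, hz⟩
    refine ⟨Γ ∪ L, w', pullback (fun x => z + φ x) A,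
      ⟨hw'0, fun γ hγ => (hw'8 γ hγ).trans (by norm_num), hreg', ?_⟩,
      apCount_pullback φ hφ z A, hcardΓ', hsize⟩
    simp_rw [chi_pullback]
    exact hz
  rcases hL with ⟨hLcard, hsep⟩ | hcov
  -- Many separated characters: 32 ≤ mα² makes the Bessel gain m(a₂/8)² at least 48/100, which
  -- outweighs the orthogonality loss 6/5 and the drop from α to a₂.
  · refine hfinish (AddMonoidHom.id G) Function.injective_id ?_
    obtain ⟨z, hz⟩ := increment_of_spectrum hB₂ ha₂ ha₂0 hB₂pos hTne (δ := 2 * ε)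
      (by linarith only [hε]) (by linarith only [hδα, hαa₂, sq_nonneg α])
      (fun b hb => hinv₂ b (hTC hb)) L hL0
      (fun γ hγ => (Finset.mem_filter.1 (hLS hγ)).2)
      (fun γ hγ γ' hγ' hne => by
        have := hsep γ hγ γ' hγ' hne
        simp only [CloseOn, not_forall, not_le] at this
        obtain ⟨b, hb, hb'⟩ := this
        exact (hinv₂ b hb).norm_sum_char_le hb') hTL
    refine ⟨z, le_trans ?_ (hz.trans (Finset.sum_le_sum fun b _ => chi_mono hA₂ _))⟩
    refine mul_le_mul_of_nonneg_right ?_ hTpos.le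
    rw [hLcard, le_div_iff₀ (by positivity)]
    have h1 : 2 * ε / a₂ ≤ 1 / 500 := by
      rw [div_le_iff₀ ha₂0]; linarith only [hδα', ha₂l, hα]
    have h2 : 99 / 100 ≤ (1 - 2 * ε / a₂) ^ 2 := by nlinarith only [h1]
    have h3 : 48 / 100 ≤ (m : ℝ) * (a₂ / 8) ^ 2 := by
      have : (m : ℝ) * (97 / 100 * α ^ 2) ≤ m * a₂ ^ 2 := by gcongr
      linarith only [this, hm]
    have h4 : 1 + 2 * (2 * ε) * m ≤ 6 / 5 := by linarith only [hmε]
    calc 201 / 200 * α * (1 + 2 * (2 * ε) * m) ≤ 201 / 200 * α * (6 / 5) := by gcongr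
      _ ≤ 197 / 200 * α * (147 / 100) := by linarith only [hα]
      _ ≤ a₂ * ((1 - 2 * ε / a₂) ^ 2 + m * (a₂ / 8) ^ 2) :=
          mul_le_mul ha₂l (by linarith only [h2, h3]) (by norm_num) ha₂0.le
  · let dbl : G →+ G := ⟨⟨fun x => x + x, add_zero 0⟩, fun x y => by
      change x + y + (x + y) = x + x + (y + y); abel⟩
    refine hfinish dbl hodd ?_
    -- Few characters cover the spectrum: for γ in S, 2γ is within 1/2 on C of some γ' that is
    -- within 1/8 of 1 on T. So γ(2b) is within 5/8 of 1, leaving κ = 3/8. The relative gain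
    -- (3/8)²/4 = 9/256 beats the 1.5% possible drop in a₁ and the required 0.5% increase.
    obtain ⟨z, hz⟩ := increment_of_mass (φ := fun x => x + x) (κ := 3 / 8) (K := a₁ ^ 2 / 4) hB₁
      ha₁ ha₁0 hB₁pos hTne (fun b hb b' hb' => hinv₁ b' (hCB₂ (hTC hb')) b (hCB₂ (hTC hb))) S
      (by norm_num) (fun γ hγ => by
        have hγ2 : γ + γ ∈ S₂ := by
          rw [hS, Finset.mem_filter] at hγ
          rw [hS₂, Finset.mem_filter]
          refine ⟨Finset.mem_univ _, ?_⟩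
          have e : ∀ m, (γ + γ) m = γ (m + m) := fun m => by
            rw [AddChar.add_apply, AddChar.map_add_eq_mul]
          simp_rw [e]
          refine le_trans ?_ hγ.2.le
          refine mul_le_mul_of_nonneg_right ?_ (Nat.cast_nonneg _)
          linarith only [ha₁l, ha₂u, hα]
        obtain ⟨γ', hγ', hclose⟩ := hcov _ hγ2
        have hb : ∀ b ∈ T, ‖1 - γ (b + b)‖ ≤ 5 / 8 := by
          intro b hb
          have h1 : ‖1 - γ' b‖ ≤ 1 / 8 := by
            rw [Finset.mem_insert] at hγ'
            rcases hγ' with rfl | h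
            · simp
            · exact hTL γ' h b hb
          have h2 := hclose b (hTC hb)
          have e : 1 - γ (b + b) = (1 - γ' b) + γ' b * (1 - (γ + γ - γ') b) := by
            rw [mul_sub, ← AddChar.add_apply, add_sub_cancel, AddChar.add_apply,
              AddChar.map_add_eq_mul]
            ring
          rw [e]
          refine (norm_add_le _ _).trans ?_
          rw [norm_mul, AddChar.norm_apply, one_mul]
          linarith only [h1, h2]
        have h3 : ‖∑ b ∈ T, (1 - γ (b + b))‖ ≤ T.card • (5 / 8 : ℝ) :=
          (norm_sum_le _ _).trans (Finset.sum_le_card_nsmul _ _ _ hb)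
        rw [nsmul_eq_mul] at h3
        have e : ∑ b ∈ T, γ (b + b) = ((T.card : ℝ) : ℂ) - ∑ b ∈ T, (1 - γ (b + b)) := by
          rw [Finset.sum_sub_distrib]; simp
        rw [e]
        have h4 := norm_sub_norm_le ((T.card : ℝ) : ℂ) (∑ b ∈ T, (1 - γ (b + b)))
        rw [Complex.norm_real, Real.norm_of_nonneg hTpos.le] at h4
        linarith only [h3, h4]) hmass
    refine ⟨z, le_trans ?_ (hz.trans (Finset.sum_le_sum fun b _ => chi_mono hA₁ _))⟩
    refine mul_le_mul_of_nonneg_right ?_ hTpos.le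
    have e : (3 / 8 : ℝ) ^ 2 * (a₁ ^ 2 / 4) / a₁ = 9 / 256 * a₁ := by field_simp; norm_num
    rw [e]
    have h1 : a₁ * (1 / 1000) ≥ a₁ * (2 * ε) := by
      refine mul_le_mul_of_nonneg_left ?_ ha₁0.le
      linarith only [hδα', hα1]
    linarith only [h1, hδα', ha₁l, hα]

end IncrementStep

section IncrementStep

variable {G : Type*} [AddCommGroup G] [Fintype G]

/-- A set which is dense on a regular Bohr set has many three-term progressions, or an affine
image of it is denser on a Bohr set of slightly larger rank. -/
lemma many_aps_or_increment (hodd : Function.Injective fun x : G => x + x)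
    {α ε : ℝ} {m D J : ℕ} (hα : 0 < α) (hα1 : α ≤ 1) (hε : 0 < ε) (hεα : ε ≤ α ^ 2 / 2000)
    (hm : 32 ≤ m * α ^ 2) (hmε : 4 * ε * m ≤ 1 / 5) (hJ : J = 7 * (D + 1) * ⌈1 / ε⌉₊)
    {Γ : Finset (AddChar G ℂ)} (hΓ : Γ.card + m ≤ D) {w : AddChar G ℂ → ℝ} {A : Finset G}
    (hA : DenseOn ε (1 / (2 * J)) α A Γ w) :
    α ^ 3 / 16 * ((bohr Γ w).card : ℝ) ^ 2
        ≤ (5 * (256 * J ^ 3 : ℕ)) ^ (4 * D) * apCount A ∨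
    ∃ (Γ' : Finset (AddChar G ℂ)) (w' : AddChar G ℂ → ℝ) (A' : Finset G),
      DenseOn ε (1 / (2 * J)) (201 / 200 * α) A' Γ' w' ∧ apCount A' = apCount A ∧
      Γ'.card ≤ Γ.card + m ∧
      ((bohr Γ w).card : ℝ) ≤ (5 * (256 * J ^ 3 : ℕ)) ^ (2 * D) * (bohr Γ' w').card := by
  classical
  have hn : (0 : ℝ) < ⌈1 / ε⌉₊ := lt_of_lt_of_le (by positivity) (Nat.le_ceil (1 / ε))
  have hn1 : 1 ≤ ⌈1 / ε⌉₊ := by exact_mod_cast hn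
  have hJ7 : 7 ≤ J := by rw [hJ]; nlinarith
  have hJ7' : (7 : ℝ) ≤ J := by exact_mod_cast hJ7
  have hM : 1 ≤ 256 * J ^ 3 := Nat.mul_pos (by norm_num) (pow_pos (by omega) 3)
  have hM' : (1 : ℝ) ≤ (256 * J ^ 3 : ℕ) := by exact_mod_cast hM
  set ρ : ℝ := 1 / (2 * J) with hρ
  have hρ0 : 0 < ρ := by positivity
  have hρ1 : ρ ≤ 1 := by
    rw [hρ, div_le_one (by positivity)]; linarith only [hJ7']
  have hw0 := hA.pos
  -- End points live at scale about ρw and midpoints at a scale smaller by a further factor of about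
  -- ρ/4; the 4 leaves room for the difference of two doubled midpoints to be an almost period of
  -- the larger set.
  obtain ⟨l₁, hl₁, hl₁', hreg₁⟩ := exists_regularBohr Γ (w := ρ • w) (fun γ hγ => by
    have := hw0 γ hγ
    simp only [Pi.smul_apply, smul_eq_mul]; positivity) hε (show Γ.card ≤ D by omega) hJ
  set w₁ := l₁ • ρ • w with hw₁
  have hw₁0 : ∀ γ ∈ Γ, 0 < w₁ γ := fun γ hγ => by
    have := hw0 γ hγ
    simp only [hw₁, Pi.smul_apply, smul_eq_mul]; positivity
  obtain ⟨l₂, hl₂, hl₂', hreg₂⟩ := exists_regularBohr Γ (w := (ρ / 4) • w₁) (fun γ hγ => by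
    have := hw₁0 γ hγ
    simp only [Pi.smul_apply, smul_eq_mul]; positivity) hε (show Γ.card ≤ D by omega) hJ
  set w₂ := l₂ • (ρ / 4) • w₁ with hw₂
  have hw₂0 : ∀ γ ∈ Γ, 0 < w₂ γ := fun γ hγ => by
    have := hw₁0 γ hγ
    simp only [hw₂, Pi.smul_apply, smul_eq_mul]; positivity
  have hw₁ρ : ∀ γ ∈ Γ, w₁ γ ≤ (ρ • w) γ := fun γ hγ => by
    have := hw0 γ hγ
    have h : 0 ≤ ρ * w γ := by positivity
    simp only [hw₁, Pi.smul_apply, smul_eq_mul]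
    exact mul_le_of_le_one_left h hl₁'
  have hρw : ∀ γ ∈ Γ, (ρ • w) γ ≤ w γ := fun γ hγ => by
    simp only [Pi.smul_apply, smul_eq_mul]
    exact mul_le_of_le_one_left (hw0 γ hγ).le hρ1
  have hw₂w₁ : ∀ γ ∈ Γ, 4 * w₂ γ ≤ ρ * w₁ γ := fun γ hγ => by
    have h : 0 ≤ ρ * w₁ γ := mul_nonneg hρ0.le (hw₁0 γ hγ).le
    have h2 : 4 * w₂ γ = l₂ * (ρ * w₁ γ) := by
      simp only [hw₂, Pi.smul_apply, smul_eq_mul]; ring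
    rw [h2]
    exact mul_le_of_le_one_left h hl₂'
  have hw₂₁ : ∀ γ ∈ Γ, w₂ γ ≤ w₁ γ := fun γ hγ => by
    have h1 := hw₂w₁ γ hγ
    have h2 := hw₂0 γ hγ
    have h3 := mul_le_of_le_one_left (hw₁0 γ hγ).le hρ1
    linarith only [h1, h2, h3]
  have hw₂w : ∀ γ ∈ Γ, ρ ^ 2 / 16 * w γ ≤ w₂ γ := fun γ hγ => by
    have h : 0 < w γ := hw0 γ hγ
    simp only [hw₂, hw₁, Pi.smul_apply, smul_eq_mul]
    calc ρ ^ 2 / 16 * w γ = 1 / 2 * (ρ / 4 * (1 / 2 * (ρ * w γ))) := by ring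
      _ ≤ _ := by gcongr
  set B := bohr Γ w with hB
  set B₁ := bohr Γ w₁ with hB₁
  set B₂ := bohr Γ w₂ with hB₂
  have hBpos : 0 < (B.card : ℝ) := bohr_card_pos fun γ hγ => (hw0 γ hγ).le
  have hB₁pos : 0 < (B₁.card : ℝ) := bohr_card_pos fun γ hγ => (hw₁0 γ hγ).le
  have hB₂pos : 0 < (B₂.card : ℝ) := bohr_card_pos fun γ hγ => (hw₂0 γ hγ).le
  have hBB₂ : (B.card : ℝ) ≤ (5 * (256 * J ^ 3 : ℕ)) ^ (2 * D) * B₂.card := by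
    refine (card_bohr_le Γ (w := w) (w' := w₂) hM hw0 fun γ hγ => ?_).trans ?_
    · refine le_trans ?_ (hw₂w γ hγ)
      have h : 0 < w γ := hw0 γ hγ
      rw [div_le_iff₀ (by linarith only [hM'])]
      have e : ρ ^ 2 / 16 * w γ * (256 * J ^ 3 : ℕ) = 4 * J * w γ := by
        rw [hρ]; push_cast; field_simp; norm_num
      rw [e]
      nlinarith only [hJ7', h]
    · gcongr
      · linarith only [hM']
      · omega
  have hBB₁ : (B.card : ℝ) ≤ (5 * (256 * J ^ 3 : ℕ)) ^ (2 * D) * B₁.card := by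
    refine hBB₂.trans ?_
    gcongr
    exact bohr_mono hw₂₁
  have hinv₁ : ∀ s ∈ B₁, ShiftInv (2 * ε) B s := fun s hs =>
    hA.regular.shiftInv hρ0.le (fun γ hγ => (hw0 γ hγ).le) (bohr_mono hw₁ρ hs)
  have hinv₂ : ∀ s ∈ B₂, ShiftInv (2 * ε) B s := fun s hs => hinv₁ s (bohr_mono hw₂₁ hs)
  obtain ⟨x, hx⟩ := exists_common_centre hBpos hB₁pos hB₂pos hA.dense hinv₁ hinv₂
  set A' := pullback (fun y => x + y) A with hA'
  have hcount' : apCount A' = apCount A := apCount_translate x A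
  simp_rw [← chi_pullback (fun y => x + y) A, ← hA'] at hx
  set A₁ := B₁.filter (· ∈ A') with hA₁
  set A₂ := B₂.filter (· ∈ A') with hA₂
  rw [← card_filter_eq_sum_chi, ← card_filter_eq_sum_chi, ← hA₁, ← hA₂] at hx
  set a₁ : ℝ := (A₁.card : ℝ) / B₁.card with ha₁
  set a₂ : ℝ := (A₂.card : ℝ) / B₂.card with ha₂
  have ha₁' : a₁ * B₁.card = A₁.card := by rw [ha₁]; field_simp
  have ha₂' : a₂ * B₂.card = A₂.card := by rw [ha₂]; field_simp
  -- The two densities sum to at least 2(α − 2ε). One reaching 201/200·α is already an increment;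
  -- otherwise neither can fall below 197/200·α.
  by_cases h₁ : 201 / 200 * α ≤ a₁
  · right
    refine ⟨Γ, w₁, A', ⟨hw₁0, fun γ hγ =>
      (hw₁ρ γ hγ).trans ((hρw γ hγ).trans (hA.le_two γ hγ)), hreg₁, ?_⟩, hcount', by omega, hBB₁⟩
    rw [← card_filter_eq_sum_chi, ← hB₁, ← hA₁, ← ha₁']
    gcongr
  by_cases h₂ : 201 / 200 * α ≤ a₂
  · right
    refine ⟨Γ, w₂, A', ⟨hw₂0, fun γ hγ => (hw₂₁ γ hγ).trans
      ((hw₁ρ γ hγ).trans ((hρw γ hγ).trans (hA.le_two γ hγ))), hreg₂, ?_⟩, hcount', by omega, hBB₂⟩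
    rw [← card_filter_eq_sum_chi, ← hB₂, ← hA₂, ← ha₂']
    gcongr
  rw [not_le] at h₁ h₂
  have hδα : 2 * ε ≤ α / 1000 := by nlinarith only [hεα, hα, hα1]
  have ha₁l : 197 / 200 * α ≤ a₁ := by linarith only [hx, h₂, hδα, hα]
  have ha₂l : 197 / 200 * α ≤ a₂ := by linarith only [hx, h₁, hδα, hα]
  have hA₁s : A₁ ⊆ A' := fun y hy => (Finset.mem_filter.1 hy).2
  have hA₂s : A₂ ⊆ A' := fun y hy => (Finset.mem_filter.1 hy).2
  by_cases hcount : ∑ m ∈ A₂, ∑ u, chi A₁ u * chi A₁ (m + m - u)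
      ≤ a₁ ^ 2 / 4 * A₂.card * B₁.card
  · right
    rw [← hcount']
    exact increment_of_few_aps hodd hα hα1 hε hεα hm hmε hJ hΓ hw0 hA.le_two hw₂w
      (fun γ hγ => (hw₁ρ γ hγ).trans (hρw γ hγ)) hw₁0 hw₂0 hw₂w₁ hreg₁ hreg₂ hA₁s hA₂s
      (Finset.filter_subset _ _) (Finset.filter_subset _ _) ha₁' ha₂' ha₁l ha₂l h₂.le hcount
  · left
    rw [not_le, ← ha₂'] at hcount
    have h3 := hcount.le.trans (sum_le_apCount hA₁s hA₂s)
    rw [hcount'] at h3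
    have h4 : α ^ 3 / 16 ≤ a₁ ^ 2 / 4 * a₂ := by
      calc α ^ 3 / 16 ≤ (197 / 200 * α) ^ 2 / 4 * (197 / 200 * α) := by
            nlinarith only [pow_pos hα 3]
        _ ≤ _ := by gcongr
    obtain ⟨P, hP⟩ : ∃ P : ℝ, P = (5 * (256 * J ^ 3 : ℕ)) ^ (2 * D) := ⟨_, rfl⟩
    have hP0 : 0 < P := by rw [hP]; positivity
    have hPP : (5 * (256 * J ^ 3 : ℕ) : ℝ) ^ (4 * D) = P * P := by
      rw [hP, ← pow_add]; congr 1; ring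
    rw [hPP]
    rw [← hP] at hBB₁ hBB₂
    calc α ^ 3 / 16 * (B.card : ℝ) ^ 2 = α ^ 3 / 16 * (B.card * B.card) := by ring
      _ ≤ a₁ ^ 2 / 4 * a₂ * ((P * B₂.card) * (P * B₁.card)) :=
          mul_le_mul h4 (mul_le_mul hBB₂ hBB₁ hBpos.le (by positivity)) (by positivity)
            (le_trans (by positivity) h4)
      _ = P * P * (a₁ ^ 2 / 4 * (a₂ * B₂.card) * B₁.card) := by ring
      _ ≤ P * P * apCount A := mul_le_mul_of_nonneg_left h3 (by positivity)

/-- Iterating the density increment. -/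
lemma many_aps_of_denseOn (hodd : Function.Injective fun x : G => x + x)
    {α₀ ε : ℝ} {m D J : ℕ} (hα₀ : 0 < α₀) (hε : 0 < ε) (hεα : ε ≤ α₀ ^ 2 / 2000)
    (hm : 32 ≤ m * α₀ ^ 2) (hmε : 4 * ε * m ≤ 1 / 5) (hJ : J = 7 * (D + 1) * ⌈1 / ε⌉₊)
    (n : ℕ) : ∀ {α : ℝ}, α₀ ≤ α → 1 < (201 / 200) ^ n * α →
    ∀ {Γ : Finset (AddChar G ℂ)}, Γ.card + n * m ≤ D → ∀ {w : AddChar G ℂ → ℝ} {A : Finset G},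
    DenseOn ε (1 / (2 * J)) α A Γ w →
    α₀ ^ 3 / 16 * ((bohr Γ w).card : ℝ) ^ 2
        ≤ (5 * (256 * J ^ 3 : ℕ)) ^ (4 * D * n) * apCount A := by
  have hle1 : ∀ {α : ℝ} {Γ : Finset (AddChar G ℂ)} {w : AddChar G ℂ → ℝ} {A : Finset G},
      DenseOn ε (1 / (2 * J)) α A Γ w → α ≤ 1 := by
    intro α Γ w A hA
    have h1 : 0 < ((bohr Γ w).card : ℝ) := bohr_card_pos fun γ hγ => (hA.pos γ hγ).le
    have h2 : ∑ b ∈ bohr Γ w, chi A b ≤ (bohr Γ w).card := by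
      have := Finset.sum_le_card_nsmul (bohr Γ w) (chi A) 1 fun b _ => chi_le_one A b
      simpa using this
    have h3 := hA.dense.trans h2
    by_contra! h
    nlinarith
  induction n with
  -- With no steps left the density would exceed 1, which is impossible.
  | zero =>
    intro α _ hn Γ _ w A hA
    have := hle1 hA
    simp at hn
    linarith
  | succ n ih =>
    intro α hα hn Γ hΓ w A hA
    have hn0 : (0 : ℝ) < ⌈1 / ε⌉₊ := lt_of_lt_of_le (by positivity) (Nat.le_ceil (1 / ε))
    have hn1 : 1 ≤ ⌈1 / ε⌉₊ := by exact_mod_cast hn0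
    have hJ7 : 7 ≤ J := by rw [hJ]; nlinarith
    have hM : 1 ≤ 256 * J ^ 3 := Nat.mul_pos (by norm_num) (pow_pos (by omega) 3)
    have hM' : (1 : ℝ) ≤ (256 * J ^ 3 : ℕ) := by exact_mod_cast hM
    set Q : ℝ := 5 * (256 * J ^ 3 : ℕ) with hQ
    have hQ1 : 1 ≤ Q := by rw [hQ]; linarith
    have hsq : α₀ ^ 2 ≤ α ^ 2 := by gcongr
    have hap : 0 ≤ apCount A := Finset.sum_nonneg fun x _ => Finset.sum_nonneg fun y _ =>
      mul_nonneg (mul_nonneg (chi_nonneg _ _) (chi_nonneg _ _)) (chi_nonneg _ _)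
    have hstep := many_aps_or_increment hodd (hα₀.trans_le hα) (hle1 hA) hε
      (hεα.trans (by linarith)) (hm.trans (by gcongr)) hmε hJ
      (show Γ.card + m ≤ D by nlinarith) hA
    rw [← hQ] at hstep
    rcases hstep with h | ⟨Γ', w', A', hA', hcount, hcard, hsize⟩
    · calc α₀ ^ 3 / 16 * ((bohr Γ w).card : ℝ) ^ 2
          ≤ α ^ 3 / 16 * ((bohr Γ w).card : ℝ) ^ 2 := by gcongr
        _ ≤ _ := h
        _ ≤ _ := by
          refine mul_le_mul_of_nonneg_right (pow_le_pow_right₀ hQ1 ?_) hap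
          exact Nat.le_mul_of_pos_right _ (Nat.succ_pos n)
    · have h1 := ih (α := 201 / 200 * α) (by linarith) (by rw [pow_succ] at hn; linarith)
        (Γ := Γ') (by nlinarith) hA'
      rw [hcount] at h1
      calc α₀ ^ 3 / 16 * ((bohr Γ w).card : ℝ) ^ 2
          ≤ α₀ ^ 3 / 16 * (Q ^ (2 * D) * (bohr Γ' w').card) ^ 2 := by gcongr
        _ = Q ^ (2 * D) * Q ^ (2 * D) * (α₀ ^ 3 / 16 * ((bohr Γ' w').card : ℝ) ^ 2) := by ring
        _ ≤ Q ^ (2 * D) * Q ^ (2 * D) * (Q ^ (4 * D * n) * apCount A) := by gcongr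
        _ = _ := by rw [← mul_assoc, ← pow_add, ← pow_add]; congr 2; ring

end IncrementStep

/-! ### Randomised rounding to lattice vectors along a chain of subspaces. -/

section LatticeRounding

/-- The tent function on the real line. -/
noncomputable def tent (s : ℝ) : ℝ := max 0 (1 - |s|)

lemma tent_nonneg (s : ℝ) : 0 ≤ tent s := le_max_left _ _

lemma tent_eq_zero {s : ℝ} (h : 1 ≤ |s|) : tent s = 0 := max_eq_left (by linarith)

lemma abs_lt_one_of_tent_ne_zero {s : ℝ} (h : tent s ≠ 0) : |s| < 1 := by
  by_contra! h'
  exact h (tent_eq_zero h')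

lemma tent_floor_add (s : ℝ) : tent (s - ⌊s⌋) + tent (s - (⌊s⌋ + 1 : ℤ)) = 1 := by
  have h1 := Int.floor_le s
  have h2 := Int.lt_floor_add_one s
  unfold tent
  push_cast
  rw [abs_of_nonneg (by linarith), abs_of_nonpos (by linarith), max_eq_right (by linarith),
    max_eq_right (by linarith)]
  ring

/-- Tents centred on ℤ sum to 1; squeezing the centres to (1−η)ℤ raises the sum to at most 1 + 2η.
The bound η ≤ 1/3 ensures that only the centre nearest to s and its two neighbours contribute. -/
lemma sum_tent_le {η : ℝ} (h0 : 0 ≤ η) (h1 : η ≤ 1 / 3) (s : ℝ) (F : Finset ℤ) :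
    ∑ m ∈ F, tent (s - (1 - η) * m) ≤ 1 + 2 * η := by
  set k : ℤ := round (s / (1 - η)) with hk
  set r : ℝ := s - (1 - η) * k with hr
  have hη : 0 < 1 - η := by linarith
  have hr2 : |r| ≤ (1 - η) / 2 := by
    have h := abs_sub_round (s / (1 - η))
    have e : r = (1 - η) * (s / (1 - η) - k) := by rw [hr]; field_simp
    rw [e, abs_mul, abs_of_pos hη]
    calc (1 - η) * |s / (1 - η) - k| ≤ (1 - η) * (1 / 2) := by gcongr
      _ = _ := by ring
  have hsub : ∑ m ∈ F, tent (s - (1 - η) * m)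
      ≤ ∑ m ∈ ({k - 1, k, k + 1} : Finset ℤ), tent (s - (1 - η) * m) := by
    have e : ∑ m ∈ F, tent (s - (1 - η) * m)
        = ∑ m ∈ F.filter (· ∈ ({k - 1, k, k + 1} : Finset ℤ)), tent (s - (1 - η) * m) := by
      rw [Finset.sum_filter]
      refine Finset.sum_congr rfl fun m _ => ?_
      split_ifs with h
      · rfl
      · simp only [Finset.mem_insert, Finset.mem_singleton, not_or] at h
        refine tent_eq_zero ?_
        have e2 : s - (1 - η) * m = r - (1 - η) * ((m - k : ℤ) : ℝ) := by
          rw [hr]; push_cast; ring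
        have h2 : (2 : ℝ) ≤ |((m - k : ℤ) : ℝ)| := by
          have : 2 ≤ |m - k| := by
            rw [le_abs]; omega
          exact_mod_cast this
        rw [e2]
        have h3 := abs_sub_abs_le_abs_sub ((1 - η) * ((m - k : ℤ) : ℝ)) r
        rw [abs_sub_comm _ r, abs_mul, abs_of_pos hη] at h3
        nlinarith
    rw [e]
    exact Finset.sum_le_sum_of_subset_of_nonneg
      (fun m hm => (Finset.mem_filter.1 hm).2) fun _ _ _ => tent_nonneg _
  refine hsub.trans ?_
  rw [Finset.sum_insert (by simp; omega), Finset.sum_insert (by simp), Finset.sum_singleton]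
  have e1 : s - (1 - η) * (k - 1 : ℤ) = r + (1 - η) := by rw [hr]; push_cast; ring
  have e2 : s - (1 - η) * (k + 1 : ℤ) = r - (1 - η) := by rw [hr]; push_cast; ring
  rw [e1, e2, ← hr]
  rw [abs_le] at hr2
  unfold tent
  rw [abs_of_nonneg (show 0 ≤ r + (1 - η) by linarith), abs_of_nonpos (show r - (1 - η) ≤ 0 by linarith)]
  rcases le_total 0 r with h | h
  · rw [abs_of_nonneg h]
    rcases max_choice 0 (1 - (r + (1 - η))) with h3 | h3 <;>
    rcases max_choice 0 (1 - r) with h4 | h4 <;>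
    rcases max_choice 0 (1 - -(r - (1 - η))) with h5 | h5 <;> rw [h3, h4, h5] <;> linarith
  · rw [abs_of_nonpos h]
    rcases max_choice 0 (1 - (r + (1 - η))) with h3 | h3 <;>
    rcases max_choice 0 (1 - -r) with h4 | h4 <;>
    rcases max_choice 0 (1 - -(r - (1 - η))) with h5 | h5 <;> rw [h3, h4, h5] <;> linarith

variable {ι L : Type*} [AddCommGroup L]

/-- The box of side lengths proportional to `w`. -/
def BoxLe (w : ι → ℝ) (r : ℝ) (z : ι → ℝ) : Prop := ∀ i, |z i| ≤ r * w i

lemma BoxLe.add {w : ι → ℝ} {r r' : ℝ} {z z' : ι → ℝ} (h : BoxLe w r z) (h' : BoxLe w r' z') :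
    BoxLe w (r + r') (z + z') := fun i => by
  have := abs_add_le (z i) (z' i)
  have := h i
  have := h' i
  simp only [Pi.add_apply]
  linarith

lemma BoxLe.smul {w : ι → ℝ} {r : ℝ} {z : ι → ℝ} (h : BoxLe w r z) (c : ℝ) :
    BoxLe w (|c| * r) (c • z) := fun i => by
  simp only [Pi.smul_apply, smul_eq_mul, abs_mul]
  rw [mul_assoc]
  exact mul_le_mul_of_nonneg_left (h i) (abs_nonneg c)

lemma BoxLe.mono {w w' : ι → ℝ} {r r' : ℝ} {z : ι → ℝ} (h : BoxLe w r z) (hw : ∀ i, w i ≤ w' i)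
    (hw0 : ∀ i, 0 ≤ w i) (hr : r ≤ r') (hr0 : 0 ≤ r') : BoxLe w' r' z := fun i =>
  (h i).trans ((mul_le_mul_of_nonneg_right hr (hw0 i)).trans
    (mul_le_mul_of_nonneg_left (hw i) hr0))

/-- Subspaces obtained by successively adjoining lattice vectors which are close to the subspace
constructed so far. -/
inductive ChainSpace (θ : L →+ (ι → ℝ)) (w : ι → ℝ) (ε : ℝ) : Submodule ℝ (ι → ℝ) → Prop
  | bot : ChainSpace θ w ε ⊥
  | step {W : Submodule ℝ (ι → ℝ)} (x : L) (p : ι → ℝ) (hW : ChainSpace θ w ε W)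
      (hx : θ x ∉ W) (hp : p ∈ W) (hxp : BoxLe w ε (θ x - p)) :
      ChainSpace θ w ε (W ⊔ Submodule.span ℝ {θ x})

/-- Subspaces which contain every lattice vector close to them. -/
def ClosedSpace (θ : L →+ (ι → ℝ)) (w : ι → ℝ) (ε : ℝ) (W : Submodule ℝ (ι → ℝ)) : Prop :=
  ∀ x, ∀ p ∈ W, BoxLe w ε (θ x - p) → θ x ∈ W

/-- Each adjoined lattice vector is close to the space built so far, hence to V, and V absorbs it.
Since the widths may increase from w to w', the subspaces of successively narrower slices are
nested. -/
lemma ChainSpace.le_closedSpace {θ : L →+ (ι → ℝ)} {w w' : ι → ℝ} {ε : ℝ} (hε : 0 ≤ ε)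
    (hw0 : ∀ i, 0 ≤ w i) (hw : ∀ i, w i ≤ w' i) {W V : Submodule ℝ (ι → ℝ)}
    (hW : ChainSpace θ w ε W) (hV : ClosedSpace θ w' ε V) : W ≤ V := by
  induction hW with
  | bot => exact bot_le
  | step x p _ _ hp hxp ih =>
    refine sup_le ih ?_
    rw [Submodule.span_le, Set.singleton_subset_iff]
    exact hV x p (ih hp) (hxp.mono hw hw0 le_rfl hε)

lemma finrank_sup_span_singleton [Finite ι] {W : Submodule ℝ (ι → ℝ)} {v : ι → ℝ} (hv : v ∉ W) :
    Module.finrank ℝ ↥(W ⊔ Submodule.span ℝ {v}) = Module.finrank ℝ W + 1 := by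
  have hv0 : v ≠ 0 := fun h => hv (h ▸ W.zero_mem)
  have h1 := Submodule.finrank_sup_add_finrank_inf_eq W (Submodule.span ℝ {v})
  have h2 : W ⊓ Submodule.span ℝ {v} = ⊥ := by
    rw [← disjoint_iff, Submodule.disjoint_span_singleton' hv0]
    exact hv
  rw [h2, finrank_bot, finrank_span_singleton hv0] at h1
  omega

/-- A chain space of maximal dimension is closed, for a lattice vector violating closedness would
extend the chain. -/
lemma exists_chainSpace_closedSpace [Fintype ι] (θ : L →+ (ι → ℝ)) (w : ι → ℝ) (ε : ℝ) :
    ∃ W, ChainSpace θ w ε W ∧ ClosedSpace θ w ε W := by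
  classical
  let P : ℕ → Prop := fun n => ∃ W, ChainSpace θ w ε W ∧ Module.finrank ℝ W = n
  have hP0 : P 0 := ⟨⊥, ChainSpace.bot, finrank_bot ℝ _⟩
  have hb : ∀ n, P n → n ≤ Fintype.card ι := by
    rintro n ⟨W, -, rfl⟩
    have := Submodule.finrank_le W
    rwa [Module.finrank_fintype_fun_eq_card] at this
  obtain ⟨W, hW, hr⟩ := Nat.findGreatest_spec (P := P) (Nat.zero_le (Fintype.card ι)) hP0
  refine ⟨W, hW, fun x p hp hxp => ?_⟩
  by_contra hx
  have h1 : P (Module.finrank ℝ W + 1) :=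
    ⟨_, ChainSpace.step x p hW hx hp hxp, finrank_sup_span_singleton hx⟩
  have h2 := Nat.le_findGreatest (hb _ h1) h1
  omega

/-- Randomised rounding of vectors in a chain space to lattice vectors: `φ (z - θ τ)` is the
probability that `z` is rounded to `τ`. -/
lemma ChainSpace.exists_rounding [Fintype ι] {θ : L →+ (ι → ℝ)} {w : ι → ℝ} {ε : ℝ}
    (hε : 0 ≤ ε) (hw : ∀ i, 0 ≤ w i) {η : ℝ} (hη0 : 0 ≤ η) (hη : η ≤ 1 / 3)
    {W : Submodule ℝ (ι → ℝ)} (hW : ChainSpace θ w ε W) :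
    ∃ (φ : (ι → ℝ) → ℝ) (Λ : Set L), (∀ z, 0 ≤ φ z) ∧ (∀ τ ∈ Λ, θ τ ∈ W) ∧
      (∀ z, φ z ≠ 0 → BoxLe w (Module.finrank ℝ W * ε) z) ∧
      (∀ z ∈ W, ∃ T : Finset L, ↑T ⊆ Λ ∧ ∑ τ ∈ T, φ (z - θ τ) = 1) ∧
      (∀ z ∈ W, ∀ T : Finset L, ↑T ⊆ Λ →
        ∑ τ ∈ T, φ (z - (1 - η) • θ τ) ≤ (1 + 2 * η) ^ Module.finrank ℝ W) := by
  classical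
  induction hW with
  | bot =>
    refine ⟨fun z => if z = 0 then 1 else 0, {0}, ?_, ?_, ?_, ?_, ?_⟩
    · intro z; dsimp only; split_ifs <;> norm_num
    · rintro τ rfl; simp
    · intro z hz
      have : z = 0 := by by_contra h; exact hz (if_neg h)
      intro i; simp [this]
    · intro z hz
      refine ⟨{0}, by simp, ?_⟩
      rw [Submodule.mem_bot] at hz
      rw [Finset.sum_singleton]
      simp [hz]
    · intro z hz T hT
      rw [Submodule.mem_bot] at hz
      have hT' : T ⊆ {0} := fun τ hτ => by simpa using hT hτ
      refine (Finset.sum_le_sum_of_subset_of_nonneg hT' fun τ _ _ => ?_).trans ?_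
      · dsimp only
        split_ifs <;> norm_num
      · rw [Finset.sum_singleton]
        simp [hz]
  | @step W x p hchain hx hp hxp ih =>
    obtain ⟨φ, Λ, hφ0, hΛ, hsupp, hone, hmass⟩ := ih
    obtain ⟨l, hlx, hlW⟩ : ∃ l : (ι → ℝ) →ₗ[ℝ] ℝ, l (θ x) = 1 ∧ ∀ v ∈ W, l v = 0 := by
      obtain ⟨f, hf1, hf2⟩ := Submodule.exists_le_ker_of_notMem hx
      refine ⟨(f (θ x))⁻¹ • f, by simp [hf1], fun v hv => ?_⟩
      have : f v = 0 := hf2 hv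
      simp [this]
    set e : ι → ℝ := θ x - p with he
    have hle : l e = 1 := by rw [he, map_sub, hlx, hlW p hp, sub_zero]
    have hrank := finrank_sup_span_singleton hx
    have hproj : ∀ z ∈ W ⊔ Submodule.span ℝ {θ x}, z - l z • e ∈ W := by
      intro z hz
      obtain ⟨y, hy, c, hc, rfl⟩ := Submodule.mem_sup.1 hz
      obtain ⟨r, rfl⟩ := Submodule.mem_span_singleton.1 hc
      have : y + r • θ x - l (y + r • θ x) • e = y + r • p := by
        rw [map_add, map_smul, hlx, hlW y hy, he]; simp; module
      rw [this]
      exact W.add_mem hy (W.smul_mem r hp)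
    -- The coefficient of θ x is rounded to an integer with tent weights; the remainder is corrected
    -- by a multiple of p and rounded inside W. Since e = θ x − p is small, each dimension adds at
    -- most ε to the rounding error.
    refine ⟨fun z => tent (l z) * φ (z - l z • e), {σ | ∃ τ ∈ Λ, ∃ m : ℤ, σ = τ + m • x},
      ?_, ?_, ?_, ?_, ?_⟩
    · exact fun z => mul_nonneg (tent_nonneg _) (hφ0 _)
    · rintro σ ⟨τ, hτ, m, rfl⟩
      rw [map_add, map_zsmul, ← Int.cast_smul_eq_zsmul ℝ]
      exact Submodule.add_mem_sup (hΛ τ hτ)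
        (Submodule.smul_mem _ _ (Submodule.mem_span_singleton_self _))
    · intro z hz
      have h1 := hsupp _ (right_ne_zero_of_mul hz)
      have h2 := (abs_lt_one_of_tent_ne_zero (left_ne_zero_of_mul hz)).le
      have h3 := h1.add (hxp.smul (l z))
      rw [sub_add_cancel] at h3
      rw [hrank]
      push_cast
      refine h3.mono (fun i => le_rfl) hw ?_ (by positivity)
      nlinarith
    · intro z hz
      have hzW := hproj z hz
      have hpart : ∀ m : ℤ, ∃ T : Finset L, ↑T ⊆ Λ ∧
          ∑ τ ∈ T, φ (z - θ (τ + m • x) - l (z - θ (τ + m • x)) • e) = 1 := by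
        intro m
        obtain ⟨T, hT, hsum⟩ := hone (z - l z • e - (m : ℝ) • p)
          (W.sub_mem hzW (W.smul_mem _ hp))
        refine ⟨T, hT, ?_⟩
        rw [← hsum]
        refine Finset.sum_congr rfl fun τ hτ => ?_
        congr 1
        rw [map_add, map_zsmul, ← Int.cast_smul_eq_zsmul ℝ, map_sub, map_add, map_smul, hlx,
          hlW _ (hΛ τ (hT hτ)), he]
        simp only [smul_eq_mul, mul_one, zero_add]
        module
      have hval : ∀ m : ℤ, ∀ τ ∈ Λ, l (z - θ (τ + m • x)) = l z - m := by
        intro m τ hτ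
        rw [map_add, map_zsmul, ← Int.cast_smul_eq_zsmul ℝ, map_sub, map_add, map_smul, hlx,
          hlW _ (hΛ τ hτ)]
        simp
      choose T hT hTsum using hpart
      set k := ⌊l z⌋ with hk
      have hinj : ∀ m : ℤ, Function.Injective fun τ : L => τ + m • x := fun m =>
        add_left_injective _
      have hblock : ∀ m : ℤ, ∑ σ ∈ (T m).image fun τ => τ + m • x,
          tent (l (z - θ σ)) * φ (z - θ σ - l (z - θ σ) • e) = tent (l z - m) := by
        intro m
        rw [Finset.sum_image fun _ _ _ _ h => hinj m h]
        calc _ = ∑ τ ∈ T m, tent (l z - m) * φ (z - θ (τ + m • x) - l (z - θ (τ + m • x)) • e) :=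
              Finset.sum_congr rfl fun τ hτ => by
                conv_lhs => rw [hval m τ (hT m hτ)]
                rw [hval m τ (hT m hτ)]
          _ = _ := by rw [← Finset.mul_sum, hTsum, mul_one]
      -- Only the integers ⌊l z⌋ and ⌊l z⌋ + 1 are needed, as their two tent weights already sum to
      -- 1.
      refine ⟨((T k).image fun τ => τ + k • x) ∪ ((T (k + 1)).image fun τ => τ + (k + 1) • x),
        ?_, ?_⟩
      · intro σ hσ
        rw [Finset.mem_coe, Finset.mem_union, Finset.mem_image, Finset.mem_image] at hσ
        rcases hσ with ⟨τ, hτ, rfl⟩ | ⟨τ, hτ, rfl⟩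
        · exact ⟨τ, hT _ hτ, _, rfl⟩
        · exact ⟨τ, hT _ hτ, _, rfl⟩
      · rw [Finset.sum_union, hblock, hblock, tent_floor_add]
        rw [Finset.disjoint_left]
        intro σ hσ hσ'
        rw [Finset.mem_image] at hσ hσ'
        obtain ⟨τ, hτ, rfl⟩ := hσ
        obtain ⟨τ', hτ', h⟩ := hσ'
        have h1 := hval k τ (hT _ hτ)
        have h2 := hval (k + 1) τ' (hT _ hτ')
        rw [h, h1] at h2
        push_cast at h2
        linarith
    · intro z hz S hS
      have hzW := hproj z hz
      have hS' : ∀ σ ∈ S, ∃ τ ∈ Λ, ∃ m : ℤ, σ = τ + m • x := fun σ hσ => hS hσ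
      choose! τ hτ m hm using hS'
      have hval : ∀ σ ∈ S, l (z - (1 - η) • θ σ) = l z - (1 - η) * m σ := by
        intro σ hσ
        conv_lhs => rw [hm σ hσ]
        rw [map_add, map_zsmul, ← Int.cast_smul_eq_zsmul ℝ, map_sub, map_smul, map_add, map_smul,
          hlx, hlW _ (hΛ _ (hτ σ hσ))]
        simp
      rw [hrank, pow_succ]
      have hfib := Finset.sum_fiberwise_of_maps_to (s := S) (t := S.image m) (g := m)
        (fun σ hσ => Finset.mem_image_of_mem m hσ)
        (fun σ => tent (l (z - (1 - η) • θ σ))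
          * φ (z - (1 - η) • θ σ - l (z - (1 - η) • θ σ) • e))
      dsimp only
      rw [← hfib]
      have hinner : ∀ k ∈ S.image m, ∑ σ ∈ S.filter (fun σ => m σ = k),
          tent (l (z - (1 - η) • θ σ)) * φ (z - (1 - η) • θ σ - l (z - (1 - η) • θ σ) • e)
          ≤ tent (l z - (1 - η) * k) * (1 + 2 * η) ^ Module.finrank ℝ W := by
        intro k _
        have hmem : ∀ σ ∈ S.filter (fun σ => m σ = k), σ ∈ S ∧ m σ = k := fun σ hσ =>
          Finset.mem_filter.1 hσ
        have hinj : Set.InjOn τ (S.filter (fun σ => m σ = k) : Set L) := by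
          intro σ hσ σ' hσ' h
          obtain ⟨h1, h2⟩ := hmem σ hσ
          obtain ⟨h3, h4⟩ := hmem σ' hσ'
          rw [hm σ h1, hm σ' h3, h, h2, h4]
        have h5 := hmass (z - l z • e - ((1 - η) * k) • p)
          (W.sub_mem hzW (W.smul_mem _ hp)) ((S.filter (fun σ => m σ = k)).image τ) (by
            intro t ht
            rw [Finset.mem_coe, Finset.mem_image] at ht
            obtain ⟨σ, hσ, rfl⟩ := ht
            exact hτ σ (hmem σ hσ).1)
        rw [Finset.sum_image hinj] at h5
        calc _ = ∑ σ ∈ S.filter (fun σ => m σ = k), tent (l z - (1 - η) * k)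
              * φ (z - l z • e - ((1 - η) * k) • p - (1 - η) • θ (τ σ)) := by
              refine Finset.sum_congr rfl fun σ hσ => ?_
              obtain ⟨h1, h2⟩ := hmem σ hσ
              rw [hval σ h1, h2]
              congr 2
              conv_lhs => rw [hm σ h1]
              rw [map_add, map_zsmul, ← Int.cast_smul_eq_zsmul ℝ, h2, he]
              module
          _ ≤ _ := by
              rw [← Finset.mul_sum]
              exact mul_le_mul_of_nonneg_left h5 (tent_nonneg _)
      -- Fibring over the coefficient m of x leaves a one-dimensional tent sum, which contributes
      -- the additional factor 1 + 2η.
      refine (Finset.sum_le_sum hinner).trans ?_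
      rw [← Finset.sum_mul, mul_comm]
      exact mul_le_mul_of_nonneg_left (sum_tent_le hη0 hη _ _) (by positivity)

/-- A set which can be contracted by rounding into another one is not much larger. -/
lemma ChainSpace.card_le [Fintype ι] {θ : L →+ (ι → ℝ)} {w : ι → ℝ} {ε : ℝ}
    (hε : 0 ≤ ε) (hw : ∀ i, 0 ≤ w i) {η : ℝ} (hη0 : 0 ≤ η) (hη : η ≤ 1 / 3)
    {W : Submodule ℝ (ι → ℝ)} (hW : ChainSpace θ w ε W) {K K' : Finset L} {g : ι → ℝ}
    (hK : ∀ y ∈ K, g - θ y ∈ W) (hK' : ∀ y ∈ K', g - θ y ∈ W)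
    (hmove : ∀ y ∈ K', ∀ τ, θ τ ∈ W →
      BoxLe w (Module.finrank ℝ W * ε) (η • (g - θ y) - θ τ) → y + τ ∈ K) :
    (K'.card : ℝ) ≤ (1 + 2 * η) ^ Module.finrank ℝ W * K.card := by
  classical
  obtain ⟨φ, Λ, hφ0, hΛ, hsupp, hone, hmass⟩ := hW.exists_rounding hε hw hη0 hη
  -- Double counting: each y in K' is moved a fraction η towards g and rounded, sending total mass
  -- at least 1 to points of K.
  have h1 : ∀ y ∈ K', (1 : ℝ) ≤ ∑ y' ∈ K,
      if y' - y ∈ Λ then φ (η • (g - θ y) - θ (y' - y)) else 0 := by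
    intro y hy
    obtain ⟨T, hT, hsum⟩ := hone (η • (g - θ y)) (W.smul_mem _ (hK' y hy))
    rw [← hsum, ← Finset.sum_filter]
    have h2 : ∑ τ ∈ T, φ (η • (g - θ y) - θ τ)
        = ∑ τ ∈ T.filter (fun τ => φ (η • (g - θ y) - θ τ) ≠ 0), φ (η • (g - θ y) - θ τ) :=
      (Finset.sum_filter_ne_zero T).symm
    rw [h2]
    calc _ = ∑ y' ∈ (T.filter (fun τ => φ (η • (g - θ y) - θ τ) ≠ 0)).image (fun τ => y + τ),
          φ (η • (g - θ y) - θ (y' - y)) := by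
          rw [Finset.sum_image fun _ _ _ _ h => add_right_injective y h]
          exact Finset.sum_congr rfl fun τ _ => by rw [add_sub_cancel_left]
      _ ≤ _ := by
          refine Finset.sum_le_sum_of_subset_of_nonneg ?_ fun _ _ _ => hφ0 _
          intro y' hy'
          rw [Finset.mem_image] at hy'
          obtain ⟨τ, hτ, rfl⟩ := hy'
          rw [Finset.mem_filter] at hτ
          rw [Finset.mem_filter, add_sub_cancel_left]
          exact ⟨hmove y hy τ (hΛ τ (hT hτ.1)) (hsupp _ hτ.2), hT hτ.1⟩
  have h2 : ∀ y' ∈ K, (∑ y ∈ K', if y' - y ∈ Λ then φ (η • (g - θ y) - θ (y' - y)) else 0)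
      ≤ (1 + 2 * η) ^ Module.finrank ℝ W := by
    intro y' hy'
    rw [← Finset.sum_filter]
    have hinj : Function.Injective fun y : L => y' - y := sub_right_injective
    -- With τ = y' − y one has η(g − θy) − θτ = η(g − θy') − (1−η)θτ, so the mass received by y' is
    -- a sum over the lattice contracted by 1 − η.
    have h3 := hmass (η • (g - θ y')) (W.smul_mem _ (hK y' hy'))
      ((K'.filter (fun y => y' - y ∈ Λ)).image fun y => y' - y) (by
        intro t ht
        rw [Finset.mem_coe, Finset.mem_image] at ht
        obtain ⟨y, hy, rfl⟩ := ht
        exact (Finset.mem_filter.1 hy).2)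
    rw [Finset.sum_image fun _ _ _ _ h => hinj h] at h3
    refine le_trans (le_of_eq (Finset.sum_congr rfl fun y _ => ?_)) h3
    congr 1
    rw [map_sub]
    module
  calc (K'.card : ℝ) = ∑ y ∈ K', (1 : ℝ) := by simp
    _ ≤ ∑ y ∈ K', ∑ y' ∈ K, if y' - y ∈ Λ then φ (η • (g - θ y) - θ (y' - y)) else 0 :=
        Finset.sum_le_sum h1
    _ = ∑ y' ∈ K, ∑ y ∈ K', if y' - y ∈ Λ then φ (η • (g - θ y) - θ (y' - y)) else 0 :=
        Finset.sum_comm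
    _ ≤ K.card • (1 + 2 * η) ^ Module.finrank ℝ W := Finset.sum_le_card_nsmul _ _ _ h2
    _ = _ := by rw [nsmul_eq_mul, mul_comm]

end LatticeRounding

/-! ### Counting the cosets of a closed subspace that meet a bounded set. -/

section LatticeSlices

/-- A finite set in a real vector space contains a basis of its span with respect to which all its
elements have coordinates of modulus at most `1`. -/
lemma exists_barycentric_spanner {V : Type*} [AddCommGroup V] [Module ℝ V] [FiniteDimensional ℝ V]
    (D : Finset V) :
    ∃ (r : ℕ) (b : Fin r → V), r = Module.finrank ℝ (Submodule.span ℝ (D : Set V)) ∧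
      (∀ i, b i ∈ D) ∧ ∀ z ∈ D, ∃ a : Fin r → ℝ, (∀ i, |a i| ≤ 1) ∧ z = ∑ i, a i • b i := by
  classical
  obtain ⟨r, hr⟩ : ∃ r, r = Module.finrank ℝ (Submodule.span ℝ (D : Set V)) := ⟨_, rfl⟩
  obtain ⟨f₀, hf₀D, hf₀⟩ : ∃ f : Fin r → V, (∀ i, f i ∈ D) ∧ LinearIndependent ℝ f := by
    obtain ⟨f, hfD, -, hf⟩ := Submodule.exists_fun_fin_finrank_span_eq ℝ (D : Set V)
    rw [hr]
    exact ⟨f, hfD, hf⟩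
  obtain ⟨p, hp⟩ := LinearMap.exists_leftInverse_of_injective
    (Fintype.linearCombination ℝ f₀) (by
      rw [LinearMap.ker_eq_bot]
      exact linearIndependent_iff_injective_fintypeLinearCombination.1 hf₀)
  -- A tuple from D maximising |F| works: by Cramer's rule, replacing b i by z multiplies F by the
  -- i-th coordinate of z, which therefore has modulus at most 1.
  set F := (Matrix.detRowAlternating (n := Fin r) (R := ℝ)).compLinearMap p with hF
  have hFf₀ : F f₀ = 1 := by
    have h : (fun i => p (f₀ i)) = (1 : Matrix (Fin r) (Fin r) ℝ) := by
      funext i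
      have := LinearMap.congr_fun hp (Pi.single i 1)
      simp only [LinearMap.comp_apply, Fintype.linearCombination_apply_single, one_smul,
        LinearMap.id_apply] at this
      rw [this]
      ext j
      rw [Matrix.one_apply, Pi.single_apply]
      simp only [eq_comm]
    rw [hF, AlternatingMap.compLinearMap_apply]
    change Matrix.det (fun i => p (f₀ i)) = 1
    rw [h, Matrix.det_one]
  obtain ⟨b, hb, hmax⟩ := Finset.exists_max_image (Fintype.piFinset fun _ : Fin r => D)
    (fun b => |F b|) ⟨f₀, Fintype.mem_piFinset.2 hf₀D⟩
  rw [Fintype.mem_piFinset] at hb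
  have hFb : 0 < |F b| := by
    have := hmax f₀ (Fintype.mem_piFinset.2 hf₀D)
    rw [hFf₀, abs_one] at this
    linarith
  have hli : LinearIndependent ℝ b := by
    by_contra h
    rw [AlternatingMap.map_linearDependent F b h] at hFb
    simp at hFb
  have hspan : Submodule.span ℝ (Set.range b) = Submodule.span ℝ (D : Set V) := by
    refine Submodule.eq_of_le_of_finrank_eq (Submodule.span_mono ?_) ?_
    · rintro _ ⟨i, rfl⟩; exact hb i
    · rw [finrank_span_eq_card hli, Fintype.card_fin, hr]
  refine ⟨r, b, hr, hb, fun z hz => ?_⟩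
  have hz' : z ∈ Submodule.span ℝ (Set.range b) := by
    rw [hspan]; exact Submodule.subset_span hz
  obtain ⟨a, rfl⟩ := (Submodule.mem_span_range_iff_exists_fun ℝ).1 hz'
  refine ⟨a, fun i => ?_, rfl⟩
  have h1 := hmax (Function.update b i (∑ j, a j • b j)) (by
    rw [Fintype.mem_piFinset]
    intro j
    by_cases h : j = i
    · subst h; rwa [Function.update_self]
    · rw [Function.update_of_ne h]; exact hb j)
  have h2 : F (Function.update b i (∑ j, a j • b j)) = a i * F b := by
    rw [AlternatingMap.map_update_sum, Finset.sum_eq_single i]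
    · rw [AlternatingMap.map_update_smul, Function.update_eq_self, smul_eq_mul]
    · intro j _ hj
      rw [AlternatingMap.map_update_smul, AlternatingMap.map_update_self _ _ hj.symm, smul_zero]
    · simp
  rw [h2, abs_mul] at h1
  exact le_of_mul_le_mul_right (by rwa [one_mul]) hFb

lemma finrank_map_mkQ_add {V : Type*} [AddCommGroup V] [Module ℝ V] [FiniteDimensional ℝ V]
    {W U : Submodule ℝ V} (h : W ≤ U) :
    Module.finrank ℝ (U.map W.mkQ) + Module.finrank ℝ W = Module.finrank ℝ U := by
  have h1 := LinearMap.finrank_range_add_finrank_ker (W.mkQ.domRestrict U)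
  rw [LinearMap.range_domRestrict, LinearMap.ker_domRestrict, Submodule.ker_mkQ] at h1
  rw [← h1]
  congr 1
  exact ((Submodule.comapSubtypeEquivOfLe h).finrank_eq).symm

variable {ι L : Type*} [Fintype ι] [AddCommGroup L]

lemma abs_sub_le_of_floor_eq {N : ℕ} (hN : 1 ≤ N) {a b : ℝ} (h : ⌊N * a⌋ = ⌊N * b⌋) :
    |a - b| ≤ 1 / N := by
  have hN' : (0 : ℝ) < N := by exact_mod_cast hN
  have := Int.abs_sub_lt_one_of_floor_eq_floor h
  rw [← mul_sub, abs_mul, abs_of_pos hN'] at this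
  rw [le_div_iff₀ hN', mul_comm]
  exact this.le

/-- A bounded set meets few cosets of a closed subspace. -/
lemma ClosedSpace.card_image_mkQ_le {θ : L →+ (ι → ℝ)} {w : ι → ℝ} {ε : ℝ}
    (hw : ∀ i, 0 ≤ w i) {W V : Submodule ℝ (ι → ℝ)} (hW : ClosedSpace θ w ε W) (hWV : W ≤ V)
    {K : Finset L} {x₀ : L} (hKw : ∀ x ∈ K, BoxLe w 1 (θ x - θ x₀))
    (hKV : ∀ x ∈ K, θ x - θ x₀ ∈ V) {N : ℕ} (hN : 1 ≤ N) (hNε : (Fintype.card ι : ℝ) ≤ N * ε)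
    [DecidableEq ((ι → ℝ) ⧸ W)] :
    (K.image fun x => W.mkQ (θ x)).card
      ≤ (2 * N + 1) ^ (Module.finrank ℝ V - Module.finrank ℝ W) := by
  classical
  have hN' : (0 : ℝ) < N := by exact_mod_cast hN
  set D := K.image fun x => W.mkQ (θ x - θ x₀) with hD
  obtain ⟨r, b, hr, hbD, hb⟩ := exists_barycentric_spanner D
  have hrV : r ≤ Module.finrank ℝ V - Module.finrank ℝ W := by
    have h1 : Submodule.span ℝ (D : Set ((ι → ℝ) ⧸ W)) ≤ V.map W.mkQ := by
      rw [Submodule.span_le]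
      intro q hq
      rw [Finset.mem_coe, hD, Finset.mem_image] at hq
      obtain ⟨x, hx, rfl⟩ := hq
      exact Submodule.mem_map_of_mem (hKV x hx)
    have h2 := Submodule.finrank_mono h1
    have h3 := finrank_map_mkQ_add hWV
    rw [hr]
    omega
  have hrι : r ≤ Fintype.card ι := by
    have := Submodule.finrank_le V
    rw [Module.finrank_fintype_fun_eq_card] at this
    omega
  have hy : ∀ i, ∃ y ∈ K, W.mkQ (θ y - θ x₀) = b i := fun i => Finset.mem_image.1 (hbD i)
  choose y hyK hyb using hy
  have ha : ∀ x ∈ K, ∃ a : Fin r → ℝ, (∀ i, |a i| ≤ 1) ∧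
      W.mkQ (θ x - θ x₀) = ∑ i, a i • b i := fun x hx => hb _ (Finset.mem_image_of_mem _ hx)
  choose! a ha1 ha2 using ha
  let cell : L → Fin r → ℤ := fun x i => ⌊N * a x i⌋
  -- If the spanner coordinates agree to within 1/N, then θ(x − x') is an element of W plus a vector
  -- in the ε-box, because r ≤ Nε. Closedness puts it in W, so a cell determines the coset.
  have hcell : ∀ x ∈ K, ∀ x' ∈ K, cell x = cell x' → W.mkQ (θ x) = W.mkQ (θ x') := by
    intro x hx x' hx' h
    have hd : ∀ i, |a x i - a x' i| ≤ 1 / N := fun i =>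
      abs_sub_le_of_floor_eq hN (congrFun h i)
    set q : ι → ℝ := ∑ i, (a x i - a x' i) • (θ (y i) - θ x₀) with hq
    have hpW : θ (x - x') - q ∈ W := by
      rw [← Submodule.ker_mkQ W, LinearMap.mem_ker, map_sub, hq, map_sum]
      have e1 : W.mkQ (θ (x - x')) = ∑ i, a x i • b i - ∑ i, a x' i • b i := by
        rw [← ha2 x hx, ← ha2 x' hx', ← map_sub, map_sub θ]; congr 1; abel
      rw [e1, ← Finset.sum_sub_distrib, sub_eq_zero]
      refine Finset.sum_congr rfl fun i _ => ?_
      rw [map_smul, hyb, sub_smul]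
    have hbox : BoxLe w ε (θ (x - x') - (θ (x - x') - q)) := by
      rw [sub_sub_cancel]
      intro j
      rw [hq, Finset.sum_apply]
      calc |∑ i, ((a x i - a x' i) • (θ (y i) - θ x₀)) j|
          ≤ ∑ i, |((a x i - a x' i) • (θ (y i) - θ x₀)) j| := Finset.abs_sum_le_sum_abs _ _
        _ ≤ ∑ _i : Fin r, 1 / N * w j := by
            refine Finset.sum_le_sum fun i _ => ?_
            rw [Pi.smul_apply, smul_eq_mul, abs_mul]
            have := hKw (y i) (hyK i) j
            rw [one_mul] at this
            exact mul_le_mul (hd i) this (abs_nonneg _) (by positivity)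
        _ = r / N * w j := by
            rw [Finset.sum_const, Finset.card_univ, Fintype.card_fin, nsmul_eq_mul]; ring
        _ ≤ ε * w j := by
            refine mul_le_mul_of_nonneg_right ?_ (hw j)
            rw [div_le_iff₀ hN', mul_comm]
            exact le_trans (by exact_mod_cast hrι) hNε
    have hmem := hW (x - x') _ hpW hbox
    rw [← sub_eq_zero, ← map_sub, ← map_sub, ← LinearMap.mem_ker, Submodule.ker_mkQ]
    exact hmem
  have hs : ∀ q ∈ K.image fun x => W.mkQ (θ x), ∃ x ∈ K, W.mkQ (θ x) = q := fun q hq =>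
    Finset.mem_image.1 hq
  choose! s hsK hsq using hs
  have hcard : (K.image fun x => W.mkQ (θ x)).card
      ≤ (Fintype.piFinset fun _ : Fin r => Finset.Icc (-(N : ℤ)) N).card := by
    refine Finset.card_le_card_of_injOn (fun q => cell (s q)) ?_ ?_
    · intro q hq
      rw [Finset.mem_coe, Fintype.mem_piFinset]
      intro i
      have h1 := abs_le.1 (ha1 _ (hsK q hq) i)
      rw [Finset.mem_Icc]
      constructor
      · rw [Int.le_floor]; push_cast; nlinarith
      · rw [← Int.cast_le (R := ℝ)]
        refine (Int.floor_le _).trans ?_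
        push_cast; nlinarith
    · intro q hq q' hq' h
      rw [← hsq q hq, ← hsq q' hq']
      exact hcell _ (hsK q hq) _ (hsK q' hq') h
  refine hcard.trans ?_
  rw [Fintype.card_piFinset]
  simp only [Int.card_Icc, Finset.prod_const, Finset.card_univ, Fintype.card_fin]
  have : ((N : ℤ) + 1 - -N).toNat = 2 * N + 1 := by omega
  rw [this]
  exact Nat.pow_le_pow_right (by omega) hrV

end LatticeSlices

/-! ### Slices of lattice boxes that are stable under small perturbations. -/

section RegularSlices

variable {ι L : Type*} [Fintype ι] [AddCommGroup L]

lemma one_add_half_inv_pow_le_two {n k : ℕ} (h : n ≤ k) :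
    (1 + 2 * (1 / (4 * ((k : ℝ) + 1)))) ^ n ≤ 2 := by
  have hk : (0 : ℝ) < (k : ℝ) + 1 := by positivity
  have hn : (n : ℝ) ≤ k := by exact_mod_cast h
  set x : ℝ := 2 * (1 / (4 * ((k : ℝ) + 1))) with hx
  have h1 : (n : ℝ) * x ≤ 1 / 2 := by
    rw [hx, show (n : ℝ) * (2 * (1 / (4 * ((k : ℝ) + 1)))) = n / (2 * (k + 1)) by field_simp; ring,
      div_le_iff₀ (by positivity)]
    linarith
  have h2 : (1 + x) ^ n ≤ Real.exp (1 / 2) := by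
    calc (1 + x) ^ n ≤ Real.exp x ^ n := by
          refine pow_le_pow_left₀ (by positivity) ?_ n
          rw [add_comm]; exact Real.add_one_le_exp x
      _ = Real.exp (n * x) := (Real.exp_nat_mul x n).symm
      _ ≤ _ := Real.exp_le_exp.2 h1
  have h3 : Real.exp (1 / 2) ^ 2 = Real.exp 1 := by
    rw [← Real.exp_nat_mul]; norm_num
  have h4 := Real.exp_one_lt_d9
  have h5 := Real.exp_pos (1 / 2)
  nlinarith

/-- The intersection of a lattice box with a closed chain space of its own width is stable under
perturbations which are small relative to its width. -/
lemma card_perturbation_le {θ : L →+ (ι → ℝ)} {u v : ι → ℝ} {B K : Finset L}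
    (hB : ∀ y, y ∈ B ↔ ∀ i, u i ≤ θ y i ∧ θ y i ≤ v i) {x₀ : L} {w : ι → ℝ}
    {W : Submodule ℝ (ι → ℝ)} (hx₀ : x₀ ∈ K)
    (hK : ∀ y, y ∈ K ↔ y ∈ B ∧ θ y - θ x₀ ∈ W) {p q : ι → L} (hp : ∀ i, p i ∈ K)
    (hq : ∀ i, q i ∈ K) (hw : ∀ i, w i = θ (p i) i - θ (q i) i)
    (hmax : ∀ i, ∀ y ∈ K, θ y i ≤ θ (p i) i) (hmin : ∀ i, ∀ y ∈ K, θ (q i) i ≤ θ y i) {ε : ℝ}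
    (hε0 : 0 ≤ ε) (hε : 8 * ((Fintype.card ι : ℝ) + 1) ^ 3 * ε ≤ 1)
    (hW : ChainSpace θ w ε W) (hW' : ClosedSpace θ w ε W) {K' : Finset L}
    (hK' : ∀ y ∈ K', ∃ x ∈ K, ∃ s, y = x + s ∧ BoxLe w ε (θ s)) :
    (K'.card : ℝ) ≤ 2 * K.card := by
  classical
  set k := Fintype.card ι with hk
  have hk1 : (0 : ℝ) < (k : ℝ) + 1 := by positivity
  have hk1' : (1 : ℝ) ≤ (k : ℝ) + 1 := by
    have : (0 : ℝ) ≤ k := by positivity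
    linarith
  have hw0 : ∀ i, 0 ≤ w i := fun i => by rw [hw]; linarith [hmax i _ (hq i)]
  set c : ℝ := 1 / (2 * ((k : ℝ) + 1)) with hc
  have hc0 : 0 < c := by positivity
  have hck : 2 * c * ((k : ℝ) + 1) = 1 := by rw [hc]; field_simp
  set η : ℝ := 1 / (4 * ((k : ℝ) + 1)) with hη
  have hη0 : 0 < η := by positivity
  have hηk : 4 * η * ((k : ℝ) + 1) = 1 := by rw [hη]; field_simp
  have hη3 : η ≤ 1 / 3 := by nlinarith
  have hεη : ((k : ℝ) + 1) * ε ≤ η * c := by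
    have : η * c = 1 / (8 * (k + 1) ^ 2) := by rw [hη, hc]; field_simp; ring
    rw [this, le_div_iff₀ (by positivity)]
    calc _ = 8 * ((k : ℝ) + 1) ^ 3 * ε := by ring
      _ ≤ 1 := hε
  -- A point of the affine slice at distance at least c·w j from both extreme values in every
  -- coordinate j, obtained by averaging x₀ with the extremal points p i and q i; c = 1/(2(k+1)) is
  -- the weight of each.
  set g : ι → ℝ := θ x₀ + c • ∑ i, ((θ (p i) - θ x₀) + (θ (q i) - θ x₀)) with hg
  have hgW : g - θ x₀ ∈ W := by
    rw [hg, add_sub_cancel_left]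
    exact W.smul_mem _ (W.sum_mem fun i _ =>
      W.add_mem ((hK _).1 (hp i)).2 ((hK _).1 (hq i)).2)
  have hgj : ∀ j, g j = θ x₀ j + c * ∑ i, ((θ (p i) j - θ x₀ j) + (θ (q i) j - θ x₀ j)) := by
    intro j
    rw [hg]
    simp only [Pi.add_apply, Pi.smul_apply, Finset.sum_apply, Pi.sub_apply, smul_eq_mul]
  have hgmax : ∀ j, g j ≤ θ (p j) j - c * w j := by
    intro j
    have h1 : ∑ i, ((θ (p i) j - θ x₀ j) + (θ (q i) j - θ x₀ j))
        ≤ ∑ i, (2 * (θ (p j) j - θ x₀ j) - if i = j then w j else 0) := by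
      refine Finset.sum_le_sum fun i _ => ?_
      split_ifs with h
      · subst h; rw [hw]; linarith
      · linarith [hmax j _ (hp i), hmax j _ (hq i)]
    rw [Finset.sum_sub_distrib, Finset.sum_ite_eq' , if_pos (Finset.mem_univ j), Finset.sum_const,
      Finset.card_univ, nsmul_eq_mul, ← hk] at h1
    rw [hgj]
    have h2 := mul_le_mul_of_nonneg_left h1 hc0.le
    have h3 := hmax j _ hx₀
    have h4 : c * (k * (2 * (θ (p j) j - θ x₀ j)) - w j)
        = (2 * c * (k + 1)) * (θ (p j) j - θ x₀ j) - 2 * c * (θ (p j) j - θ x₀ j) - c * w j := by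
      ring
    rw [hck] at h4
    nlinarith
  have hgmin : ∀ j, θ (q j) j + c * w j ≤ g j := by
    intro j
    have h1 : ∑ i, (2 * (θ (q j) j - θ x₀ j) + if i = j then w j else 0)
        ≤ ∑ i, ((θ (p i) j - θ x₀ j) + (θ (q i) j - θ x₀ j)) := by
      refine Finset.sum_le_sum fun i _ => ?_
      split_ifs with h
      · subst h; rw [hw]; linarith
      · linarith [hmin j _ (hp i), hmin j _ (hq i)]
    rw [Finset.sum_add_distrib, Finset.sum_ite_eq' , if_pos (Finset.mem_univ j), Finset.sum_const,
      Finset.card_univ, nsmul_eq_mul, ← hk] at h1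
    rw [hgj]
    have h2 := mul_le_mul_of_nonneg_left h1 hc0.le
    have h3 := hmin j _ hx₀
    have h4 : c * (k * (2 * (θ (q j) j - θ x₀ j)) + w j)
        = (2 * c * (k + 1)) * (θ (q j) j - θ x₀ j) - 2 * c * (θ (q j) j - θ x₀ j) + c * w j := by
      ring
    rw [hck] at h4
    nlinarith
  have hnk : Module.finrank ℝ W ≤ k := by
    have := Submodule.finrank_le W
    rwa [Module.finrank_fintype_fun_eq_card] at this
  have hgK : ∀ y, θ y - θ x₀ ∈ W → g - θ y ∈ W := fun y hy => by
    have := W.sub_mem hgW hy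
    rwa [sub_sub_sub_cancel_right] at this
  have hyW : ∀ x ∈ K, ∀ s, BoxLe w ε (θ s) → θ (x + s) - θ x₀ ∈ W := fun x hx s hs => by
    have h1 : θ s ∈ W := hW' s 0 W.zero_mem (by rwa [sub_zero])
    have h2 := W.add_mem ((hK _).1 hx).2 h1
    rwa [map_add, add_sub_right_comm]
  refine (hW.card_le hε0 hw0 hη0.le hη3 (K := K) (K' := K') (g := g)
    (fun y hy => hgK y ((hK _).1 hy).2) ?_ ?_).trans ?_
  · intro y hy
    obtain ⟨x, hx, s, rfl, hs⟩ := hK' y hy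
    exact hgK _ (hyW x hx s hs)
  -- Moving by η towards g creates a margin ηc·w j in coordinate j, which absorbs both the
  -- perturbation ε·w j and the rounding error kε·w j. The choice η = 1/(4(k+1)) also keeps (1+2η)^k
  -- ≤ 2.
  · intro y hy τ hτ hbox
    obtain ⟨x, hx, s, rfl, hs⟩ := hK' y hy
    have hmemW : θ (x + s + τ) - θ x₀ ∈ W := by
      have := W.add_mem (hyW x hx s hs) hτ
      rwa [map_add θ (x + s), add_sub_right_comm]
    refine (hK _).2 ⟨(hB _).2 fun j => ?_, hmemW⟩
    have h1 := abs_le.1 (hbox j)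
    have h2 := abs_le.1 (hs j)
    simp only [Pi.sub_apply, Pi.smul_apply, smul_eq_mul, map_add, Pi.add_apply] at h1
    simp only [map_add, Pi.add_apply]
    have h3 : (Module.finrank ℝ W : ℝ) * ε * w j ≤ k * ε * w j := by
      have : (Module.finrank ℝ W : ℝ) ≤ k := by exact_mod_cast hnk
      exact mul_le_mul_of_nonneg_right (mul_le_mul_of_nonneg_right this hε0) (hw0 j)
    have h4 := mul_le_mul_of_nonneg_right hεη (hw0 j)
    have h5 : (1 - η) * (θ x j + θ s j) ≤ (1 - η) * (θ (p j) j + ε * w j) :=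
      mul_le_mul_of_nonneg_left (by linarith [hmax j _ hx]) (by linarith)
    have h6 : (1 - η) * (θ (q j) j - ε * w j) ≤ (1 - η) * (θ x j + θ s j) :=
      mul_le_mul_of_nonneg_left (by linarith [hmin j _ hx]) (by linarith)
    have h7 := mul_le_mul_of_nonneg_left (hgmax j) hη0.le
    have h8 := mul_le_mul_of_nonneg_left (hgmin j) hη0.le
    have h9 : 0 ≤ η * (ε * w j) := mul_nonneg hη0.le (mul_nonneg hε0 (hw0 j))
    have h10 := ((hB _).1 ((hK _).1 (hp j)).1 j).2
    have h11 := ((hB _).1 ((hK _).1 (hq j)).1 j).1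
    constructor <;> nlinarith
  · exact mul_le_mul_of_nonneg_right (one_add_half_inv_pow_le_two hnk) (by positivity)

/-- Strong induction on the dimension of V. Let W be a closed chain space for the actual widths of
K₀. If W = V then K₀ is stable. Otherwise K₀ meets at most (2N+1)^{dim V − dim W} cosets of W, and
the argument is repeated on the coset with the largest sum; the losses telescope. -/
lemma exists_regular_slice_of_closedSpace {θ : L →+ (ι → ℝ)} {u v : ι → ℝ} {B : Finset L}
    (hB : ∀ y, y ∈ B ↔ ∀ i, u i ≤ θ y i ∧ θ y i ≤ v i) (f : L → ℝ) {ε : ℝ} (hε0 : 0 ≤ ε)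
    (hε : 8 * ((Fintype.card ι : ℝ) + 1) ^ 3 * ε ≤ 1) {N : ℕ} (hN : 1 ≤ N)
    (hNε : (Fintype.card ι : ℝ) ≤ N * ε) (n : ℕ) :
    ∀ {V : Submodule ℝ (ι → ℝ)}, Module.finrank ℝ V = n → ∀ {w₀ : ι → ℝ},
      (∀ i, 0 ≤ w₀ i) → ClosedSpace θ w₀ ε V → ∀ {x₀ : L} {K₀ : Finset L}, x₀ ∈ K₀ →
      (∀ y, y ∈ K₀ ↔ y ∈ B ∧ θ y - θ x₀ ∈ V) →
      (∀ x ∈ K₀, ∀ y ∈ K₀, BoxLe w₀ 1 (θ x - θ y)) → 0 < ∑ x ∈ K₀, f x →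
      ∃ (K : Finset L) (w : ι → ℝ), K ⊆ B ∧ (∀ i, 0 ≤ w i) ∧
        (∀ x ∈ K, ∀ y ∈ K, BoxLe w 1 (θ x - θ y)) ∧
        (∀ K' : Finset L, (∀ y ∈ K', ∃ x ∈ K, ∃ s, y = x + s ∧ BoxLe w ε (θ s)) →
          (K'.card : ℝ) ≤ 2 * K.card) ∧
        ∑ x ∈ K₀, f x ≤ (2 * N + 1) ^ n * ∑ x ∈ K, f x := by
  classical
  induction n using Nat.strong_induction_on with
  | _ n ih =>
  intro V hVn w₀ hw₀ hV x₀ K₀ hx₀ hK₀ hbox hpos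
  have hne : K₀.Nonempty := ⟨x₀, hx₀⟩
  choose p hp hmax using fun i => Finset.exists_max_image K₀ (fun y => θ y i) hne
  choose q hq hmin using fun i => Finset.exists_min_image K₀ (fun y => θ y i) hne
  set w : ι → ℝ := fun i => θ (p i) i - θ (q i) i with hw
  have hw0 : ∀ i, 0 ≤ w i := fun i => by rw [hw]; linarith [hmax i _ (hq i)]
  have hww₀ : ∀ i, w i ≤ w₀ i := fun i => by
    have := (le_abs_self _).trans (hbox _ (hp i) _ (hq i) i)
    rwa [one_mul] at this
  have hKw : ∀ x ∈ K₀, ∀ y ∈ K₀, BoxLe w 1 (θ x - θ y) := by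
    intro x hx y hy i
    rw [one_mul, Pi.sub_apply, abs_le]
    have h1 := hmax i x hx
    have h2 := hmax i y hy
    have h3 := hmin i x hx
    have h4 := hmin i y hy
    simp only [hw]
    constructor <;> linarith
  obtain ⟨W, hW, hW'⟩ := exists_chainSpace_closedSpace θ w ε
  have hWV : W ≤ V := hW.le_closedSpace hε0 hw0 hww₀ hV
  by_cases hrank : Module.finrank ℝ W = Module.finrank ℝ V
  · obtain rfl := Submodule.eq_of_le_of_finrank_eq hWV hrank
    refine ⟨K₀, w, fun y hy => ((hK₀ y).1 hy).1, hw0, hKw, fun K' hK' => ?_, ?_⟩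
    · exact card_perturbation_le hB hx₀ hK₀ hp hq (fun i => rfl) hmax hmin hε0 hε hW hW' hK'
    · refine le_mul_of_one_le_left hpos.le (one_le_pow₀ ?_)
      have : (0 : ℝ) ≤ N := by positivity
      linarith
  · have hlt : Module.finrank ℝ W < n := by
      have := Submodule.finrank_mono hWV
      omega
    set π : L → (ι → ℝ) ⧸ W := fun x => W.mkQ (θ x) with hπ
    have hcard := hW'.card_image_mkQ_le hw0 hWV (fun x hx => hKw x hx x₀ hx₀)
      (fun x hx => ((hK₀ x).1 hx).2) hN hNε
    rw [hVn] at hcard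
    set M : ℝ := (2 * (N : ℝ) + 1) ^ (n - Module.finrank ℝ W) with hM
    have hcard' : ((K₀.image π).card : ℝ) ≤ M := by
      rw [hM]; exact_mod_cast hcard
    obtain ⟨c, hc, hcsum⟩ : ∃ c ∈ K₀.image π,
        ∑ x ∈ K₀, f x ≤ M * ∑ x ∈ K₀ with π x = c, f x := by
      by_contra! h
      have h1 := Finset.sum_fiberwise_of_maps_to (s := K₀) (t := K₀.image π) (g := π)
        (fun x hx => Finset.mem_image_of_mem π hx) f
      have hM0 : 0 < M := by rw [hM]; positivity
      have h2 : ∑ c ∈ K₀.image π, M * ∑ x ∈ K₀ with π x = c, f x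
          < ∑ c ∈ K₀.image π, ∑ x ∈ K₀, f x :=
        Finset.sum_lt_sum_of_nonempty (hne.image π) h
      rw [← Finset.mul_sum, h1, Finset.sum_const, nsmul_eq_mul] at h2
      exact absurd (mul_le_mul_of_nonneg_right hcard' hpos.le) (not_le.2 h2)
    obtain ⟨x₁, hx₁, hx₁c⟩ := Finset.mem_image.1 hc
    have hMpos : 0 < M := by rw [hM]; positivity
    have hπ' : ∀ y, π y = c ↔ θ y - θ x₁ ∈ W := by
      intro y
      rw [← hx₁c, hπ, ← sub_eq_zero]
      dsimp only
      rw [← map_sub, ← LinearMap.mem_ker, Submodule.ker_mkQ]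
    obtain ⟨K, w', hKB, hw'0, hKw', hKstab, hKsum⟩ := ih _ hlt rfl hw0 hW' (x₀ := x₁)
      (K₀ := K₀.filter (fun x => π x = c)) (Finset.mem_filter.2 ⟨hx₁, hx₁c⟩) (by
        intro y
        rw [Finset.mem_filter, hK₀, hπ']
        refine ⟨fun h => ⟨h.1.1, h.2⟩, fun h => ⟨⟨h.1, ?_⟩, h.2⟩⟩
        have := V.add_mem (hWV h.2) ((hK₀ _).1 hx₁).2
        rwa [sub_add_sub_cancel] at this)
      (fun x hx y hy => hKw x (Finset.mem_filter.1 hx).1 y (Finset.mem_filter.1 hy).1)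
      (pos_of_mul_pos_right (hpos.trans_le hcsum) hMpos.le)
    refine ⟨K, w', hKB, hw'0, hKw', hKstab, hcsum.trans ?_⟩
    calc _ ≤ M * ((2 * (N : ℝ) + 1) ^ Module.finrank ℝ W * ∑ x ∈ K, f x) :=
          mul_le_mul_of_nonneg_left hKsum hMpos.le
      _ = _ := by
          rw [← mul_assoc, hM, ← pow_add, Nat.sub_add_cancel hlt.le]

/-- A lattice box on which `f` has positive sum contains a slice, stable under perturbations which
are small relative to its widths, on which `f` has a sum not much smaller. -/
lemma exists_regular_slice {θ : L →+ (ι → ℝ)} {u v : ι → ℝ} {B : Finset L}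
    (hB : ∀ y, y ∈ B ↔ ∀ i, u i ≤ θ y i ∧ θ y i ≤ v i) {f : L → ℝ} (hf : 0 < ∑ x ∈ B, f x)
    {ε : ℝ} (hε0 : 0 ≤ ε) (hε : 8 * ((Fintype.card ι : ℝ) + 1) ^ 3 * ε ≤ 1) {N : ℕ} (hN : 1 ≤ N)
    (hNε : (Fintype.card ι : ℝ) ≤ N * ε) :
    ∃ (K : Finset L) (w : ι → ℝ), K ⊆ B ∧ (∀ i, 0 ≤ w i) ∧
      (∀ x ∈ K, ∀ y ∈ K, BoxLe w 1 (θ x - θ y)) ∧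
      (∀ K' : Finset L, (∀ y ∈ K', ∃ x ∈ K, ∃ s, y = x + s ∧ BoxLe w ε (θ s)) →
        (K'.card : ℝ) ≤ 2 * K.card) ∧
      ∑ x ∈ B, f x ≤ (2 * N + 1) ^ Fintype.card ι * ∑ x ∈ K, f x := by
  obtain ⟨x₀, hx₀⟩ : B.Nonempty := by
    rw [Finset.nonempty_iff_ne_empty]
    rintro rfl
    simp at hf
  refine exists_regular_slice_of_closedSpace hB f hε0 hε hN hNε (Fintype.card ι) (V := ⊤)
    (by rw [finrank_top, Module.finrank_fintype_fun_eq_card]) (w₀ := fun i => v i - u i) ?_ ?_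
    hx₀ ?_ ?_ hf
  · intro i
    have := (hB _).1 hx₀ i
    linarith
  · exact fun _ _ _ _ => Submodule.mem_top
  · simp
  · intro x hx y hy i
    have h1 := (hB _).1 hx i
    have h2 := (hB _).1 hy i
    rw [one_mul, Pi.sub_apply, abs_le]
    constructor <;> linarith

end RegularSlices

/-! ### Bohr sets as lattice boxes, and the passage to a regular Bohr set. -/

section PhaseLattice

variable {G : Type*} [AddCommGroup G]

/-- The group of pairs `(x, t)` where `t` is a real lift of the phases of the characters at `x`. -/
def phaseLattice (Γ : Finset (AddChar G ℂ)) : AddSubgroup (G × (Γ → ℝ)) where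
  carrier := {p | ∀ i : Γ, i.1 p.1 = Complex.exp (p.2 i * Complex.I)}
  zero_mem' := by simp
  add_mem' := by
    intro p q hp hq i
    simp only [Prod.fst_add, Prod.snd_add, Pi.add_apply, AddChar.map_add_eq_mul, hp i, hq i,
      Complex.ofReal_add, add_mul, Complex.exp_add]
  neg_mem' := by
    intro p hp i
    simp only [Prod.fst_neg, Prod.snd_neg, Pi.neg_apply, AddChar.map_neg_eq_inv, hp i,
      Complex.ofReal_neg, neg_mul, Complex.exp_neg]

/-- The phases of an element of the phase lattice. -/
def phases (Γ : Finset (AddChar G ℂ)) : phaseLattice Γ →+ (Γ → ℝ) :=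
  (AddMonoidHom.snd G (Γ → ℝ)).comp (phaseLattice Γ).subtype

lemma norm_one_sub_exp_mul_I (t : ℝ) :
    ‖1 - Complex.exp (t * Complex.I)‖ = 2 * |Real.sin (t / 2)| := by
  rw [norm_sub_rev, mul_comm, Complex.norm_exp_I_mul_ofReal_sub_one, Real.norm_eq_abs, abs_mul,
    abs_two]

lemma norm_one_sub_eq_phase {Γ : Finset (AddChar G ℂ)} (p : phaseLattice Γ) (i : Γ) :
    ‖1 - i.1 p.1.1‖ = 2 * |Real.sin (phases Γ p i / 2)| := by
  rw [p.2 i, norm_one_sub_exp_mul_I]; rfl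

lemma norm_one_sub_le_phase {Γ : Finset (AddChar G ℂ)} (p : phaseLattice Γ) (i : Γ) :
    ‖1 - i.1 p.1.1‖ ≤ |phases Γ p i| := by
  rw [norm_one_sub_eq_phase]
  have h := Real.abs_sin_le_abs (x := phases Γ p i / 2)
  rw [abs_div, abs_two] at h
  linarith

variable [Fintype G]

/-- The lift of `x` with all phases in `(-π, π]`. -/
noncomputable def principalLift (Γ : Finset (AddChar G ℂ)) (x : G) : phaseLattice Γ :=
  ⟨(x, fun i => Complex.arg (i.1 x)), fun i => by
    have h := Complex.norm_mul_exp_arg_mul_I (i.1 x)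
    rw [AddChar.norm_apply, Complex.ofReal_one, one_mul] at h
    exact h.symm⟩

lemma abs_phases_principalLift_le (Γ : Finset (AddChar G ℂ)) (x : G) (i : Γ) :
    |phases Γ (principalLift Γ x) i| ≤ Real.pi := Complex.abs_arg_le_pi _

lemma phases_principalLift_le_norm (Γ : Finset (AddChar G ℂ)) (x : G) (i : Γ) :
    |phases Γ (principalLift Γ x) i| ≤ 2 * ‖1 - i.1 x‖ := by
  have h := norm_one_sub_eq_phase (principalLift Γ x) i
  have h1 := abs_phases_principalLift_le Γ x i
  have h2 := Real.mul_abs_le_abs_sin (x := phases Γ (principalLift Γ x) i / 2) (by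
    rw [abs_div, abs_two]; linarith)
  change ‖1 - i.1 x‖ = _ at h
  rw [h]
  rw [abs_div, abs_two] at h2
  have h3 : 1 / 2 ≤ 2 / Real.pi := by
    rw [div_le_div_iff₀ (by norm_num) Real.pi_pos]; linarith [Real.pi_le_four]
  have h4 := mul_le_mul_of_nonneg_right h3
    (show 0 ≤ |phases Γ (principalLift Γ x) i| / 2 by positivity)
  linarith

lemma char_ne_neg_one (hodd : Odd (Fintype.card G)) (γ : AddChar G ℂ) (x : G) : γ x ≠ -1 := by
  intro h
  have h1 : γ x ^ Fintype.card G = 1 := by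
    rw [← AddChar.map_nsmul_eq_pow, card_nsmul_eq_zero, AddChar.map_zero_eq_one]
  rw [h, hodd.neg_one_pow] at h1
  norm_num at h1

/-- Odd order rules out the value −1, the only one with two lifts in [−π, π]. Hence the closed box
of phases contains just the principal lifts, even at width 2. -/
lemma eq_principalLift (hodd : Odd (Fintype.card G)) {Γ : Finset (AddChar G ℂ)}
    {p : phaseLattice Γ} (h : ∀ i, |phases Γ p i| ≤ Real.pi) : p = principalLift Γ p.1.1 := by
  refine Subtype.ext (Prod.ext rfl (funext fun i => ?_))
  change phases Γ p i = Complex.arg (i.1 p.1.1)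
  have hp : i.1 p.1.1 = Complex.exp (phases Γ p i * Complex.I) := p.2 i
  have h1 := abs_le.1 (h i)
  have hne : -Real.pi ≠ phases Γ p i := by
    intro h2
    refine char_ne_neg_one hodd i.1 p.1.1 ?_
    rw [hp, ← h2, Complex.ofReal_neg, neg_mul, Complex.exp_neg, Complex.exp_pi_mul_I]
    norm_num
  rw [hp, ← Complex.log_im, Complex.log_exp]
  · simp
  · simpa using lt_of_le_of_ne h1.1 hne
  · simpa using h1.2

lemma principalLift_box_iff {Γ : Finset (AddChar G ℂ)} {x : G} {i : Γ} {d : ℝ} (h0 : 0 ≤ d)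
    (h2 : d ≤ 2) : ‖1 - i.1 x‖ ≤ d ↔
      |phases Γ (principalLift Γ x) i| ≤ 2 * Real.arcsin (d / 2) := by
  have h := norm_one_sub_eq_phase (principalLift Γ x) i
  change ‖1 - i.1 x‖ = _ at h
  have h1 := abs_phases_principalLift_le Γ x i
  have hs : |Real.sin (phases Γ (principalLift Γ x) i / 2)|
      = Real.sin (|phases Γ (principalLift Γ x) i| / 2) := by
    rw [Real.abs_sin_eq_sin_abs_of_abs_le_pi, abs_div, abs_two]
    rw [abs_div, abs_two]
    linarith [Real.pi_pos]
  rw [h, hs, ← div_le_iff₀' (by norm_num : (0 : ℝ) < 2), Real.le_arcsin_iff_sin_le,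
    le_div_iff₀' (by norm_num : (0 : ℝ) < 2)]
  · constructor
    · linarith [Real.pi_pos, abs_nonneg (phases Γ (principalLift Γ x) i)]
    · linarith
  · constructor <;> linarith

/-- Finiteness gives a gap above 0. The threshold c stands in for slice widths that vanish, since
Bohr widths must be positive. -/
lemma exists_pos_norm_one_sub_le_imp (Γ : Finset (AddChar G ℂ)) :
    ∃ c : ℝ, 0 < c ∧ c ≤ 2 ∧ ∀ γ ∈ Γ, ∀ x : G, ‖1 - γ x‖ ≤ c → ‖1 - γ x‖ = 0 := by
  classical
  set S : Finset ℝ := insert 2 (((Γ ×ˢ Finset.univ).image fun p : AddChar G ℂ × G =>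
    ‖1 - p.1 p.2‖ / 2).filter (0 < ·)) with hS
  have hne : S.Nonempty := ⟨2, Finset.mem_insert_self _ _⟩
  refine ⟨S.min' hne, ?_, Finset.min'_le _ _ (Finset.mem_insert_self _ _), ?_⟩
  · rcases Finset.mem_insert.1 (S.min'_mem hne) with h | h
    · rw [h]; norm_num
    · exact (Finset.mem_filter.1 h).2
  · intro γ hγ x hx
    by_contra h0
    have hpos : 0 < ‖1 - γ x‖ := lt_of_le_of_ne (norm_nonneg _) (Ne.symm h0)
    have := S.min'_le (‖1 - γ x‖ / 2) (Finset.mem_insert_of_mem (Finset.mem_filter.2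
      ⟨Finset.mem_image.2 ⟨(γ, x), Finset.mem_product.2 ⟨hγ, Finset.mem_univ _⟩, rfl⟩,
        by positivity⟩))
    linarith

/-- A Bohr set on which `f` has positive sum contains a slice, stable under perturbations which are
small relative to its widths, on which `f` has a sum not much smaller. -/
lemma exists_bohr_slice (hodd : Odd (Fintype.card G)) {Γ : Finset (AddChar G ℂ)}
    {δ : AddChar G ℂ → ℝ} (hδ0 : ∀ γ ∈ Γ, 0 ≤ δ γ) (hδ2 : ∀ γ ∈ Γ, δ γ ≤ 2) {f : G → ℝ}
    (hf : 0 < ∑ x ∈ bohr Γ δ, f x) {ε : ℝ} (hε0 : 0 < ε) (hε : 8 * ((Γ.card : ℝ) + 1) ^ 3 * ε ≤ 1)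
    {N : ℕ} (hN : 1 ≤ N) (hNε : (Γ.card : ℝ) ≤ N * ε) :
    ∃ (K : Finset G) (w : AddChar G ℂ → ℝ), (∀ γ ∈ Γ, 0 < w γ) ∧ (∀ γ ∈ Γ, w γ ≤ 2) ∧
      (∀ x ∈ K, ∀ y ∈ K, ∀ γ ∈ Γ, ‖1 - γ (x - y)‖ ≤ w γ) ∧
      (∀ K' : Finset G, (∀ y ∈ K', ∃ x ∈ K, ∃ s, y = x + s ∧ ∀ γ ∈ Γ, ‖1 - γ s‖ ≤ ε / 2 * w γ) →
        (K'.card : ℝ) ≤ 2 * K.card) ∧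
      ∑ x ∈ bohr Γ δ, f x ≤ (2 * N + 1) ^ Γ.card * ∑ x ∈ K, f x := by
  classical
  have hB : ∀ p : phaseLattice Γ, p ∈ (bohr Γ δ).image (principalLift Γ) ↔
      ∀ i : Γ, -(2 * Real.arcsin (δ i / 2)) ≤ phases Γ p i ∧
        phases Γ p i ≤ 2 * Real.arcsin (δ i / 2) := by
    intro p
    simp only [← abs_le]
    constructor
    · rw [Finset.mem_image]
      rintro ⟨x, hx, rfl⟩ i
      rw [← principalLift_box_iff (hδ0 _ i.2) (hδ2 _ i.2)]
      exact mem_bohr.1 hx _ i.2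
    · intro h
      have hp := eq_principalLift hodd (p := p) fun i =>
        (h i).trans (by linarith [Real.arcsin_le_pi_div_two (δ i / 2)])
      refine Finset.mem_image.2 ⟨p.1.1, mem_bohr.2 fun γ hγ => ?_, hp.symm⟩
      rw [principalLift_box_iff (i := ⟨γ, hγ⟩) (hδ0 _ hγ) (hδ2 _ hγ), ← hp]
      exact h ⟨γ, hγ⟩
  have hinj : Function.Injective (principalLift Γ) := fun x y h =>
    congrArg (fun p : phaseLattice Γ => p.1.1) h
  have hsum : ∑ p ∈ (bohr Γ δ).image (principalLift Γ), f p.1.1 = ∑ x ∈ bohr Γ δ, f x := by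
    rw [Finset.sum_image fun _ _ _ _ h => hinj h]; rfl
  obtain ⟨K, w, hKB, hw0, hKw, hK, hKf⟩ := exists_regular_slice hB (f := fun p => f p.1.1)
    (by rwa [hsum]) hε0.le (by rwa [Fintype.card_coe]) hN (by rwa [Fintype.card_coe])
  rw [hsum, Fintype.card_coe] at hKf
  have hKinj : Set.InjOn (fun p : phaseLattice Γ => p.1.1) K := by
    intro p hp q hq h
    obtain ⟨x, -, rfl⟩ := Finset.mem_image.1 (hKB hp)
    obtain ⟨y, -, rfl⟩ := Finset.mem_image.1 (hKB hq)
    exact congrArg (principalLift Γ) h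
  obtain ⟨c, hc0, hc2, hc⟩ := exists_pos_norm_one_sub_le_imp Γ
  have hε1 : ε ≤ 1 := by
    have h1 : (1 : ℝ) ≤ ((Γ.card : ℝ) + 1) ^ 3 := one_le_pow₀ (by
      have : (0 : ℝ) ≤ Γ.card := by positivity
      linarith)
    nlinarith
  -- Where c replaces a smaller w, a perturbation within ε/2·c has value exactly 1 at γ and zero
  -- phase, so nothing is lost. The factor ε/2 pays for principal phases being bounded by twice the
  -- chord.
  let w' : AddChar G ℂ → ℝ := fun γ => if h : γ ∈ Γ then min 2 (max (w ⟨γ, h⟩) c) else 0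
  have hw' : ∀ i : Γ, w' i = min 2 (max (w i) c) := fun i => dif_pos i.2
  refine ⟨K.image fun p => p.1.1, w', ?_, ?_, ?_, ?_, ?_⟩
  · intro γ hγ
    rw [hw' ⟨γ, hγ⟩]
    exact lt_min (by norm_num) (lt_max_of_lt_right hc0)
  · intro γ hγ
    rw [hw' ⟨γ, hγ⟩]
    exact min_le_left _ _
  · intro x hx y hy γ hγ
    obtain ⟨p, hp, rfl⟩ := Finset.mem_image.1 hx
    obtain ⟨q, hq, rfl⟩ := Finset.mem_image.1 hy
    rw [hw' ⟨γ, hγ⟩]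
    refine le_min (norm_one_sub_le_two _ _) (le_max_of_le_left ?_)
    refine (norm_one_sub_le_phase (p - q) ⟨γ, hγ⟩).trans ?_
    rw [map_sub]
    simpa using hKw p hp q hq ⟨γ, hγ⟩
  · intro K' hK'
    choose! x hx s hxs hs using hK'
    have hx' : ∀ y ∈ K', ∃ p ∈ K, p.1.1 = x y := fun y hy => Finset.mem_image.1 (hx y hy)
    choose! p hpK hp using hx'
    have hlift : ∀ y ∈ K', (p y + principalLift Γ (s y)).1.1 = y := by
      intro y hy
      conv_rhs => rw [hxs y hy, ← hp y hy]
      rfl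
    have h1 := hK (K'.image fun y => p y + principalLift Γ (s y)) (by
      intro q hq
      obtain ⟨y, hy, rfl⟩ := Finset.mem_image.1 hq
      refine ⟨_, hpK y hy, _, rfl, fun i => ?_⟩
      refine (phases_principalLift_le_norm _ _ _).trans ?_
      have h2 := hs y hy i i.2
      rw [hw'] at h2
      replace h2 : ‖1 - i.1 (s y)‖ ≤ ε / 2 * max (w i) c :=
        h2.trans (mul_le_mul_of_nonneg_left (min_le_right _ _) (by positivity))
      rcases max_choice (w i) c with h3 | h3
      · rw [h3] at h2
        linarith
      · rw [h3] at h2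
        rw [hc i i.2 (s y) (by nlinarith)]
        have := mul_nonneg hε0.le (hw0 i)
        linarith)
    rw [Finset.card_image_of_injOn] at h1
    · rwa [Finset.card_image_of_injOn hKinj]
    · intro y hy y' hy' h
      rw [← hlift y hy, ← hlift y' hy']
      exact congrArg (fun p : phaseLattice Γ => p.1.1) h
  · rwa [Finset.sum_image hKinj]

/-- A dense subset of an arbitrary Bohr set is dense on a translate of a regular Bohr set which is
not much smaller. -/
lemma exists_denseOn_translate (hodd : Odd (Fintype.card G)) {Γ : Finset (AddChar G ℂ)}
    {δ : AddChar G ℂ → ℝ} (hδ0 : ∀ γ ∈ Γ, 0 ≤ δ γ) (hδ2 : ∀ γ ∈ Γ, δ γ ≤ 2) {A : Finset G}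
    {α : ℝ} (hα : 0 < α) (hA : A ⊆ bohr Γ δ) (hAα : α * (bohr Γ δ).card = A.card) {ε : ℝ}
    (hε : 0 < ε) {D J : ℕ} (hΓ : Γ.card ≤ D) (hJ : J = 7 * (D + 1) * ⌈1 / ε⌉₊) :
    ∃ (w : AddChar G ℂ → ℝ) (z : G),
      DenseOn ε (1 / (2 * J)) (α / 4) (pullback (fun x => z + x) A) Γ w ∧
      α / 2 * ((bohr Γ δ).card : ℝ) ≤ (2 * (8 * (Γ.card + 1) ^ 4 : ℕ) + 1) ^ Γ.card
        * ((5 * (32 * (Γ.card + 1) ^ 3 : ℕ)) ^ (2 * Γ.card) * (bohr Γ w).card) := by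
  classical
  set k := Γ.card with hk
  have hk1 : (1 : ℝ) ≤ (k : ℝ) + 1 := by
    have : (0 : ℝ) ≤ k := by positivity
    linarith
  set ε' : ℝ := 1 / (8 * ((k : ℝ) + 1) ^ 3) with hε'
  have hε'0 : 0 < ε' := by positivity
  have hBpos := bohr_card_pos hδ0
  have hsumA : ∑ x ∈ bohr Γ δ, chi A x = A.card := by
    rw [← sum_chi, ← sum_chi_mul]
    exact Finset.sum_congr rfl fun x _ => by rw [mul_comm, chi_mul_of_subset hA]
  -- Subtracting α/2 lets a single sum control two things: positivity on K gives density above α/2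
  -- there, and its magnitude bounds |K| from below.
  have hsum : ∑ x ∈ bohr Γ δ, (chi A x - α / 2) = α / 2 * (bohr Γ δ).card := by
    rw [Finset.sum_sub_distrib, hsumA, ← hAα, Finset.sum_const, nsmul_eq_mul]; ring
  obtain ⟨K, v, hv0, hv2, hKv, hK, hKf⟩ := exists_bohr_slice hodd hδ0 hδ2
    (f := fun x => chi A x - α / 2) (by rw [hsum]; positivity) hε'0
    (le_of_eq (by rw [hε', ← hk]; field_simp)) (N := 8 * (k + 1) ^ 4)
    (Nat.mul_pos (by norm_num) (pow_pos (Nat.succ_pos k) 4)) (by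
      rw [hε']
      push_cast
      rw [mul_one_div, mul_div_mul_left _ _ (by norm_num : (8 : ℝ) ≠ 0),
        show ((k : ℝ) + 1) ^ 4 = ((k : ℝ) + 1) * ((k : ℝ) + 1) ^ 3 by ring, mul_div_assoc,
        div_self (by positivity), mul_one, ← hk]
      linarith)
  rw [hsum, ← hk] at hKf
  have hv' : ∀ γ ∈ Γ, 0 < ((ε' / 2) • v) γ := fun γ hγ => by
    have := hv0 γ hγ
    simp only [Pi.smul_apply, smul_eq_mul]
    positivity
  obtain ⟨l, hl1, hl2, hreg⟩ := exists_regularBohr Γ hv' hε hΓ hJ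
  set w := l • (ε' / 2) • v with hw
  have hwγ : ∀ γ, w γ = l * (ε' / 2 * v γ) := fun γ => rfl
  have hε'1 : ε' ≤ 1 := by
    rw [hε', div_le_one (by positivity)]
    have : (1 : ℝ) ≤ ((k : ℝ) + 1) ^ 3 := one_le_pow₀ hk1
    linarith
  have hw0 : ∀ γ ∈ Γ, 0 < w γ := fun γ hγ => by
    have := hv0 γ hγ
    rw [hwγ]
    have : 0 < l := by linarith
    positivity
  have hwv : ∀ γ ∈ Γ, w γ ≤ ε' / 2 * v γ := fun γ hγ => by
    have := hv0 γ hγ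
    rw [hwγ]
    exact mul_le_of_le_one_left (by positivity) hl2
  have hSpos := bohr_card_pos (Γ := Γ) (w := w) fun γ hγ => (hw0 γ hγ).le
  have hKsum : 0 < ∑ x ∈ K, (chi A x - α / 2) := by
    by_contra! h
    have h1 : (2 * ((8 * (k + 1) ^ 4 : ℕ) : ℝ) + 1) ^ k * ∑ x ∈ K, (chi A x - α / 2) ≤ 0 :=
      mul_nonpos_of_nonneg_of_nonpos (by positivity) h
    have : 0 < α / 2 * ((bohr Γ δ).card : ℝ) := by positivity
    linarith
  have hKA : α / 2 * K.card < ∑ x ∈ K, chi A x := by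
    rw [Finset.sum_sub_distrib, Finset.sum_const, nsmul_eq_mul] at hKsum
    linarith
  obtain ⟨x₀, hx₀⟩ : K.Nonempty := by
    rw [Finset.nonempty_iff_ne_empty]
    rintro rfl
    simp at hKsum
  set S := bohr Γ w with hS
  -- Since |K + S| ≤ 2|K|, averaging over centres in K + S halves the density at worst, giving α/4
  -- on some translate of S.
  set K' := (K ×ˢ S).image fun p => p.1 + p.2 with hK'
  have hK'card : (K'.card : ℝ) ≤ 2 * K.card := by
    refine hK K' fun y hy => ?_
    obtain ⟨⟨x, s⟩, hxs, rfl⟩ := Finset.mem_image.1 hy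
    obtain ⟨hx, hs⟩ := Finset.mem_product.1 hxs
    exact ⟨x, hx, s, rfl, fun γ hγ => (mem_bohr.1 hs γ hγ).trans (hwv γ hγ)⟩
  have h0S : (0 : G) ∈ S := zero_mem_bohr fun γ hγ => (hw0 γ hγ).le
  have hdouble : (S.card : ℝ) * ∑ x ∈ K, chi A x ≤ ∑ y ∈ K', ∑ s ∈ S, chi A (y + s) := by
    rw [Finset.sum_comm, ← nsmul_eq_mul]
    refine Finset.card_nsmul_le_sum _ _ _ fun s hs => ?_
    calc ∑ x ∈ K, chi A x = ∑ y ∈ K.image (fun x => x - s), chi A (y + s) := by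
          rw [Finset.sum_image fun _ _ _ _ h => sub_left_injective h]
          exact Finset.sum_congr rfl fun x _ => by rw [sub_add_cancel]
      _ ≤ _ := by
          refine Finset.sum_le_sum_of_subset_of_nonneg ?_ fun _ _ _ => chi_nonneg _ _
          intro y hy
          obtain ⟨x, hx, rfl⟩ := Finset.mem_image.1 hy
          exact Finset.mem_image.2 ⟨(x, -s), Finset.mem_product.2 ⟨hx, neg_mem_bohr.2 hs⟩,
            (sub_eq_add_neg x s).symm⟩
  obtain ⟨z, -, hz⟩ : ∃ z ∈ K', α / 4 * S.card ≤ ∑ s ∈ S, chi A (z + s) := by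
    by_contra! h
    have hne : K'.Nonempty := ⟨x₀ + 0, Finset.mem_image.2
      ⟨(x₀, 0), Finset.mem_product.2 ⟨hx₀, h0S⟩, rfl⟩⟩
    have h1 := Finset.sum_lt_sum_of_nonempty hne h
    rw [Finset.sum_const, nsmul_eq_mul] at h1
    have h2 : (K'.card : ℝ) * (α / 4 * S.card) ≤ 2 * K.card * (α / 4 * S.card) :=
      mul_le_mul_of_nonneg_right hK'card (by positivity)
    have h3 := mul_lt_mul_of_pos_left hKA hSpos
    linarith
  refine ⟨w, z, ⟨hw0, fun γ hγ => ?_, hreg, ?_⟩, ?_⟩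
  · have h1 := hwv γ hγ
    have h2 := hv2 γ hγ
    have h3 := hv0 γ hγ
    nlinarith
  · simp only [chi_pullback]
    exact hz
  · refine hKf.trans (mul_le_mul_of_nonneg_left ?_ (by positivity))
    have h1 : ∑ x ∈ K, (chi A x - α / 2) ≤ K.card := by
      calc ∑ x ∈ K, (chi A x - α / 2) ≤ ∑ x ∈ K, (1 : ℝ) :=
            Finset.sum_le_sum fun x _ => by linarith [chi_le_one A x]
        _ = K.card := by simp
    have h2 : K.card ≤ (bohr Γ v).card := by
      refine Finset.card_le_card_of_injOn (fun x => x - x₀) ?_ fun _ _ _ _ h => sub_left_injective h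
      intro x hx
      exact mem_bohr.2 fun γ hγ => hKv x hx x₀ hx₀ γ hγ
    have h3 := card_bohr_le Γ (w := v) (w' := w) (M := 32 * (k + 1) ^ 3)
      (Nat.mul_pos (by norm_num) (pow_pos (Nat.succ_pos k) 3)) hv0 (by
        intro γ hγ
        have h4 := hv0 γ hγ
        rw [hwγ, hε']
        push_cast
        calc v γ / (32 * ((k : ℝ) + 1) ^ 3)
            = 1 / 2 * (1 / (8 * ((k : ℝ) + 1) ^ 3) / 2 * v γ) := by field_simp; norm_num
          _ ≤ _ := by gcongr)
    calc ∑ x ∈ K, (chi A x - α / 2) ≤ K.card := h1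
      _ ≤ (bohr Γ v).card := by exact_mod_cast h2
      _ ≤ _ := h3

end PhaseLattice

/-! ### Choice of parameters and final estimates. -/

section Assembly

variable {G : Type*} [AddCommGroup G] [Fintype G]

lemma injective_add_self_of_odd (hodd : Odd (Fintype.card G)) :
    Function.Injective fun x : G => x + x := by
  intro x y h
  have h1 : 2 • (x - y) = 0 := by
    rw [two_nsmul]
    have h' : x + x = y + y := h
    rw [sub_add_sub_comm, h', sub_self]
  have h2 : Fintype.card G • (x - y) = 0 := card_nsmul_eq_zero
  have h3 := Nat.dvd_gcd (addOrderOf_dvd_of_nsmul_eq_zero h1) (addOrderOf_dvd_of_nsmul_eq_zero h2)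
  rw [Nat.coprime_two_left.2 hodd, Nat.dvd_one, AddMonoid.addOrderOf_eq_one_iff] at h3
  exact sub_eq_zero.1 h3

lemma apCount_le (A : Finset G) : apCount A ≤ (A.card : ℝ) ^ 2 := by
  calc apCount A ≤ ∑ x, ∑ y, chi A x * chi A (x + y) := by
        refine Finset.sum_le_sum fun x _ => Finset.sum_le_sum fun y _ => ?_
        rw [mul_assoc]
        exact mul_le_of_le_one_left (mul_nonneg (chi_nonneg _ _) (chi_nonneg _ _)) (chi_le_one _ _)
    _ = ∑ x, chi A x * ∑ y, chi A y := by
        refine Finset.sum_congr rfl fun x _ => ?_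
        rw [← Finset.mul_sum]
        exact congrArg _ (Equiv.sum_comp (Equiv.addLeft x) (chi A))
    _ = (A.card : ℝ) ^ 2 := by rw [← Finset.sum_mul, sum_chi, sq]

/-- All constants, densities and ranks are absorbed into powers of y. The passage to a regular Bohr
set contributes 2(2 + 21k) to the exponent; the iteration contributes 13 + 524Dn, where 524 = 4·131
and 5·256·J³ ≤ y^131. -/
lemma card_bohr_sq_le (hodd : Odd (Fintype.card G)) {Γ : Finset (AddChar G ℂ)}
    {δ : AddChar G ℂ → ℝ} (hδ0 : ∀ γ ∈ Γ, 0 ≤ δ γ) (hδ2 : ∀ γ ∈ Γ, δ γ ≤ 2) {A : Finset G}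
    {α y : ℝ} (hα : 0 < α) (hA : A ⊆ bohr Γ δ) (hAα : α * (bohr Γ δ).card = A.card)
    (hy : 2 ≤ y) (hαy : 1 ≤ α * y) (hky : 2 * ((Γ.card : ℝ) + 1) ≤ y) {ε : ℝ} {m n D J : ℕ}
    (hε : 0 < ε) (hεα : ε ≤ (α / 4) ^ 2 / 2000) (hm : 32 ≤ m * (α / 4) ^ 2)
    (hmε : 4 * ε * m ≤ 1 / 5) (hn : 1 < (201 / 200) ^ n * (α / 4)) (hD : Γ.card + n * m ≤ D)
    (hJ : J = 7 * (D + 1) * ⌈1 / ε⌉₊) (hJy : (J : ℝ) ≤ y ^ 40) :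
    ((bohr Γ δ).card : ℝ) ^ 2 ≤ y ^ (17 + 42 * Γ.card + 524 * (D * n)) * apCount A := by
  obtain ⟨w, z, hd, hsize⟩ := exists_denseOn_translate hodd hδ0 hδ2 hα hA hAα hε
    (le_trans (Nat.le_add_right _ _) hD) hJ
  have haps := many_aps_of_denseOn (injective_add_self_of_odd hodd) (by positivity : 0 < α / 4)
    hε hεα hm hmε hJ n le_rfl hn hD hd
  rw [apCount_translate] at haps
  set k := Γ.card with hk
  have hy0 : 0 < y := by linarith
  have hy1 : 1 ≤ y := by linarith
  have hpow : ∀ j : ℕ, (2 : ℝ) ^ j ≤ y ^ j := fun j => pow_le_pow_left₀ (by norm_num) hy j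
  have hap0 : 0 ≤ apCount A := Finset.sum_nonneg fun x _ => Finset.sum_nonneg fun u _ =>
    mul_nonneg (mul_nonneg (chi_nonneg _ _) (chi_nonneg _ _)) (chi_nonneg _ _)
  have hk0 : (0 : ℝ) ≤ k := by positivity
  have hb1 : 2 * ((8 * (k + 1) ^ 4 : ℕ) : ℝ) + 1 ≤ y ^ 5 := by
    push_cast
    have h1 : (2 * ((k : ℝ) + 1)) ^ 4 ≤ y ^ 4 := pow_le_pow_left₀ (by positivity) hky 4
    have h2 : (1 : ℝ) ≤ y ^ 4 := one_le_pow₀ hy1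
    have h3 : y ^ 4 * 2 ≤ y ^ 4 * y := mul_le_mul_of_nonneg_left hy (by positivity)
    calc 2 * (8 * ((k : ℝ) + 1) ^ 4) + 1 = (2 * ((k : ℝ) + 1)) ^ 4 + 1 := by ring
      _ ≤ y ^ 4 * y := by linarith
      _ = y ^ 5 := by ring
  have hb2 : 5 * ((32 * (k + 1) ^ 3 : ℕ) : ℝ) ≤ y ^ 8 := by
    push_cast
    have h1 : (2 * ((k : ℝ) + 1)) ^ 3 ≤ y ^ 3 := pow_le_pow_left₀ (by positivity) hky 3
    calc 5 * (32 * ((k : ℝ) + 1) ^ 3) = 20 * (2 * ((k : ℝ) + 1)) ^ 3 := by ring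
      _ ≤ y ^ 5 * y ^ 3 := by
          refine mul_le_mul ?_ h1 (by positivity) (by positivity)
          linarith [hpow 5]
      _ = y ^ 8 := by ring
  have hb3 : 5 * ((256 * J ^ 3 : ℕ) : ℝ) ≤ y ^ 131 := by
    push_cast
    have h1 : (J : ℝ) ^ 3 ≤ (y ^ 40) ^ 3 := pow_le_pow_left₀ (by positivity) hJy 3
    calc 5 * (256 * (J : ℝ) ^ 3) = 1280 * (J : ℝ) ^ 3 := by ring
      _ ≤ y ^ 11 * (y ^ 40) ^ 3 := by
          refine mul_le_mul ?_ h1 (by positivity) (by positivity)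
          linarith [hpow 11]
      _ = y ^ 131 := by rw [← pow_mul, ← pow_add]
  set b : ℝ := ((bohr Γ δ).card : ℝ) with hb
  set b' : ℝ := ((bohr Γ w).card : ℝ) with hb'
  have hs : b ≤ y ^ (2 + 21 * k) * b' := by
    have h1 : b ≤ y ^ 2 * (α / 2 * b) := by
      have : 1 ≤ y ^ 2 * (α / 2) := by nlinarith
      calc b ≤ y ^ 2 * (α / 2) * b := le_mul_of_one_le_left (by positivity) this
        _ = _ := by ring
    calc b ≤ y ^ 2 * (α / 2 * b) := h1
      _ ≤ y ^ 2 * ((y ^ 5) ^ k * ((y ^ 8) ^ (2 * k) * b')) := by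
          refine mul_le_mul_of_nonneg_left (hsize.trans ?_) (by positivity)
          gcongr
      _ = y ^ (2 + 21 * k) * b' := by
          rw [← pow_mul, ← pow_mul, ← mul_assoc, ← mul_assoc, ← pow_add, ← pow_add]
          congr 2
          ring
  have ha : b' ^ 2 ≤ y ^ (13 + 524 * (D * n)) * apCount A := by
    have h1 : 1 ≤ y ^ 13 * ((α / 4) ^ 3 / 16) := by
      calc (1 : ℝ) ≤ (α * y) ^ 3 := one_le_pow₀ hαy
        _ = 2 ^ 10 * (y ^ 3 * ((α / 4) ^ 3 / 16)) := by ring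
        _ ≤ y ^ 10 * (y ^ 3 * ((α / 4) ^ 3 / 16)) :=
            mul_le_mul_of_nonneg_right (hpow 10) (by positivity)
        _ = _ := by ring
    calc b' ^ 2 ≤ y ^ 13 * ((α / 4) ^ 3 / 16) * b' ^ 2 :=
          le_mul_of_one_le_left (by positivity) h1
      _ = y ^ 13 * ((α / 4) ^ 3 / 16 * b' ^ 2) := by ring
      _ ≤ y ^ 13 * ((y ^ 131) ^ (4 * D * n) * apCount A) := by
          refine mul_le_mul_of_nonneg_left (haps.trans ?_) (by positivity)
          gcongr
      _ = _ := by
          rw [← pow_mul, ← mul_assoc, ← pow_add]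
          congr 2
          ring
  calc b ^ 2 ≤ (y ^ (2 + 21 * k) * b') ^ 2 := pow_le_pow_left₀ (by positivity) hs 2
    _ = y ^ ((2 + 21 * k) * 2) * b' ^ 2 := by rw [mul_pow, pow_mul]
    _ ≤ y ^ ((2 + 21 * k) * 2) * (y ^ (13 + 524 * (D * n)) * apCount A) :=
        mul_le_mul_of_nonneg_left ha (by positivity)
    _ = _ := by
        rw [← mul_assoc, ← pow_add]
        congr 2
        ring

lemma one_half_le_log {y : ℝ} (hy : 2 ≤ y) : 1 / 2 ≤ Real.log y := by
  have h1 := Real.log_two_gt_d9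
  have h2 := Real.log_le_log (by norm_num) hy
  linarith

/-- A choice of parameters for the iteration. -/
lemma exists_iteration_parameters {α : ℝ} (hα : 0 < α) (hα1 : α ≤ 1) (k : ℕ) {y l : ℝ}
    (hy : y = 2 * ((k : ℝ) + (α ^ 2)⁻¹)) (hl : l = Real.log y) :
    ∃ (ε : ℝ) (m n D J : ℕ), 0 < ε ∧ ε ≤ (α / 4) ^ 2 / 2000 ∧ 32 ≤ m * (α / 4) ^ 2 ∧
      4 * ε * m ≤ 1 / 5 ∧ 1 < (201 / 200) ^ n * (α / 4) ∧ k + n * m ≤ D ∧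
      J = 7 * (D + 1) * ⌈1 / ε⌉₊ ∧ (J : ℝ) ≤ y ^ 40 ∧ (n : ℝ) ≤ 507 * l ∧
      (D : ℝ) ≤ 131000 * (y * l) := by
  obtain ⟨a, ha⟩ : ∃ a, a = (α ^ 2)⁻¹ := ⟨_, rfl⟩
  have hα2 : 0 < α ^ 2 := by positivity
  have haα : a * α ^ 2 = 1 := by rw [ha, inv_mul_cancel₀ hα2.ne']
  have ha1 : 1 ≤ a := by
    rw [ha]; exact (one_le_inv₀ hα2).2 (pow_le_one₀ hα.le hα1)
  have hk0 : (0 : ℝ) ≤ k := by positivity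
  rw [← ha] at hy
  have hay : 2 * a ≤ y := by linarith
  have hy2 : 2 ≤ y := by linarith
  have hl2 : 1 / 2 ≤ l := hl ▸ one_half_le_log hy2
  have hly : l ≤ y := by
    rw [hl]
    linarith [Real.log_le_sub_one_of_pos (by linarith : (0 : ℝ) < y)]
  have hlog : Real.log (4 / α) ≤ 5 / 2 * l := by
    have h1 : (4 / α) ^ 2 ≤ y ^ 5 := by
      have h2 : (4 / α) ^ 2 = 16 * a := by rw [div_pow, ha]; norm_num; ring
      rw [h2]
      have h3 : (2 : ℝ) ^ 4 ≤ y ^ 4 := pow_le_pow_left₀ (by norm_num) hy2 4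
      calc 16 * a ≤ y ^ 4 * y := by
            refine mul_le_mul (by linarith) (by linarith) (by linarith) (by positivity)
        _ = y ^ 5 := by ring
    have h4 := Real.log_le_log (by positivity) h1
    rw [Real.log_pow, Real.log_pow, ← hl] at h4
    push_cast at h4
    linarith
  have hlog0 : 0 ≤ Real.log (4 / α) := Real.log_nonneg (by rw [le_div_iff₀ hα]; linarith)
  set m := ⌈512 * a⌉₊ with hm
  have hm1 : 512 * a ≤ m := Nat.le_ceil _
  have hm2 : (m : ℝ) ≤ 513 * a := by
    have := Nat.ceil_lt_add_one (by linarith : 0 ≤ 512 * a)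
    linarith
  -- log(201/200) ≥ 1/201, so n steps take the density α/4 past 1; the added 1 makes the inequality
  -- strict.
  set n := ⌈201 * Real.log (4 / α)⌉₊ + 1 with hn
  have hn1 : 201 * Real.log (4 / α) < n := by
    rw [hn]; push_cast
    linarith [Nat.le_ceil (201 * Real.log (4 / α))]
  have hn2 : (n : ℝ) ≤ 507 * l := by
    have := Nat.ceil_lt_add_one (by linarith : 0 ≤ 201 * Real.log (4 / α))
    rw [hn]; push_cast
    linarith
  have hal : 0 ≤ a * l := by nlinarith
  have hD : ((k + n * m : ℕ) : ℝ) ≤ 131000 * (y * l) := by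
    push_cast
    have h1 : (n : ℝ) * m ≤ 507 * l * (513 * a) := mul_le_mul hn2 hm2 (by positivity) (by linarith)
    have h2 : (k : ℝ) * 1 ≤ k * (2 * l) := mul_le_mul_of_nonneg_left (by linarith) hk0
    have h3 : 0 ≤ k * l := by nlinarith
    rw [hy]
    nlinarith
  -- This is exactly (α/4)²/2000, the largest value permitted; then εm is about 512/32000.
  set ε : ℝ := 1 / (32000 * a) with hε
  have hε0 : 0 < ε := by positivity
  have hεa : 32000 * (ε * a) = 1 := by rw [hε]; field_simp
  refine ⟨ε, m, n, k + n * m, 7 * (k + n * m + 1) * ⌈1 / ε⌉₊, hε0, ?_, ?_, ?_, ?_, le_rfl, rfl,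
    ?_, hn2, hD⟩
  · have : α ^ 2 = 1 / a := by rw [ha, one_div, inv_inv]
    rw [div_pow, this, hε, div_div, div_div]
    exact one_div_le_one_div_of_le (by positivity) (by linarith)
  · have := mul_le_mul_of_nonneg_right hm1 hα2.le
    nlinarith
  · have := mul_le_mul_of_nonneg_left hm2 hε0.le
    linarith
  · have h1 : Real.exp (1 / 201) ≤ 201 / 200 := by
      have h2 := Real.one_sub_inv_le_log_of_pos (by norm_num : (0 : ℝ) < 201 / 200)
      rw [← Real.exp_log (by norm_num : (0 : ℝ) < 201 / 200)]
      refine Real.exp_le_exp.2 (le_trans ?_ h2)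
      norm_num
    have h3 : 4 / α < (201 / 200 : ℝ) ^ n := by
      calc 4 / α = Real.exp (Real.log (4 / α)) := (Real.exp_log (by positivity)).symm
        _ < Real.exp (n * (1 / 201)) := Real.exp_lt_exp.2 (by linarith)
        _ = Real.exp (1 / 201) ^ n := Real.exp_nat_mul _ _
        _ ≤ _ := pow_le_pow_left₀ (Real.exp_pos _).le h1 n
    rw [div_lt_iff₀ hα] at h3
    linarith
  · have h1 : (⌈1 / ε⌉₊ : ℝ) ≤ 16001 * y := by
      have h2 := Nat.ceil_lt_add_one (by positivity : 0 ≤ 1 / ε)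
      have h3 : 1 / ε = 32000 * a := by rw [hε, one_div_one_div]
      rw [h3] at h2 ⊢
      linarith
    have h4 : (((k + n * m : ℕ) : ℝ) + 1) ≤ 131001 * y ^ 2 := by
      have h5 : y * l ≤ y * y := mul_le_mul_of_nonneg_left hly (by linarith)
      nlinarith
    have h6 : (2 : ℝ) ^ 37 ≤ y ^ 37 := pow_le_pow_left₀ (by norm_num) hy2 37
    calc ((7 * (k + n * m + 1) * ⌈1 / ε⌉₊ : ℕ) : ℝ)
        = 7 * (((k + n * m : ℕ) : ℝ) + 1) * (⌈1 / ε⌉₊ : ℝ) := by push_cast; ring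
      _ ≤ 7 * (131001 * y ^ 2) * (16001 * y) := by gcongr
      _ = 14673029007 * y ^ 3 := by ring
      _ ≤ y ^ 37 * y ^ 3 := by
          refine mul_le_mul_of_nonneg_right ?_ (by positivity)
          linarith
      _ = y ^ 40 := by ring

/-- Dn carries two logarithms and the conversion from a power of y to an exponential supplies the
third. The constant comes from 524·131000·507·2 < 7·10^10. -/
lemma exponent_mul_log_le {k n D : ℕ} {a y l : ℝ} (ha : 1 ≤ a) (hy : y = 2 * ((k : ℝ) + a))
    (hl : 1 / 2 ≤ l) (hn : (n : ℝ) ≤ 507 * l) (hD : (D : ℝ) ≤ 131000 * (y * l)) :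
    ((17 + 42 * k + 524 * (D * n) : ℕ) : ℝ) * l ≤ 70000000000 * (k + a) * l ^ 3 := by
  have hk0 : (0 : ℝ) ≤ k := by positivity
  have hl2 : 1 ≤ 4 * l ^ 2 := by nlinarith
  have h1 : (D : ℝ) * n ≤ 131000 * (y * l) * (507 * l) :=
    mul_le_mul hD hn (by positivity) (by rw [hy]; positivity)
  have h2 : (17 : ℝ) + 42 * k ≤ 42 * (k + a) := by linarith
  have h3 : 42 * ((k : ℝ) + a) * 1 ≤ 42 * (k + a) * (4 * l ^ 2) :=
    mul_le_mul_of_nonneg_left hl2 (by positivity)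
  have h4 : 0 ≤ ((k : ℝ) + a) * l ^ 2 := by positivity
  have h5 : ((17 + 42 * k + 524 * (D * n) : ℕ) : ℝ) ≤ 70000000000 * (k + a) * l ^ 2 := by
    push_cast
    rw [hy] at h1
    nlinarith
  calc _ ≤ 70000000000 * (k + a) * l ^ 2 * l := mul_le_mul_of_nonneg_right h5 (by linarith)
    _ = _ := by ring

end Assembly

theorem mainTheorem3 :
    ∃ (K : ℝ) (m : ℕ), 0 < K ∧
      ∀ (G : Type*) [AddCommGroup G] [Fintype G], Odd (Fintype.card G) →
        ∀ (B : BohrSet G) (A : Set G) (k : ℕ) (α : ℝ),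
          B.rank = k → A ⊆ B.carrier → 0 < α →
          α = haarProb G A / haarProb G B.carrier →
          ∃ X : ℝ, 0 ≤ X ∧
            X ≤ K * ((k : ℝ) + (α ^ 2)⁻¹) * Real.log (2 * ((k : ℝ) + (α ^ 2)⁻¹)) ^ m ∧
            threeAP (ind A) (ind A) (ind A) = Real.exp (-X) * haarProb G B.carrier ^ 2 := by
  classical
  refine ⟨70000000000, 3, by norm_num, ?_⟩
  rintro G _ _ hodd B A k α rfl hAB hα hαdef
  have hδ0 : ∀ γ ∈ B.freq, 0 ≤ B.width γ := fun γ hγ => (B.width_mem γ hγ).1.le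
  have hδ2 : ∀ γ ∈ B.freq, B.width γ ≤ 2 := fun γ hγ => (B.width_mem γ hγ).2
  obtain ⟨A', rfl⟩ : ∃ A' : Finset G, A = A' := ⟨A.toFinset, by simp⟩
  have hcarrier : B.carrier = (bohr B.freq B.width : Set G) := by
    ext x
    rw [Finset.mem_coe, mem_bohr]
    rfl
  rw [hcarrier] at hAB hαdef ⊢
  rw [Finset.coe_subset] at hAB
  have hG : (0 : ℝ) < Fintype.card G := by exact_mod_cast Fintype.card_pos
  have hb := bohr_card_pos hδ0
  set b : ℝ := ((bohr B.freq B.width).card : ℝ) with hbdef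
  simp only [haarProb, Set.ncard_coe_finset, ← hbdef] at hαdef ⊢
  rw [div_div_div_cancel_right₀ hG.ne'] at hαdef
  have hAα : α * b = A'.card := by rw [hαdef, div_mul_cancel₀ _ hb.ne']
  have hcard : (A'.card : ℝ) ≤ b := Nat.cast_le.2 (Finset.card_le_card hAB)
  have hα1 : α ≤ 1 := by rw [hαdef, div_le_one hb]; exact hcard
  have hα2 : 0 < α ^ 2 := by positivity
  have ha1 : 1 ≤ (α ^ 2)⁻¹ := (one_le_inv₀ hα2).2 (pow_le_one₀ hα.le hα1)
  have hk0 : (0 : ℝ) ≤ B.rank := by positivity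
  obtain ⟨y, hy⟩ : ∃ y, y = 2 * ((B.rank : ℝ) + (α ^ 2)⁻¹) := ⟨_, rfl⟩
  have hy2 : 2 ≤ y := by linarith
  have hαy : 1 ≤ α * y := by
    have h1 : α ^ 2 * (α ^ 2)⁻¹ = 1 := mul_inv_cancel₀ hα2.ne'
    have h2 : α ^ 2 * y ≤ α * y := mul_le_mul_of_nonneg_right (by nlinarith) (by linarith)
    nlinarith
  obtain ⟨ε, m, n, D, J, hε, hεα, hm, hmε, hn, hD, hJ, hJy, hnl, hDl⟩ :=
    exists_iteration_parameters hα hα1 B.rank hy rfl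
  have hmain : b ^ 2 ≤ y ^ (17 + 42 * B.rank + 524 * (D * n)) * apCount A' :=
    card_bohr_sq_le hodd hδ0 hδ2 hα hAB hAα hy2 hαy
      (by rw [hy]; change 2 * ((B.rank : ℝ) + 1) ≤ _; linarith) hε hεα hm hmε hn hD hJ hJy
  have hT : threeAP (ind (A' : Set G)) (ind A') (ind A') = apCount A' / (Fintype.card G : ℝ) ^ 2 := by
    rw [div_eq_inv_mul]; rfl
  have hap : 0 < apCount A' := by
    have : 0 < b ^ 2 := by positivity
    exact pos_of_mul_pos_right (this.trans_le hmain) (by positivity)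
  -- X is determined by the identity. It is nonnegative since a progression is fixed by two of its
  -- points, so the count is at most |A|² ≤ |B|²; the upper bound is `hmain`.
  refine ⟨Real.log (b ^ 2 / apCount A'), Real.log_nonneg ?_, ?_, ?_⟩
  · rw [one_le_div hap]
    exact (apCount_le A').trans (pow_le_pow_left₀ (by positivity) hcard 2)
  · rw [← hy]
    refine le_trans ?_ (exponent_mul_log_le ha1 hy (one_half_le_log hy2) hnl hDl)
    rw [← Real.log_pow]
    refine Real.log_le_log (by positivity) ?_
    rwa [div_le_iff₀ hap]
  · rw [hT, Real.exp_neg, Real.exp_log (by positivity), inv_div, div_pow]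
    field_simp
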